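/- Let $d\ge 2$, let $\rho_0:\mathbb R^d\to[0,1]$ have a bounded fourth derivative, and let $T>0$. For $n\in\mathbb N=\{1,2,\dots\}$ let $(\eta_t)_{t\ge 0}$ be the symmetric simple exclusion process on $\{0,1\}^{\mathbb Z^d}$ accelerated by $n^2$, that is, the process with generator $n^2\mathcal L$, where on local functions $$\mathcal L f(\eta)=\sum_{x\in\mathbb Z^d}\sum_{j=1}^d\big(f(\eta^{x,x+e_j})-f(\eta)\big)$$ and $\eta^{x,y}$ is $\eta$ with the values at $x$ and $y$ exchanged; the process starts from the product Bernoulli measure with $\eta_0(x)=1$ with probability $\rho_0(x/n)$. Put $\bar\eta_t(x)=\eta_t(x)-\mathbb E[\eta_t(x)]$ and $$\phi(t_1,\dots,t_k;x_1,\dots,x_k)=\mathbb E\Big[\prod_{i=1}^k\bar\eta_{t_i}(x_i)\Big].$$ There is a constant $C=C(d,\rho_0,T)>0$ such that, for all $n\geq 1$, all $0<s<t\le T$, all $y\in\mathbb Z^d$ and all pairwise distinct $x_1,x_2,x_3\in\mathbb Z^d$ (one of which may equal $y$), the following bounds hold. If $d=2$: $$|\phi(s,t;y,x_1)|\le C\Big(\frac{\log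 n}{n^2}+\frac1{1+n^2(t-s)}\Big),$$ $$|\phi(s,t,t;y,x_1,x_2)|\le C\Big(\frac{\log n\,\log\log n}{n^3}+\frac1{n\,(1+n^2(t-s))}\Big)\quad\text{provided } n\ge 3,$$ $$|\phi(s,t,t,t;y,x_1,x_2,x_3)|\le C\Big(\frac{\log^2 n}{n^4}+\frac{\log n}{n^2(1+n^2(t-s))}\Big)\quad\text{provided } n\ge 2.$$ If $d\ge 3$: $$|\phi(s,t;y,x_1)|\le C\Big(\frac1{n^2}+\Big(\frac1{1+n^2(t-s)}\Big)^{d/2}\Big),$$ $$|\phi(s,t,t;y,x_1,x_2)|\le C\Big(\frac1{n^3}+\frac1n\Big(\frac1{1+n^2(t-s)}\Big)^{d/2}\Big),$$ $$|\phi(s,t,t,t;y,x_1,x_2,x_3)|\le C\Big(\frac1{n^4}+\frac1{n^2}\Big(\frac1{1+n^2(t-s)}\Big)^{d/2}\Big).$$ -/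

import Mathlib

open MeasureTheory ProbabilityTheory Filter Topology
open scoped NNReal

noncomputable section

namespace SSEP

/-- The lattice `ℤ^d`. -/
abbrev Site (d : ℕ) : Type := Fin d → ℤ

/-- The state space `{0,1}^{ℤ^d}` (`true` means that the site is occupied), with the product
topology and the product σ-algebra. -/
abbrev Config (d : ℕ) : Type := Site d → Bool

/-- The occupation number `η(x) ∈ {0,1}`, as a real number. -/
def occ {d : ℕ} (η : Config d) (x : Site d) : ℝ := if η x then 1 else 0

/-- The `j`-th canonical unit vector of `ℤ^d`. -/
def unitVec {d : ℕ} (j : Fin d) : Site d := Pi.single j 1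

/-- The configuration `η^{x,y}`, in which the values of `η` at `x` and `y` are exchanged. -/
def exchange {d : ℕ} (η : Config d) (x y : Site d) : Config d := fun z => η (Equiv.swap x y z)

/-- A local function: it depends on finitely many coordinates only. -/
def IsLocal {d : ℕ} (f : Config d → ℝ) : Prop := ∃ S : Finset (Site d), DependsOn f (S : Set (Site d))

/-- The generator of the symmetric simple exclusion process,
`(𝓛 f)(η) = ∑_{x ∈ ℤ^d} ∑_{j = 1}^d (f(η^{x,x+e_j}) - f(η))`; for a local function `f` only finitely
many terms of the sum over `x` are nonzero. -/
def generator {d : ℕ} (f : Config d → ℝ) (η : Config d) : ℝ :=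
  ∑' x : Site d, ∑ j : Fin d, (f (exchange η x (x + unitVec j)) - f η)

/-- The product Bernoulli measure on `{0,1}^{ℤ^d}` with marginals `η(x) = 1` with probability
`ρ₀(x/n)`. -/
def initialMeasure {d : ℕ} (ρ₀ : EuclideanSpace ℝ (Fin d) → unitInterval) (n : ℕ) :
    Measure (Config d) :=
  Measure.infinitePi fun x : Site d =>
    bernoulliMeasure true false (ρ₀ (WithLp.toLp 2 fun j => (x j : ℝ) / (n : ℝ)))

/-- Right-continuity with left limits on `[0,∞)`. -/
def IsCadlag {E : Type*} [TopologicalSpace E] (γ : ℝ≥0 → E) : Prop :=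
  ∀ t, ContinuousWithinAt γ (Set.Ici t) t ∧ ∃ l, Tendsto γ (𝓝[<] t) (𝓝 l)

/-- `η = (η_t)_{t ≥ 0}`, defined on the probability space `(Ω, P)`, is a symmetric simple exclusion
process on `ℤ^d` with initial law `μ` and generator `𝓛_n = n² 𝓛`: it has càdlàg paths and solves the
martingale problem for `𝓛_n` on local functions, with respect to its own filtration. -/
structure IsExclusionProcess {d : ℕ} (n : ℕ) (μ : Measure (Config d)) {Ω : Type*}
    [mΩ : MeasurableSpace Ω] (P : Measure Ω) (η : ℝ≥0 → Ω → Config d) : Prop where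
  measurable : ∀ t, Measurable (η t)
  cadlag : ∀ ω, IsCadlag fun t => η t ω
  initial : P.map (η 0) = μ
  martingale : ∀ f : Config d → ℝ, IsLocal f →
    Martingale
      (fun (t : ℝ≥0) (ω : Ω) => f (η t ω) - f (η 0 ω) -
        ∫ r in (0 : ℝ)..t, (n : ℝ) ^ 2 * generator f (η r.toNNReal ω))
      (Filtration.natural η fun t => (measurable t).stronglyMeasurable) P

/-- The centered occupation number `η̄_t(x) = η_t(x) - 𝔼[η_t(x)]`. -/
def centered {d : ℕ} {Ω : Type*} [MeasurableSpace Ω] (P : Measure Ω) (η : ℝ≥0 → Ω → Config d)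
    (t : ℝ≥0) (x : Site d) (ω : Ω) : ℝ :=
  occ (η t ω) x - ∫ ω', occ (η t ω') x ∂P

/-- The correlation function `φ(t₁,…,t_k; x₁,…,x_k) = 𝔼[∏ᵢ η̄_{tᵢ}(xᵢ)]`. -/
def corr {d : ℕ} {Ω : Type*} [MeasurableSpace Ω] (P : Measure Ω) (η : ℝ≥0 → Ω → Config d)
    {k : ℕ} (t : Fin k → ℝ≥0) (x : Fin k → Site d) : ℝ :=
  ∫ ω, ∏ i, centered P η (t i) (x i) ω ∂P

/-- `ρ : ℝ^d → ℝ` is four times differentiable with a bounded fourth derivative. -/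
def HasBoundedFourthDeriv {d : ℕ} (ρ : EuclideanSpace ℝ (Fin d) → ℝ) : Prop :=
  ContDiff ℝ 3 ρ ∧ Differentiable ℝ (iteratedFDeriv ℝ 3 ρ) ∧
    ∃ K : ℝ, ∀ u, ‖iteratedFDeriv ℝ 4 ρ u‖ ≤ K

/-- The quantity `1 / (1 + n² (t - s))`. -/
def decay (n : ℕ) (s t : ℝ≥0) : ℝ := 1 / (1 + (n : ℝ) ^ 2 * ((t : ℝ) - (s : ℝ)))

end SSEP

end

/-! ### Comparison principle for infinite systems of differential inequalities -/

noncomputable section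

namespace SSEP

/-! On the microscopic time scale τ = n²t, the expectations ψ(A) of products of centered occupation
numbers over finite sets A form a closed hierarchy: the time derivative of ψ(A) is the exclusion
generator plus a source. The source lives on neighbouring pairs a, b in A. It is a squared density
gradient times the correlation of A without a and b, plus a density gradient times the difference of
the correlations of A without a and of A without b (`generator_cprod`, `hasDerivAt_microCorr`). The
initial profile is bounded with bounded fourth derivative, hence Lipschitz, and the lattice heat
equation does not increase discrete gradients, so all density gradients are at most δ = L/n. The
product initial law makes the equal-time correlations of nonempty sets vanish at time 0.

A source bounded by S(τ) times the number of neighbouring pairs contributes at most a constant times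
∫ S(r) (1+τ-r)^{-d/2} dr (`exclusion_comparison`). This rests on an inequality of Liggett type,
`exgen_pairSum_le`: pair sums of an even function with its maximum at the origin grow under
exclusion no faster than under independent walks. A constant source costs the factor `ell d τ`,
which is log(1+τ) for d = 2 and bounded for d ≥ 3. In particular the two-point function is O(δ²
ell).

Inserting that size into the source for three points would cost a second factor ell. The heart of
the proof is that the gradient of the two-point function is O(δ²) uniformly in time
(`Hierarchy.abs_gradient_pairExt_le`). The two-point function is extended to the diagonal so that it
solves the equation of two independent walks with a source on neighbouring pairs; the price is that
the source contains a mixed second difference of the solution itself. A reflection argument bounds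
this difference by 1/d times the bound on the source (`FreePair.abs_mixedDiff_le`). Since 1/d ≤ 1/2,
a bootstrap closes and leaves a source of size 2δ². A second reflection argument, restarted at
dyadic times, turns a bounded source into a bounded gradient (`FreePair.abs_gradient_le`). Three
points are then O(δ³ ell), and four points are O(δ⁴ ell²) by plain insertion.

For two times, the centered variable at (s, y) is a bounded weight measurable with respect to the
past, so the same hierarchy runs from time s on. Its initial values are equal-time correlations: of
A ∪ {y} if y ∉ A, and otherwise a combination of those of A and A \ {y}, because the square of a
centered Bernoulli variable is affine in that variable. This larger contribution near y spreads like
the heat kernel and gives the terms with (1+n²(t-s))^{-d/2}. For d = 2 the argument yields log n /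
n³ for two later points, without the iterated logarithm. -/

/-- Comparison principle for a family of differential inequalities on a set `R`: if the right-hand
side is quasi-monotone with bounded coefficients, nonnegativity propagates in time. -/
theorem nonneg_of_quasimonotone {X : Type*} (R : Set X) (u u' : ℝ → X → ℝ) {T K Λ M : ℝ}
    (hK : 0 ≤ K) (hΛ : 0 ≤ Λ)
    (hc : ∀ x ∈ R, ContinuousOn (u · x) (Set.Icc 0 T))
    (hd : ∀ τ ∈ Set.Ioo 0 T, ∀ x ∈ R, HasDerivAt (u · x) (u' τ x) τ)
    (hb : ∀ τ ∈ Set.Icc 0 T, ∀ x ∈ R, -M ≤ u τ x)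
    (h0 : ∀ x ∈ R, 0 ≤ u 0 x)
    (hq : ∀ τ ∈ Set.Ioo 0 T, ∀ x ∈ R, ∀ m : ℝ, 0 ≤ m → (∀ y ∈ R, -m ≤ u τ y) →
      -(K * m) ≤ u' τ x + Λ * u τ x) :
    ∀ τ ∈ Set.Icc 0 T, ∀ x ∈ R, 0 ≤ u τ x := by
  set C : ℝ := |M| * Real.exp (Λ * T) with hC
  have hC0 : 0 ≤ C := by positivity
  -- On an infinite set a negative infimum need not be attained, so Picard iteration replaces the
  -- first-touching argument: the bound of order k, inserted into `hq` and integrated in time, gives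
  -- the one of order k + 1, and the right-hand side tends to zero.
  have key : ∀ k : ℕ, ∀ τ ∈ Set.Icc 0 T, ∀ x ∈ R,
      -(C * ((K * τ) ^ k / k.factorial)) ≤ Real.exp (Λ * τ) * u τ x := by
    intro k
    induction k with
    | zero =>
      intro τ hτ x hx
      have h1 : Real.exp (Λ * τ) ≤ Real.exp (Λ * T) :=
        Real.exp_le_exp.2 (mul_le_mul_of_nonneg_left hτ.2 hΛ)
      have h2 := hb τ hτ x hx
      have h3 : -|M| ≤ u τ x := by linarith [le_abs_self M]
      have h4 : Real.exp (Λ * τ) * -|M| ≤ Real.exp (Λ * τ) * u τ x :=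
        mul_le_mul_of_nonneg_left h3 (Real.exp_pos _).le
      have h5 : |M| * Real.exp (Λ * τ) ≤ C := mul_le_mul_of_nonneg_left h1 (abs_nonneg M)
      simp only [pow_zero, Nat.factorial_zero, Nat.cast_one, div_one, mul_one]
      linarith
    | succ k ih =>
      intro τ hτ x hx
      set w : ℝ → ℝ := fun r => Real.exp (Λ * r) * u r x +
        C * ((K * r) ^ (k + 1) / (k + 1).factorial) with hw
      have hcw : ContinuousOn w (Set.Icc 0 T) := by
        have := hc x hx
        fun_prop
      have hdw : ∀ r ∈ Set.Ioo 0 T, HasDerivAt w (Real.exp (Λ * r) * (u' r x + Λ * u r x) +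
          C * (K * ((K * r) ^ k / k.factorial))) r := by
        intro r hr
        have e1 : HasDerivAt (fun r => Real.exp (Λ * r)) (Real.exp (Λ * r) * Λ) r := by
          simpa using ((hasDerivAt_id r).const_mul Λ).exp
        have e2 : HasDerivAt (fun r : ℝ => (K * r) ^ (k + 1) / ((k + 1).factorial : ℝ))
            (((k + 1 : ℕ) * (K * r) ^ k * K) / (k + 1).factorial) r := by
          simpa using (((hasDerivAt_id r).const_mul K).pow (k + 1)).div_const _
        refine ((e1.mul (hd r hr x hx)).add (e2.const_mul C)).congr_deriv ?_
        rw [Nat.factorial_succ]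
        have : (k.factorial : ℝ) ≠ 0 := by positivity
        have h' : ((k : ℝ) + 1) ≠ 0 := by positivity
        push_cast
        field_simp
        ring
      have hmono : MonotoneOn w (Set.Icc 0 T) := by
        apply monotoneOn_of_deriv_nonneg (convex_Icc 0 T) hcw
        · intro r hr
          rw [interior_Icc] at hr
          exact (hdw r hr).differentiableAt.differentiableWithinAt
        · intro r hr
          rw [interior_Icc] at hr
          rw [(hdw r hr).deriv]
          have hrI : r ∈ Set.Icc 0 T := ⟨hr.1.le, hr.2.le⟩
          -- The deficit allowed at time r by the bound of order k, with the exponential weight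
          -- removed.
          set m : ℝ := Real.exp (-(Λ * r)) * (C * ((K * r) ^ k / k.factorial)) with hm
          have hr0 := hr.1.le
          have hm0 : 0 ≤ m := by positivity
          have hlow : ∀ y ∈ R, -m ≤ u r y := by
            intro y hy
            have := ih r hrI y hy
            have h2 := mul_le_mul_of_nonneg_left this (Real.exp_pos (-(Λ * r))).le
            rw [← mul_assoc (Real.exp (-(Λ * r))) (Real.exp _), ← Real.exp_add] at h2
            simp only [neg_add_cancel, Real.exp_zero, one_mul] at h2
            rw [hm]; linarith
          have h3 := hq r hr x hx m hm0 hlow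
          have h4 := mul_le_mul_of_nonneg_left h3 (Real.exp_pos (Λ * r)).le
          have h5 : Real.exp (Λ * r) * -(K * m) = -(C * (K * ((K * r) ^ k / k.factorial))) := by
            rw [hm]
            have : Real.exp (Λ * r) * Real.exp (-(Λ * r)) = 1 := by
              rw [← Real.exp_add]; simp
            linear_combination (-(C * (K * ((K * r) ^ k / k.factorial)))) * this
          linarith
      have hT : (0 : ℝ) ∈ Set.Icc 0 T := ⟨le_rfl, hτ.1.trans hτ.2⟩
      have h1 := hmono hT hτ hτ.1
      have h2 : 0 ≤ w 0 := by
        simp only [hw, mul_zero, Real.exp_zero, one_mul]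
        have := h0 x hx
        simpa using this
      simp only [hw] at h1 h2
      linarith
  intro τ hτ x hx
  have hlim : Tendsto (fun k : ℕ => -(C * ((K * τ) ^ k / k.factorial))) atTop (𝓝 0) := by
    have := (FloorSemiring.tendsto_pow_div_factorial_atTop (K * τ)).const_mul C
    simpa using this.neg
  have h := le_of_tendsto' hlim fun k => key k τ hτ x hx
  exact nonneg_of_mul_nonneg_right h (Real.exp_pos _)

/-! ### The lattice Laplacian -/

/-- The `2d` unit steps `±e_j`. -/
def dirs (d : ℕ) : Finset (Site d) :=
  Finset.univ.image unitVec ∪ Finset.univ.image fun j => -unitVec j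

/-- The lattice Laplacian. -/
def lap {d : ℕ} (f : Site d → ℝ) (x : Site d) : ℝ := ∑ e ∈ dirs d, (f (x + e) - f x)

theorem unitVec_injective {d : ℕ} : Function.Injective (unitVec : Fin d → Site d) := by
  intro i j h
  by_contra hne
  have := congrFun h i
  simp [unitVec, hne] at this

theorem unitVec_ne_neg {d : ℕ} (i j : Fin d) : (unitVec i : Site d) ≠ -unitVec j := by
  intro h
  have := congrFun h i
  simp only [unitVec, Pi.single_eq_same, Pi.neg_apply, Pi.single_apply] at this
  grind

theorem mem_dirs {d : ℕ} {e : Site d} : e ∈ dirs d ↔ ∃ j, e = unitVec j ∨ e = -unitVec j := by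
  simp only [dirs, Finset.mem_union, Finset.mem_image, Finset.mem_univ, true_and]
  constructor
  · rintro (⟨j, rfl⟩ | ⟨j, rfl⟩)
    · exact ⟨j, Or.inl rfl⟩
    · exact ⟨j, Or.inr rfl⟩
  · rintro ⟨j, rfl | rfl⟩
    · exact Or.inl ⟨j, rfl⟩
    · exact Or.inr ⟨j, rfl⟩

theorem neg_mem_dirs {d : ℕ} {e : Site d} : -e ∈ dirs d ↔ e ∈ dirs d := by
  simp only [mem_dirs]
  constructor
  · rintro ⟨j, h | h⟩
    · exact ⟨j, Or.inr (by rw [← h, neg_neg])⟩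
    · exact ⟨j, Or.inl (neg_injective h)⟩
  · rintro ⟨j, rfl | rfl⟩
    · exact ⟨j, Or.inr rfl⟩
    · exact ⟨j, Or.inl (neg_neg _)⟩

theorem unitVec_mem_dirs {d : ℕ} (j : Fin d) : unitVec j ∈ dirs d := mem_dirs.2 ⟨j, Or.inl rfl⟩

theorem zero_notMem_dirs {d : ℕ} : (0 : Site d) ∉ dirs d := by
  rw [mem_dirs]
  rintro ⟨j, h | h⟩ <;>
  · have := congrFun h j
    simp [unitVec] at this

theorem sum_dirs {d : ℕ} (F : Site d → ℝ) :
    ∑ e ∈ dirs d, F e = ∑ j, (F (unitVec j) + F (-unitVec j)) := by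
  rw [dirs, Finset.sum_union, Finset.sum_image, Finset.sum_image, Finset.sum_add_distrib]
  · intro i _ j _ h
    exact unitVec_injective (neg_injective h)
  · intro i _ j _ h
    exact unitVec_injective h
  · rw [Finset.disjoint_left]
    simp only [Finset.mem_image, Finset.mem_univ, true_and, not_exists]
    rintro _ ⟨i, rfl⟩ j h
    exact unitVec_ne_neg i j h.symm

theorem card_dirs (d : ℕ) : ((dirs d).card : ℝ) = 2 * d := by
  have := sum_dirs (d := d) fun _ => (1 : ℝ)
  simp only [Finset.sum_const, Finset.card_univ, Fintype.card_fin, nsmul_eq_mul, mul_one] at this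
  rw [this]; ring

theorem sum_dirs_neg {d : ℕ} (F : Site d → ℝ) :
    ∑ e ∈ dirs d, F (-e) = ∑ e ∈ dirs d, F e := by
  rw [sum_dirs, sum_dirs]
  simp [add_comm]

theorem lap_eq {d : ℕ} (f : Site d → ℝ) (x : Site d) :
    lap f x = ∑ e ∈ dirs d, f (x + e) - 2 * d * f x := by
  rw [lap, Finset.sum_sub_distrib, Finset.sum_const, nsmul_eq_mul, card_dirs]

theorem lap_add {d : ℕ} (f g : Site d → ℝ) (x : Site d) :
    lap (fun z => f z + g z) x = lap f x + lap g x := by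
  simp only [lap, ← Finset.sum_add_distrib]
  exact Finset.sum_congr rfl fun e _ => by ring

theorem lap_sub {d : ℕ} (f g : Site d → ℝ) (x : Site d) :
    lap (fun z => f z - g z) x = lap f x - lap g x := by
  simp only [lap, ← Finset.sum_sub_distrib]
  exact Finset.sum_congr rfl fun e _ => by ring

theorem lap_const_mul {d : ℕ} (c : ℝ) (f : Site d → ℝ) (x : Site d) :
    lap (fun z => c * f z) x = c * lap f x := by
  simp only [lap, Finset.mul_sum]
  exact Finset.sum_congr rfl fun e _ => by ring

theorem lap_const {d : ℕ} (c : ℝ) (x : Site d) : lap (fun _ => c) x = 0 := by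
  simp [lap]

theorem lap_neg {d : ℕ} (f : Site d → ℝ) (x : Site d) :
    lap (fun z => -f z) x = -lap f x := by
  simp only [lap, ← Finset.sum_neg_distrib]
  exact Finset.sum_congr rfl fun e _ => by ring

theorem lap_comp_add {d : ℕ} (f : Site d → ℝ) (x y : Site d) :
    lap (fun z => f (z + y)) x = lap f (x + y) := by
  simp only [lap]
  exact Finset.sum_congr rfl fun e _ => by rw [add_right_comm]

theorem lap_comp_sub {d : ℕ} (f : Site d → ℝ) (x y : Site d) :
    lap (fun z => f (z - y)) x = lap f (x - y) := by
  simp only [sub_eq_add_neg, lap_comp_add f x (-y)]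

theorem lap_comp_sub_left {d : ℕ} (f : Site d → ℝ) (x y : Site d) :
    lap (fun z => f (y - z)) x = lap f (y - x) := by
  simp only [lap]
  rw [← sum_dirs_neg]
  exact Finset.sum_congr rfl fun e _ => by congr 2; abel

theorem abs_lap_le {d : ℕ} (f : Site d → ℝ) {B : ℝ} (hf : ∀ x, |f x| ≤ B) (x : Site d) :
    |lap f x| ≤ 4 * d * B := by
  rw [lap]
  calc |∑ e ∈ dirs d, (f (x + e) - f x)| ≤ ∑ e ∈ dirs d, |f (x + e) - f x| :=
        Finset.abs_sum_le_sum_abs _ _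
    _ ≤ ∑ e ∈ dirs d, (B + B) := Finset.sum_le_sum fun e _ =>
        (abs_sub _ _).trans (add_le_add (hf _) (hf _))
    _ = 4 * d * B := by rw [Finset.sum_const, nsmul_eq_mul, card_dirs]; ring

/-- Adding the diagonal part leaves only nonnegative coefficients, of total mass 2d. This is the
quasi-monotonicity asked for by `nonneg_of_quasimonotone`. -/
theorem neg_le_lap_add {d : ℕ} (f : Site d → ℝ) {m : ℝ} (hf : ∀ x, -m ≤ f x) (x : Site d) :
    -(2 * d * m) ≤ lap f x + 2 * d * f x := by
  rw [lap_eq]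
  have : ∑ e ∈ dirs d, -m ≤ ∑ e ∈ dirs d, f (x + e) := Finset.sum_le_sum fun e _ => hf _
  rw [Finset.sum_const, nsmul_eq_mul, card_dirs] at this
  linarith

/-- Comparison principle for the lattice heat equation. -/
theorem heat_nonneg {d : ℕ} (u u' : ℝ → Site d → ℝ) {T M : ℝ}
    (hc : ∀ x, ContinuousOn (u · x) (Set.Icc 0 T))
    (hd : ∀ τ ∈ Set.Ioo 0 T, ∀ x, HasDerivAt (u · x) (u' τ x) τ)
    (hb : ∀ τ ∈ Set.Icc 0 T, ∀ x, -M ≤ u τ x)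
    (h0 : ∀ x, 0 ≤ u 0 x)
    (hq : ∀ τ ∈ Set.Ioo 0 T, ∀ x, lap (u τ) x ≤ u' τ x) :
    ∀ τ ∈ Set.Icc 0 T, ∀ x, 0 ≤ u τ x := by
  intro τ hτ x
  refine nonneg_of_quasimonotone Set.univ u u' (T := T) (K := 2 * d) (Λ := 2 * d) (M := M)
    (by positivity) (by positivity) (fun x _ => hc x) (fun τ hτ x _ => hd τ hτ x)
    (fun τ hτ x _ => hb τ hτ x) (fun x _ => h0 x) ?_ τ hτ x trivial
  intro τ hτ x _ m _ hm
  have := neg_le_lap_add (u τ) (fun y => hm y trivial) x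
  linarith [hq τ hτ x]

/-! ### The one-dimensional heat kernel -/

theorem hasDerivAt_integral_exp_neg_mul {a b : ℝ → ℝ} (ha : Continuous a) (hb : Continuous b)
    (c c' τ : ℝ) :
    HasDerivAt (fun τ => ∫ θ in c..c', a θ * Real.exp (-(τ * b θ)))
      (∫ θ in c..c', a θ * (Real.exp (-(τ * b θ)) * -b θ)) τ := by
  refine (intervalIntegral.hasDerivAt_integral_of_dominated_loc_of_deriv_le
    (F := fun τ θ => a θ * Real.exp (-(τ * b θ)))
    (F' := fun τ θ => a θ * (Real.exp (-(τ * b θ)) * -b θ))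
    (bound := fun θ => |a θ| * (Real.exp ((|τ| + 1) * |b θ|) * |b θ|))
    (Metric.ball_mem_nhds τ one_pos) ?_ ?_ ?_ ?_ ?_ ?_).2
  · exact Eventually.of_forall fun x => (by fun_prop : Continuous _).aestronglyMeasurable
  · exact (by fun_prop : Continuous _).intervalIntegrable _ _
  · exact (by fun_prop : Continuous _).aestronglyMeasurable
  · refine Eventually.of_forall fun θ _ x hx => ?_
    rw [norm_mul, norm_mul, norm_neg, Real.norm_eq_abs, Real.norm_eq_abs, Real.norm_eq_abs,
      abs_of_pos (Real.exp_pos _)]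
    gcongr
    have h1 : |x| ≤ |τ| + 1 := by
      rw [Metric.mem_ball, Real.dist_eq] at hx
      calc |x| = |(x - τ) + τ| := by ring_nf
        _ ≤ |x - τ| + |τ| := abs_add_le _ _
        _ ≤ |τ| + 1 := by linarith
    calc -(x * b θ) ≤ |x * b θ| := neg_le_abs _
      _ = |x| * |b θ| := abs_mul _ _
      _ ≤ _ := by gcongr
  · exact (by fun_prop : Continuous _).intervalIntegrable _ _
  · refine Eventually.of_forall fun θ _ x _ => ?_
    have : HasDerivAt (fun x => -(x * b θ)) (-b θ) x := by
      simpa using ((hasDerivAt_id x).mul_const (b θ)).fun_neg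
    exact this.exp.const_mul (a θ)

/-- The heat kernel of the continuous-time simple random walk on `ℤ` (jump rate one to each
neighbour), as a Fourier integral. -/
def q (τ : ℝ) (k : ℤ) : ℝ :=
  (2 * Real.pi)⁻¹ * ∫ θ in (-Real.pi)..Real.pi,
    Real.cos (k * θ) * Real.exp (-(τ * (2 * (1 - Real.cos θ))))

theorem q_neg (τ : ℝ) (k : ℤ) : q τ (-k) = q τ k := by
  simp [q]

/-- The identity cos((k+1)θ) + cos((k-1)θ) = 2 cos θ cos(kθ) turns the symbol 2(1 - cos θ) into a
second difference. -/
theorem hasDerivAt_q (τ : ℝ) (k : ℤ) :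
    HasDerivAt (fun τ => q τ k) (q τ (k + 1) + q τ (k - 1) - 2 * q τ k) τ := by
  refine ((hasDerivAt_integral_exp_neg_mul (a := fun θ => Real.cos (k * θ))
    (b := fun θ => 2 * (1 - Real.cos θ)) (by fun_prop) (by fun_prop) _ _ τ).const_mul
      (2 * Real.pi)⁻¹).congr_deriv ?_
  have hi : ∀ j : ℤ, IntervalIntegrable (fun θ => Real.cos (j * θ) *
      Real.exp (-(τ * (2 * (1 - Real.cos θ))))) volume (-Real.pi) Real.pi := fun j =>
    (by fun_prop : Continuous _).intervalIntegrable _ _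
  have h2 : 2 * q τ k = (2 * Real.pi)⁻¹ * ∫ θ in (-Real.pi)..Real.pi,
      2 * (Real.cos (k * θ) * Real.exp (-(τ * (2 * (1 - Real.cos θ))))) := by
    rw [intervalIntegral.integral_const_mul, q]; ring
  rw [h2, q, q, ← mul_add, ← mul_sub, ← intervalIntegral.integral_add (hi _) (hi _),
    ← intervalIntegral.integral_sub ((hi _).add (hi _)) ((hi _).const_mul 2)]
  congr 1
  refine intervalIntegral.integral_congr fun θ _ => ?_
  have e1 : ((k + 1 : ℤ) : ℝ) * θ = k * θ + θ := by push_cast; ring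
  have e2 : ((k - 1 : ℤ) : ℝ) * θ = k * θ - θ := by push_cast; ring
  simp only [e1, e2, Real.cos_add, Real.cos_sub]
  ring

theorem continuous_q (k : ℤ) : Continuous fun τ => q τ k :=
  continuous_iff_continuousAt.2 fun τ => (hasDerivAt_q τ k).continuousAt

theorem abs_q_le (τ : ℝ) (k : ℤ) : |q τ k| ≤ q τ 0 := by
  have hpi := Real.pi_pos
  rw [q, q, abs_mul, abs_of_pos (by positivity : 0 < (2 * Real.pi)⁻¹)]
  refine mul_le_mul_of_nonneg_left ?_ (by positivity)
  refine (intervalIntegral.abs_integral_le_integral_abs (by linarith)).trans ?_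
  refine intervalIntegral.integral_mono_on (by linarith)
    ((by fun_prop : Continuous _).intervalIntegrable _ _)
    ((by fun_prop : Continuous _).intervalIntegrable _ _) fun θ _ => ?_
  rw [abs_mul, abs_of_pos (Real.exp_pos _)]
  simpa using mul_le_mul_of_nonneg_right (Real.abs_cos_le_one (k * θ)) (Real.exp_pos _).le

theorem q_zero (k : ℤ) : q 0 k = if k = 0 then 1 else 0 := by
  have hpi := Real.pi_pos
  simp only [q, zero_mul, neg_zero, Real.exp_zero, mul_one]
  split_ifs with h
  · subst h
    simp only [Int.cast_zero, zero_mul, Real.cos_zero, intervalIntegral.integral_const,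
      smul_eq_mul, mul_one]
    field_simp
    ring
  · have hk : (k : ℝ) ≠ 0 := by exact_mod_cast h
    rw [intervalIntegral.integral_comp_mul_left (fun x => Real.cos x) hk, integral_cos]
    simp [Real.sin_int_mul_pi]

theorem q_zero_le_one {τ : ℝ} (hτ : 0 ≤ τ) : q τ 0 ≤ 1 := by
  have hpi := Real.pi_pos
  have h : q τ 0 ≤ q 0 0 := by
    rw [q, q]
    refine mul_le_mul_of_nonneg_left ?_ (by positivity)
    refine intervalIntegral.integral_mono_on (by linarith)
      ((by fun_prop : Continuous _).intervalIntegrable _ _)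
      ((by fun_prop : Continuous _).intervalIntegrable _ _) fun θ _ => ?_
    have := Real.cos_le_one θ
    have h2 : 0 ≤ τ * (2 * (1 - Real.cos θ)) := by
      apply mul_nonneg hτ; linarith
    simp only [Int.cast_zero, zero_mul, Real.cos_zero, one_mul, neg_zero, Real.exp_zero]
    exact Real.exp_le_one_iff.2 (by linarith)
  simpa [q_zero] using h

theorem abs_q_le_one {τ : ℝ} (hτ : 0 ≤ τ) (k : ℤ) : |q τ k| ≤ 1 :=
  (abs_q_le τ k).trans (q_zero_le_one hτ)

/-- Positivity is hidden in the oscillating integral; it comes from the comparison principle, the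
initial value being the indicator of the origin. -/
theorem q_nonneg {τ : ℝ} (hτ : 0 ≤ τ) (k : ℤ) : 0 ≤ q τ k := by
  refine nonneg_of_quasimonotone Set.univ q (fun τ k => q τ (k + 1) + q τ (k - 1) - 2 * q τ k)
    (T := τ) (K := 2) (Λ := 2) (M := 1) (by norm_num) (by norm_num)
    (fun k _ => (continuous_q k).continuousOn) (fun τ _ k _ => hasDerivAt_q τ k)
    (fun τ hτ k _ => (abs_le.1 (abs_q_le_one hτ.1 k)).1) (fun k _ => ?_) ?_ τ ⟨hτ, le_rfl⟩ k trivial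
  · rw [q_zero]; split_ifs <;> norm_num
  · intro τ _ k _ m _ h
    linarith [h (k + 1) trivial, h (k - 1) trivial]

/-- The quadratic upper bound for the cosine on [-π, π] makes the Fourier symbol Gaussian; all decay
rates come from here. -/
theorem exp_neg_le {τ θ : ℝ} (hτ : 0 ≤ τ) (hθ : |θ| ≤ Real.pi) :
    Real.exp (-(τ * (2 * (1 - Real.cos θ)))) ≤ Real.exp (-(4 * τ / Real.pi ^ 2) * θ ^ 2) := by
  have h := Real.cos_le_one_sub_mul_cos_sq hθ
  apply Real.exp_le_exp.2
  have h2 : τ * (2 * (2 / Real.pi ^ 2 * θ ^ 2)) ≤ τ * (2 * (1 - Real.cos θ)) := by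
    apply mul_le_mul_of_nonneg_left _ hτ; linarith
  calc _ ≤ -(τ * (2 * (2 / Real.pi ^ 2 * θ ^ 2))) := by linarith
    _ = _ := by ring

theorem interval_gaussian_le {b : ℝ} (hb : 0 < b) :
    ∫ θ in (-Real.pi)..Real.pi, Real.exp (-b * θ ^ 2) ≤ √(Real.pi / b) := by
  have hpi := Real.pi_pos
  rw [← integral_gaussian, intervalIntegral.integral_of_le (by linarith)]
  exact setIntegral_le_integral (integrable_exp_neg_mul_sq hb)
    (Eventually.of_forall fun _ => (Real.exp_pos _).le)

theorem q_zero_le_inv_sqrt {τ : ℝ} (hτ : 0 < τ) : q τ 0 ≤ 1 / √τ := by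
  have hpi := Real.pi_pos
  have h4 := Real.pi_le_four
  have h1 : q τ 0 ≤ (2 * Real.pi)⁻¹ * √(Real.pi / (4 * τ / Real.pi ^ 2)) := by
    rw [q]
    refine mul_le_mul_of_nonneg_left ?_ (by positivity)
    refine le_trans ?_ (interval_gaussian_le (by positivity))
    refine intervalIntegral.integral_mono_on (by linarith)
      ((by fun_prop : Continuous _).intervalIntegrable _ _)
      ((by fun_prop : Continuous _).intervalIntegrable _ _) fun θ hθ => ?_
    simpa using exp_neg_le hτ.le (abs_le.2 ⟨hθ.1, hθ.2⟩)
  refine h1.trans ?_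
  have h2 : Real.pi / (4 * τ / Real.pi ^ 2) ≤ (2 * Real.pi) ^ 2 / τ := by
    rw [div_div_eq_mul_div, div_le_div_iff₀ (by positivity) hτ]
    nlinarith [mul_pos (mul_pos hpi hpi) hτ]
  calc (2 * Real.pi)⁻¹ * √(Real.pi / (4 * τ / Real.pi ^ 2))
      ≤ (2 * Real.pi)⁻¹ * √((2 * Real.pi) ^ 2 / τ) := by gcongr
    _ = 1 / √τ := by
      rw [Real.sqrt_div (by positivity), Real.sqrt_sq (by positivity)]
      field_simp

theorem q_zero_le {τ : ℝ} (hτ : 0 ≤ τ) : q τ 0 ≤ 2 / √(1 + τ) := by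
  have hs : 0 < √(1 + τ) := Real.sqrt_pos.2 (by linarith)
  rcases le_or_gt τ 1 with h | h
  · refine (q_zero_le_one hτ).trans ?_
    rw [le_div_iff₀ hs, one_mul, Real.sqrt_le_left (by norm_num)]
    linarith
  · refine (q_zero_le_inv_sqrt (by linarith)).trans ?_
    rw [div_le_div_iff₀ (Real.sqrt_pos.2 (by linarith)) hs, one_mul]
    rw [Real.sqrt_le_left (by positivity), mul_pow, Real.sq_sqrt (by linarith)]
    linarith

/-- The difference of the two cosines gains a factor |θ|, which under the Gaussian is worth another
τ^{-1/2}. -/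
theorem abs_q_succ_sub_le {τ : ℝ} (hτ : 0 ≤ τ) (k : ℤ) :
    |q τ (k + 1) - q τ k| ≤ 4 / (1 + τ) := by
  have hpi := Real.pi_pos
  have h4 := Real.pi_le_four
  rcases le_or_gt τ 1 with h | h
  · calc |q τ (k + 1) - q τ k| ≤ |q τ (k + 1)| + |q τ k| := abs_sub _ _
      _ ≤ 1 + 1 := add_le_add (abs_q_le_one hτ _) (abs_q_le_one hτ _)
      _ ≤ 4 / (1 + τ) := by rw [le_div_iff₀ (by linarith)]; linarith
  · have hτ0 : 0 < τ := by linarith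
    set b : ℝ := 4 * τ / Real.pi ^ 2 with hb
    have hb0 : 0 < b := by positivity
    have h1 : |q τ (k + 1) - q τ k| ≤ (2 * Real.pi)⁻¹ * (1 / √b * √(Real.pi / (b / 2))) := by
      rw [q, q, ← mul_sub, abs_mul, abs_of_pos (by positivity : 0 < (2 * Real.pi)⁻¹),
        ← intervalIntegral.integral_sub ((by fun_prop : Continuous _).intervalIntegrable _ _)
          ((by fun_prop : Continuous _).intervalIntegrable _ _)]
      refine mul_le_mul_of_nonneg_left ?_ (by positivity)
      refine (intervalIntegral.abs_integral_le_integral_abs (by linarith)).trans ?_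
      calc _ ≤ ∫ θ in (-Real.pi)..Real.pi, 1 / √b * Real.exp (-(b / 2) * θ ^ 2) := by
            refine intervalIntegral.integral_mono_on (by linarith)
              ((by fun_prop : Continuous _).intervalIntegrable _ _)
              ((by fun_prop : Continuous _).intervalIntegrable _ _) fun θ hθ => ?_
            rw [← sub_mul, abs_mul, abs_of_pos (Real.exp_pos _)]
            have e1 : |Real.cos ((k + 1 : ℤ) * θ) - Real.cos (k * θ)| ≤ |θ| := by
              refine (Real.abs_cos_sub_cos_le _ _).trans_eq ?_
              congr 1; push_cast; ring
            have e2 := exp_neg_le hτ (abs_le.2 ⟨hθ.1, hθ.2⟩)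
            rw [← hb] at e2
            -- Half of the Gaussian exponent absorbs the factor |θ|.
            have e3 : √b * |θ| ≤ Real.exp (b / 2 * θ ^ 2) := by
              have hx : (√b * |θ|) ^ 2 = b * θ ^ 2 := by
                rw [mul_pow, Real.sq_sqrt hb0.le, sq_abs]
              have := Real.add_one_le_exp (b / 2 * θ ^ 2)
              nlinarith [sq_nonneg (√b * |θ| - 1)]
            calc |Real.cos ((k + 1 : ℤ) * θ) - Real.cos (k * θ)| *
                  Real.exp (-(τ * (2 * (1 - Real.cos θ))))
                ≤ |θ| * Real.exp (-b * θ ^ 2) := by gcongr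
              _ = 1 / √b * ((√b * |θ|) * Real.exp (-b * θ ^ 2)) := by
                have : √b ≠ 0 := (Real.sqrt_pos.2 hb0).ne'
                field_simp
              _ ≤ 1 / √b * (Real.exp (b / 2 * θ ^ 2) * Real.exp (-b * θ ^ 2)) := by gcongr
              _ = 1 / √b * Real.exp (-(b / 2) * θ ^ 2) := by
                rw [← Real.exp_add]; congr 2; ring
        _ ≤ _ := by
            rw [intervalIntegral.integral_const_mul]
            exact mul_le_mul_of_nonneg_left (interval_gaussian_le (by positivity)) (by positivity)
    refine h1.trans ?_
    have h2 : 1 / √b * √(Real.pi / (b / 2)) = √(2 * Real.pi) / b := by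
      have e : Real.pi / (b / 2) = 2 * Real.pi / b := by field_simp
      rw [e, Real.sqrt_div (by positivity : 0 ≤ 2 * Real.pi), div_mul_div_comm, one_mul, Real.mul_self_sqrt hb0.le]
    have h3 : √(2 * Real.pi) ≤ Real.pi := by
      rw [Real.sqrt_le_left hpi.le]
      nlinarith [Real.pi_gt_three]
    calc (2 * Real.pi)⁻¹ * (1 / √b * √(Real.pi / (b / 2))) = (2 * Real.pi)⁻¹ * (√(2 * Real.pi) / b) := by
          rw [h2]
      _ ≤ (2 * Real.pi)⁻¹ * (Real.pi / b) := by gcongr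
      _ = Real.pi ^ 2 / (8 * τ) := by rw [hb]; field_simp; ring
      _ ≤ 4 / (1 + τ) := by
        rw [div_le_div_iff₀ (by positivity) (by positivity)]
        have hp : Real.pi ^ 2 ≤ 16 := by nlinarith
        nlinarith [mul_le_mul_of_nonneg_right hp (by linarith : (0 : ℝ) ≤ 1 + τ)]

/-- The walk may never jump: e^{2r} q_r(0) is nondecreasing, because what flows in from the
neighbours is nonnegative. -/
theorem exp_le_q_zero {τ : ℝ} (hτ : 0 ≤ τ) : Real.exp (-(2 * τ)) ≤ q τ 0 := by
  have hd : ∀ r : ℝ, HasDerivAt (fun r => Real.exp (2 * r) * q r 0)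
      (Real.exp (2 * r) * (q r 1 + q r (-1))) r := by
    intro r
    have e1 : HasDerivAt (fun r : ℝ => Real.exp (2 * r)) (Real.exp (2 * r) * 2) r := by
      simpa using ((hasDerivAt_id r).const_mul 2).exp
    refine (e1.mul (hasDerivAt_q r 0)).congr_deriv ?_
    simp only [zero_add, zero_sub]; ring
  have hm : MonotoneOn (fun r => Real.exp (2 * r) * q r 0) (Set.Ici 0) := by
    apply monotoneOn_of_deriv_nonneg (convex_Ici 0)
    · exact fun r _ => (hd r).continuousAt.continuousWithinAt
    · exact fun r _ => (hd r).differentiableAt.differentiableWithinAt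
    · intro r hr
      rw [interior_Ici] at hr
      rw [(hd r).deriv]
      have hr0 : (0 : ℝ) ≤ r := le_of_lt hr
      have := q_nonneg hr0 1
      have := q_nonneg hr0 (-1)
      positivity
  have h := hm (Set.mem_Ici.2 le_rfl) (Set.mem_Ici.2 hτ) hτ
  simp only [mul_zero, Real.exp_zero, q_zero, if_true, mul_one] at h
  rw [Real.exp_neg, inv_le_iff_one_le_mul₀ (Real.exp_pos _), mul_comm]
  exact h

/-- By `exp_le_q_zero` the inflow from the origin makes e^{2r} q_r(1) grow at least as fast as r.
The positivity makes the constant `pConst` meaningful. -/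
theorem q_one_one_pos : 0 < q 1 1 := by
  have hd : ∀ r : ℝ, HasDerivAt (fun r => Real.exp (2 * r) * q r 1 - r)
      (Real.exp (2 * r) * (q r 0 + q r 2) - 1) r := by
    intro r
    have e1 : HasDerivAt (fun r : ℝ => Real.exp (2 * r)) (Real.exp (2 * r) * 2) r := by
      simpa using ((hasDerivAt_id r).const_mul 2).exp
    refine ((e1.mul (hasDerivAt_q r 1)).sub (hasDerivAt_id r)).congr_deriv ?_
    norm_num; ring
  have hm : MonotoneOn (fun r => Real.exp (2 * r) * q r 1 - r) (Set.Ici 0) := by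
    apply monotoneOn_of_deriv_nonneg (convex_Ici 0)
    · exact fun r _ => (hd r).continuousAt.continuousWithinAt
    · exact fun r _ => (hd r).differentiableAt.differentiableWithinAt
    · intro r hr
      rw [interior_Ici] at hr
      rw [(hd r).deriv]
      have hr0 : (0 : ℝ) ≤ r := le_of_lt hr
      have h1 := q_nonneg hr0 2
      have h2 := mul_le_mul_of_nonneg_left (exp_le_q_zero hr0) (Real.exp_pos (2 * r)).le
      rw [← Real.exp_add, add_neg_cancel, Real.exp_zero] at h2
      nlinarith [Real.exp_pos (2 * r)]
  have h := hm (Set.mem_Ici.2 le_rfl) (Set.mem_Ici.2 zero_le_one) zero_le_one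
  simp only [q_zero, one_ne_zero, if_false, mul_zero, sub_zero, mul_one] at h
  have : 0 < Real.exp 2 * q 1 1 := by linarith
  exact pos_of_mul_pos_right this (Real.exp_pos 2).le

section

variable {d : ℕ}

/-! ### The heat kernel on the lattice -/

/-- The heat kernel of the continuous-time simple random walk on `ℤ^d` with generator `lap`. -/
def p (τ : ℝ) (z : Site d) : ℝ := ∏ j, q τ (z j)

theorem p_neg (τ : ℝ) (z : Site d) : p τ (-z) = p τ z := by
  simp [p, q_neg]

theorem add_unitVec_apply (z : Site d) (i j : Fin d) :
    (z + unitVec i) j = if j = i then z j + 1 else z j := by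
  by_cases h : j = i <;> simp [unitVec, h]

theorem add_neg_unitVec_apply (z : Site d) (i j : Fin d) :
    (z + -unitVec i) j = if j = i then z j - 1 else z j := by
  by_cases h : j = i
  · subst h; simp [unitVec]; ring
  · simp [unitVec, h]

theorem p_add_unitVec (τ : ℝ) (z : Site d) (i : Fin d) :
    p τ (z + unitVec i) = q τ (z i + 1) * ∏ j ∈ Finset.univ.erase i, q τ (z j) := by
  rw [p, ← Finset.mul_prod_erase _ _ (Finset.mem_univ i), add_unitVec_apply, if_pos rfl]
  congr 1
  exact Finset.prod_congr rfl fun j hj => by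
    rw [add_unitVec_apply, if_neg (Finset.ne_of_mem_erase hj)]

theorem p_add_neg_unitVec (τ : ℝ) (z : Site d) (i : Fin d) :
    p τ (z + -unitVec i) = q τ (z i - 1) * ∏ j ∈ Finset.univ.erase i, q τ (z j) := by
  rw [p, ← Finset.mul_prod_erase _ _ (Finset.mem_univ i), add_neg_unitVec_apply, if_pos rfl]
  congr 1
  exact Finset.prod_congr rfl fun j hj => by
    rw [add_neg_unitVec_apply, if_neg (Finset.ne_of_mem_erase hj)]

theorem p_eq_mul (τ : ℝ) (z : Site d) (i : Fin d) :
    p τ z = q τ (z i) * ∏ j ∈ Finset.univ.erase i, q τ (z j) := by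
  rw [p, ← Finset.mul_prod_erase _ _ (Finset.mem_univ i)]

theorem hasDerivAt_p (τ : ℝ) (z : Site d) :
    HasDerivAt (fun τ => p τ z) (lap (p τ) z) τ := by
  refine (HasDerivAt.fun_finsetProd (u := Finset.univ) fun j _ =>
    hasDerivAt_q τ (z j)).congr_deriv ?_
  rw [lap, sum_dirs]
  refine Finset.sum_congr rfl fun i _ => ?_
  rw [p_add_unitVec, p_add_neg_unitVec, p_eq_mul τ z i, smul_eq_mul]
  ring

theorem continuous_p (z : Site d) : Continuous fun τ => p τ z :=
  continuous_finsetProd _ fun j _ => continuous_q (z j)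

theorem p_zero (z : Site d) : p 0 z = if z = 0 then 1 else 0 := by
  simp only [p, q_zero]
  split_ifs with h
  · subst h; simp
  · obtain ⟨j, hj⟩ := Function.ne_iff.1 h
    exact Finset.prod_eq_zero (Finset.mem_univ j) (if_neg hj)

theorem p_nonneg {τ : ℝ} (hτ : 0 ≤ τ) (z : Site d) : 0 ≤ p τ z :=
  Finset.prod_nonneg fun _ _ => q_nonneg hτ _

theorem p_le_p_zero {τ : ℝ} (hτ : 0 ≤ τ) (z : Site d) : p τ z ≤ p τ (0 : Site d) :=
  Finset.prod_le_prod (fun _ _ => q_nonneg hτ _) fun j _ => (le_abs_self _).trans (abs_q_le τ (z j))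

theorem p_le_one {τ : ℝ} (hτ : 0 ≤ τ) (z : Site d) : p τ z ≤ 1 :=
  Finset.prod_le_one (fun _ _ => q_nonneg hτ _) fun j _ =>
    (le_abs_self _).trans (abs_q_le_one hτ (z j))

theorem abs_p_le_one {τ : ℝ} (hτ : 0 ≤ τ) (z : Site d) : |p τ z| ≤ 1 := by
  rw [abs_of_nonneg (p_nonneg hτ z)]; exact p_le_one hτ z

/-- The decay `(1 + τ)^{-d/2}` of the heat kernel. -/
def heatDecay (d : ℕ) (τ : ℝ) : ℝ := (1 / √(1 + τ)) ^ d

theorem heatDecay_nonneg (d : ℕ) (τ : ℝ) : 0 ≤ heatDecay d τ := by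
  unfold heatDecay; positivity

theorem heatDecay_antitone (d : ℕ) {τ τ' : ℝ} (hτ : 0 ≤ τ) (h : τ ≤ τ') :
    heatDecay d τ' ≤ heatDecay d τ := by
  have : 0 < √(1 + τ) := Real.sqrt_pos.2 (by linarith)
  unfold heatDecay
  gcongr

theorem heatDecay_le_one (d : ℕ) {τ : ℝ} (hτ : 0 ≤ τ) : heatDecay d τ ≤ 1 := by
  have := heatDecay_antitone d le_rfl hτ
  simpa [heatDecay] using this

theorem continuousOn_heatDecay (d : ℕ) : ContinuousOn (heatDecay d) (Set.Ici 0) := by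
  unfold heatDecay
  refine ContinuousOn.pow (ContinuousOn.div continuousOn_const (by fun_prop) fun τ hτ => ?_) d
  exact (Real.sqrt_pos.2 (by linarith [Set.mem_Ici.1 hτ])).ne'

theorem p_le_heatDecay {τ : ℝ} (hτ : 0 ≤ τ) (z : Site d) : p τ z ≤ 2 ^ d * heatDecay d τ := by
  refine (p_le_p_zero hτ z).trans ?_
  calc p τ (0 : Site d) = q τ 0 ^ d := by simp [p]
    _ ≤ (2 / √(1 + τ)) ^ d := pow_le_pow_left₀ (q_nonneg hτ 0) (q_zero_le hτ) d
    _ = 2 ^ d * heatDecay d τ := by rw [heatDecay, ← mul_pow]; congr 1; ring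

theorem abs_p_add_unitVec_sub_le {τ : ℝ} (hτ : 0 ≤ τ) (z : Site d) (i : Fin d) :
    |p τ (z + unitVec i) - p τ z| ≤ 2 ^ (d + 1) * heatDecay (d + 1) τ := by
  rw [p_add_unitVec, p_eq_mul τ z i, ← sub_mul, abs_mul]
  have hs : 0 < √(1 + τ) := Real.sqrt_pos.2 (by linarith)
  have h1 : |∏ j ∈ Finset.univ.erase i, q τ (z j)| ≤ (2 / √(1 + τ)) ^ (d - 1) := by
    rw [Finset.abs_prod]
    refine (Finset.prod_le_prod (fun _ _ => abs_nonneg _) fun j _ =>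
      (abs_q_le τ (z j)).trans (q_zero_le hτ)).trans_eq ?_
    rw [Finset.prod_const, Finset.card_erase_of_mem (Finset.mem_univ i), Finset.card_univ,
      Fintype.card_fin]
  have h2 := abs_q_succ_sub_le hτ (z i)
  have hd : d = (d - 1) + 1 := by have := i.pos; omega
  calc |q τ (z i + 1) - q τ (z i)| * |∏ j ∈ Finset.univ.erase i, q τ (z j)|
      ≤ (4 / (1 + τ)) * (2 / √(1 + τ)) ^ (d - 1) := by gcongr
    _ = (2 / √(1 + τ)) ^ 2 * (2 / √(1 + τ)) ^ (d - 1) := by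
      rw [div_pow _ _ 2, Real.sq_sqrt (by linarith)]; norm_num
    _ = (2 / √(1 + τ)) ^ (d + 1) := by rw [← pow_add]; congr 1; omega
    _ = 2 ^ (d + 1) * heatDecay (d + 1) τ := by rw [heatDecay, ← mul_pow]; congr 1; ring

theorem abs_p_add_sub_le {τ : ℝ} (hτ : 0 ≤ τ) (z : Site d) {e : Site d} (he : e ∈ dirs d) :
    |p τ (z + e) - p τ z| ≤ 2 ^ (d + 1) * heatDecay (d + 1) τ := by
  obtain ⟨j, rfl | rfl⟩ := mem_dirs.1 he
  · exact abs_p_add_unitVec_sub_le hτ z j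
  · have := abs_p_add_unitVec_sub_le hτ (z + -unitVec j) j
    rw [neg_add_cancel_right] at this
    rwa [abs_sub_comm]

/-- A constant `c` with `c p_1(z) ≥ 1` for `z = 0` and for the unit steps. -/
def pConst (d : ℕ) : ℝ := (q 1 1 ^ d)⁻¹

theorem pConst_pos (d : ℕ) : 0 < pConst d := inv_pos.2 (pow_pos q_one_one_pos d)

theorem one_le_pConst_mul {z : Site d} (h : ∀ j, |z j| ≤ 1) : 1 ≤ pConst d * p 1 z := by
  rw [pConst, inv_mul_eq_div, le_div_iff₀ (pow_pos q_one_one_pos d), one_mul]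
  calc q 1 1 ^ d = ∏ _j : Fin d, q 1 1 := by simp
    _ ≤ p 1 z := Finset.prod_le_prod (fun _ _ => q_one_one_pos.le) fun j _ => by
      have h1 := abs_le.1 (h j)
      have h2 : z j = 1 ∨ z j = 0 ∨ z j = -1 := by omega
      rcases h2 with h2 | h2 | h2 <;> rw [h2]
      · exact (le_abs_self _).trans (abs_q_le 1 1)
      · rw [q_neg]

theorem one_le_pConst_mul_zero : 1 ≤ pConst d * p 1 (0 : Site d) :=
  one_le_pConst_mul fun j => by simp

theorem one_le_pConst_mul_dir {e : Site d} (he : e ∈ dirs d) : 1 ≤ pConst d * p 1 e := by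
  apply one_le_pConst_mul
  obtain ⟨i, rfl | rfl⟩ := mem_dirs.1 he <;> intro j <;> by_cases h : j = i <;> simp [unitVec, h]

/-! ### Time integrals of the heat kernel -/

/-- Time occurs both as limit and in the integrand; the two occurrences are separated into a
function of two variables, which is differentiated along the diagonal. -/
theorem hasDerivAt_integral_mul_comp_sub {S k k' : ℝ → ℝ} (hS : Continuous S)
    (hk : ∀ r, HasDerivAt k (k' r) r) (hk' : Continuous k') (τ : ℝ) :
    HasDerivAt (fun τ => ∫ r in (0 : ℝ)..τ, S r * k (τ - r))
      (S τ * k 0 + ∫ r in (0 : ℝ)..τ, S r * k' (τ - r)) τ := by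
  have hkc : Continuous k := continuous_iff_continuousAt.2 fun r => (hk r).continuousAt
  have hmain := hasStrictFDerivAt_uncurry_coprod (𝕜 := ℝ) (u := (τ, τ))
    (f := fun a b : ℝ => ∫ r in (0 : ℝ)..a, S r * k (b - r))
    (f₁ := fun a b => ContinuousLinearMap.toSpanSingleton ℝ (S a * k (b - a)))
    (f₂ := fun a b => ContinuousLinearMap.toSpanSingleton ℝ (∫ r in (0 : ℝ)..a, S r * k' (b - r)))
    ?_ ?_ ?_ ?_
  · have h2 : HasDerivAt (fun t : ℝ => (t, t)) ((1 : ℝ), (1 : ℝ)) τ :=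
      (hasDerivAt_id τ).prodMk (hasDerivAt_id τ)
    have h3 := (hmain.hasFDerivAt.comp_hasDerivAt_of_eq τ h2 rfl)
    refine h3.congr_deriv ?_
    simp [Function.HasUncurry.uncurry]
  · refine Eventually.of_forall fun v => ?_
    have : Continuous fun r => S r * k (v.2 - r) := by fun_prop
    exact (intervalIntegral.integral_hasDerivAt_right (this.intervalIntegrable _ _)
      this.stronglyMeasurable.stronglyMeasurableAtFilter this.continuousAt).hasFDerivAt
  · refine Eventually.of_forall fun v => ?_
    refine HasDerivAt.hasFDerivAt ?_
    have hcb : Continuous fun x : ℝ × ℝ => S x.2 * k' (x.1 - x.2) := by fun_prop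
    obtain ⟨B, hB⟩ := ((isCompact_closedBall v.2 1).prod
      (isCompact_uIcc (a := (0 : ℝ)) (b := v.1))).exists_bound_of_continuousOn hcb.continuousOn
    refine (intervalIntegral.hasDerivAt_integral_of_dominated_loc_of_deriv_le
      (F := fun b r => S r * k (b - r)) (F' := fun b r => S r * k' (b - r))
      (bound := fun _ => B) (Metric.ball_mem_nhds v.2 one_pos) ?_ ?_ ?_ ?_ ?_ ?_).2
    · exact Eventually.of_forall fun x => (by fun_prop : Continuous _).aestronglyMeasurable
    · exact (by fun_prop : Continuous _).intervalIntegrable _ _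
    · exact (by fun_prop : Continuous _).aestronglyMeasurable
    · refine Eventually.of_forall fun r hr x hx => ?_
      exact hB (x, r) ⟨Metric.ball_subset_closedBall hx, Set.uIoc_subset_uIcc hr⟩
    · exact continuous_const.intervalIntegrable _ _
    · refine Eventually.of_forall fun r _ x _ => ?_
      have := (hk (x - r)).comp x ((hasDerivAt_id x).sub_const r)
      simpa using this.const_mul (S r)
  · have : Continuous fun x : ℝ × ℝ => S x.1 * k (x.2 - x.1) := by fun_prop
    exact ((ContinuousLinearMap.toSpanSingletonCLE (𝕜 := ℝ) (E := ℝ)).continuous.comp this).continuousAt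
  · have h1 : Continuous (Function.uncurry fun (x : ℝ × ℝ) (r : ℝ) => S r * k' (x.2 - r)) := by
      unfold Function.uncurry; fun_prop
    have := intervalIntegral.continuous_parametric_intervalIntegral_of_continuous
      (μ := volume) (a₀ := (0 : ℝ)) h1 (s := fun x : ℝ × ℝ => x.1) continuous_fst
    exact ((ContinuousLinearMap.toSpanSingletonCLE (𝕜 := ℝ) (E := ℝ)).continuous.comp this).continuousAt

/-- The solution of the heat equation at double speed with source `S(τ) p_1`. -/
def heatConv (S : ℝ → ℝ) (τ : ℝ) (z : Site d) : ℝ := ∫ r in (0 : ℝ)..τ, S r * p (2 * (τ - r) + 1) z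

theorem intervalIntegrable_mul_p {S : ℝ → ℝ} (hS : Continuous S) (τ a b : ℝ) (z : Site d) :
    IntervalIntegrable (fun r => S r * p (2 * (τ - r) + 1) z) volume a b := by
  have := continuous_p z
  exact (by fun_prop : Continuous _).intervalIntegrable _ _

/-- The speed is doubled because the argument will be the difference of two walks. The kernel p_1
replaces a source on neighbouring sites: `pConst` times p_1 is at least one there, and it stays
within the heat flow. -/
theorem hasDerivAt_heatConv {S : ℝ → ℝ} (hS : Continuous S) (τ : ℝ) (z : Site d) :
    HasDerivAt (fun τ => heatConv S τ z) (S τ * p 1 z + 2 * lap (heatConv S τ) z) τ := by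
  have hp : ∀ r : ℝ, HasDerivAt (fun r => p (2 * r + 1) z) (2 * lap (p (2 * r + 1)) z) r := by
    intro r
    have e : HasDerivAt (fun r : ℝ => 2 * r + 1) 2 r := by
      simpa using ((hasDerivAt_id r).const_mul 2).add_const 1
    refine ((hasDerivAt_p (2 * r + 1) z).comp r e).congr_deriv (mul_comm _ _)
  have hc : Continuous fun r : ℝ => 2 * lap (p (2 * r + 1)) z := by
    unfold lap
    have := fun z : Site d => continuous_p z
    fun_prop
  refine (hasDerivAt_integral_mul_comp_sub hS hp hc τ).congr_deriv ?_
  simp only [mul_zero, zero_add, lap, heatConv, Finset.mul_sum]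
  congr 1
  rw [intervalIntegral.integral_finsetSum]
  · refine Finset.sum_congr rfl fun e _ => ?_
    rw [← intervalIntegral.integral_sub (intervalIntegrable_mul_p hS _ _ _ _)
      (intervalIntegrable_mul_p hS _ _ _ _), ← intervalIntegral.integral_const_mul]
    exact intervalIntegral.integral_congr fun r _ => by ring
  · intro e _
    have := fun z : Site d => continuous_p z
    exact (by fun_prop : Continuous _).intervalIntegrable _ _

theorem heatConv_neg (S : ℝ → ℝ) (τ : ℝ) (z : Site d) : heatConv S τ (-z) = heatConv S τ z := by
  simp [heatConv, p_neg]

theorem heatConv_zero (S : ℝ → ℝ) (z : Site d) : heatConv S 0 z = 0 := by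
  simp [heatConv]

theorem heatConv_nonneg {S : ℝ → ℝ} (h0 : ∀ r, 0 ≤ S r) {τ : ℝ} (hτ : 0 ≤ τ) (z : Site d) :
    0 ≤ heatConv S τ z :=
  intervalIntegral.integral_nonneg hτ fun r hr =>
    mul_nonneg (h0 r) (p_nonneg (by linarith [hr.2]) z)

/-- The maximum at the origin is the hypothesis under which `exgen_pairSum_le` applies. -/
theorem heatConv_le_zero_apply {S : ℝ → ℝ} (hS : Continuous S) (h0 : ∀ r, 0 ≤ S r) {τ : ℝ}
    (hτ : 0 ≤ τ) (z : Site d) : heatConv S τ z ≤ heatConv S τ (0 : Site d) :=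
  intervalIntegral.integral_mono_on hτ (intervalIntegrable_mul_p hS _ _ _ _)
    (intervalIntegrable_mul_p hS _ _ _ _) fun r hr =>
      mul_le_mul_of_nonneg_left (p_le_p_zero (by linarith [hr.2]) z) (h0 r)

theorem continuousOn_heatDecay_sub (d : ℕ) (τ : ℝ) :
    ContinuousOn (fun r => heatDecay d (τ - r)) (Set.Iic τ) :=
  (continuousOn_heatDecay d).comp (by fun_prop) fun r hr => by
    simpa using hr

theorem intervalIntegrable_mul_heatDecay_sub {S : ℝ → ℝ} (d : ℕ) {τ : ℝ} (hτ : 0 ≤ τ)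
    (hS : ContinuousOn S (Set.Icc 0 τ)) :
    IntervalIntegrable (fun r => S r * heatDecay d (τ - r)) volume 0 τ := by
  refine ContinuousOn.intervalIntegrable ?_
  rw [Set.uIcc_of_le hτ]
  exact hS.mul ((continuousOn_heatDecay_sub d τ).mono fun r hr => hr.2)

theorem heatConv_le {S : ℝ → ℝ} (hS : Continuous S) (h0 : ∀ r, 0 ≤ S r) {τ : ℝ}
    (hτ : 0 ≤ τ) (z : Site d) :
    heatConv S τ z ≤ 2 ^ d * ∫ r in (0 : ℝ)..τ, S r * heatDecay d (τ - r) := by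
  rw [← intervalIntegral.integral_const_mul]
  refine intervalIntegral.integral_mono_on hτ (intervalIntegrable_mul_p hS _ _ _ _)
    ((intervalIntegrable_mul_heatDecay_sub d hτ hS.continuousOn).const_mul _) fun r hr => ?_
  have h1 : 0 ≤ τ - r := by linarith [hr.2]
  have h2 := p_le_heatDecay (by linarith : 0 ≤ 2 * (τ - r) + 1) z
  have h3 := heatDecay_antitone d h1 (by linarith : τ - r ≤ 2 * (τ - r) + 1)
  calc S r * p (2 * (τ - r) + 1) z ≤ S r * (2 ^ d * heatDecay d (τ - r)) := by
        refine mul_le_mul_of_nonneg_left (h2.trans ?_) (h0 r)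
        gcongr
    _ = _ := by ring

/-- The time integral `∫₀^τ p_{2r} dr` of the heat kernel. -/
def green (τ : ℝ) (z : Site d) : ℝ := ∫ r in (0 : ℝ)..τ, p (2 * r) z

theorem continuous_p_two_mul (z : Site d) : Continuous fun r => p (2 * r) z :=
  (continuous_p z).comp (by fun_prop)

theorem hasDerivAt_green (τ : ℝ) (z : Site d) : HasDerivAt (fun τ => green τ z) (p (2 * τ) z) τ :=
  intervalIntegral.integral_hasDerivAt_right ((continuous_p_two_mul z).intervalIntegrable _ _)
    (continuous_p_two_mul z).stronglyMeasurable.stronglyMeasurableAtFilter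
    (continuous_p_two_mul z).continuousAt

theorem green_zero (z : Site d) : green 0 z = 0 := by simp [green]

theorem green_nonneg {τ : ℝ} (hτ : 0 ≤ τ) (z : Site d) : 0 ≤ green τ z :=
  intervalIntegral.integral_nonneg hτ fun r hr => p_nonneg (by linarith [hr.1]) z

theorem green_le {τ : ℝ} (hτ : 0 ≤ τ) (z : Site d) : green τ z ≤ τ := by
  have := intervalIntegral.integral_mono_on hτ ((continuous_p_two_mul z).intervalIntegrable _ _)
    (continuous_const.intervalIntegrable (μ := volume) 0 τ)
    fun r hr => p_le_one (by linarith [hr.1] : 0 ≤ 2 * r) z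
  simpa [green] using this

/-- The heat equation integrated in time; the indicator is the initial value of the kernel. -/
theorem two_mul_lap_green (τ : ℝ) (z : Site d) :
    2 * lap (green τ) z = p (2 * τ) z - if z = 0 then 1 else 0 := by
  have hd : ∀ r : ℝ, HasDerivAt (fun r => p (2 * r) z) (2 * lap (p (2 * r)) z) r := by
    intro r
    have e : HasDerivAt (fun r : ℝ => 2 * r) 2 r := by
      simpa using (hasDerivAt_id r).const_mul 2
    exact ((hasDerivAt_p (2 * r) z).comp r e).congr_deriv (mul_comm _ _)
  have hc : Continuous fun r : ℝ => 2 * lap (p (2 * r)) z := by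
    unfold lap
    have := fun z : Site d => continuous_p z
    fun_prop
  have h := intervalIntegral.integral_eq_sub_of_hasDerivAt (a := 0) (b := τ) (fun r _ => hd r)
    (hc.intervalIntegrable _ _)
  rw [mul_zero, p_zero] at h
  rw [← h, intervalIntegral.integral_const_mul]
  congr 1
  simp only [lap, green]
  rw [intervalIntegral.integral_finsetSum]
  · refine Finset.sum_congr rfl fun e _ => ?_
    rw [intervalIntegral.integral_sub ((continuous_p_two_mul _).intervalIntegrable _ _)
      ((continuous_p_two_mul _).intervalIntegrable _ _)]
  · intro e _
    exact ((continuous_p_two_mul _).sub (continuous_p_two_mul _)).intervalIntegrable _ _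

end

section

variable {d : ℕ}

/-! ### The exclusion generator on finite subsets of the lattice -/

/-- The nearest neighbours of a site. -/
def nbr (a : Site d) : Finset (Site d) := (dirs d).map (addLeftEmbedding a)

theorem mem_nbr {a b : Site d} : b ∈ nbr a ↔ b - a ∈ dirs d := by
  simp only [nbr, Finset.mem_map, addLeftEmbedding_apply]
  constructor
  · rintro ⟨e, he, rfl⟩; simpa using he
  · intro h; exact ⟨b - a, h, by abel⟩

theorem mem_nbr_comm {a b : Site d} : b ∈ nbr a ↔ a ∈ nbr b := by
  rw [mem_nbr, mem_nbr, ← neg_mem_dirs, neg_sub]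

theorem self_notMem_nbr (a : Site d) : a ∉ nbr a := by
  rw [mem_nbr, sub_self]; exact zero_notMem_dirs

theorem ne_of_mem_nbr {a b : Site d} (h : b ∈ nbr a) : a ≠ b := by
  rintro rfl; exact self_notMem_nbr a h

theorem sum_nbr (a : Site d) (F : Site d → ℝ) : ∑ b ∈ nbr a, F b = ∑ e ∈ dirs d, F (a + e) := by
  simp [nbr]

theorem lap_eq_sum_nbr (f : Site d → ℝ) (a : Site d) : lap f a = ∑ b ∈ nbr a, (f b - f a) := by
  rw [sum_nbr, lap]

theorem card_nbr (a : Site d) : ((nbr a).card : ℝ) = 2 * d := by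
  rw [nbr, Finset.card_map, card_dirs]

/-- The exclusion generator acting on functions of finite sets of occupied sites. -/
def exgen (f : Finset (Site d) → ℝ) (A : Finset (Site d)) : ℝ :=
  ∑ a ∈ A, ∑ b ∈ nbr a \ A, (f (insert b (A.erase a)) - f A)

/-- The number of ordered pairs of neighbouring sites in `A`. -/
def adjCount (A : Finset (Site d)) : ℝ := ∑ a ∈ A, ∑ _b ∈ nbr a ∩ A, 1

/-- The sum of `g` over the differences of ordered pairs of distinct sites in `A`. -/
def pairSum (g : Site d → ℝ) (A : Finset (Site d)) : ℝ := ∑ a ∈ A, ∑ c ∈ A.erase a, g (a - c)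

theorem card_insert_erase {A : Finset (Site d)} {a b : Site d} (ha : a ∈ A) (hb : b ∉ A) :
    (insert b (A.erase a)).card = A.card := by
  rw [Finset.card_insert_of_notMem fun h => hb (Finset.mem_of_mem_erase h),
    Finset.card_erase_add_one ha]

theorem sum_adj_swap (A : Finset (Site d)) (h : Site d → Site d → ℝ) :
    ∑ a ∈ A, ∑ b ∈ nbr a ∩ A, h a b = ∑ a ∈ A, ∑ b ∈ nbr a ∩ A, h b a := by
  refine Finset.sum_comm' fun x y => ?_
  have := mem_nbr_comm (a := x) (b := y)
  simp only [Finset.mem_inter]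
  tauto

theorem sum_adj_antisymm (A : Finset (Site d)) {h : Site d → Site d → ℝ}
    (hh : ∀ a b, h b a = -h a b) : ∑ a ∈ A, ∑ b ∈ nbr a ∩ A, h a b = 0 := by
  have h1 := sum_adj_swap A h
  have h2 : ∑ a ∈ A, ∑ b ∈ nbr a ∩ A, h b a = -∑ a ∈ A, ∑ b ∈ nbr a ∩ A, h a b := by
    rw [← Finset.sum_neg_distrib]
    refine Finset.sum_congr rfl fun a _ => ?_
    rw [← Finset.sum_neg_distrib]
    exact Finset.sum_congr rfl fun b _ => hh a b
  linarith

theorem sum_nbr_sdiff (A : Finset (Site d)) (a : Site d) (F : Site d → ℝ) :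
    ∑ b ∈ nbr a \ A, F b = ∑ b ∈ nbr a, F b - ∑ b ∈ nbr a ∩ A, F b := by
  rw [← Finset.sum_inter_add_sum_sdiff (nbr a) A F]; ring

theorem pairSum_insert {g : Site d → ℝ} (hg : ∀ z, g (-z) = g z) {A : Finset (Site d)} {b : Site d}
    (hb : b ∉ A) : pairSum g (insert b A) = pairSum g A + 2 * ∑ c ∈ A, g (b - c) := by
  rw [pairSum, Finset.sum_insert hb, Finset.erase_insert hb, pairSum]
  have : ∀ x ∈ A, ∑ c ∈ (insert b A).erase x, g (x - c) = g (b - x) + ∑ c ∈ A.erase x, g (x - c) := by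
    intro x hx
    have hxb : b ≠ x := fun h => hb (h ▸ hx)
    rw [Finset.erase_insert_of_ne hxb, Finset.sum_insert fun h => hb (Finset.mem_of_mem_erase h),
      ← hg (x - b), neg_sub]
  rw [Finset.sum_congr rfl this, Finset.sum_add_distrib]
  ring

/-- With the suppressed jumps onto occupied sites restored, both sides agree. For a suppressed jump
from a to b, the contributions of the sites c cancel by antisymmetry in a and b once c = a is
included; that inclusion leaves 2(g(0) - g(b - a)), which is nonnegative. So the exclusion rule can
only lower the drift of the pair sum. -/
theorem exgen_pairSum_le {g : Site d → ℝ} (hg : ∀ z, g (-z) = g z) (hmax : ∀ z, g z ≤ g 0)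
    (A : Finset (Site d)) : exgen (pairSum g) A ≤ 2 * pairSum (lap g) A := by
  have h1 : exgen (pairSum g) A =
      ∑ a ∈ A, ∑ b ∈ nbr a \ A, 2 * ∑ c ∈ A.erase a, (g (b - c) - g (a - c)) := by
    refine Finset.sum_congr rfl fun a ha => Finset.sum_congr rfl fun b hb => ?_
    have hb' := (Finset.mem_sdiff.1 hb).2
    have e : pairSum g A = pairSum g (insert a (A.erase a)) := by rw [Finset.insert_erase ha]
    rw [e, pairSum_insert hg fun h => hb' (Finset.mem_of_mem_erase h),
      pairSum_insert hg (Finset.notMem_erase a A), Finset.sum_sub_distrib]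
    ring
  have h2 : ∀ a, ∑ b ∈ nbr a, 2 * ∑ c ∈ A.erase a, (g (b - c) - g (a - c)) =
      2 * ∑ c ∈ A.erase a, lap g (a - c) := by
    intro a
    rw [← Finset.mul_sum, Finset.sum_comm]
    congr 1
    refine Finset.sum_congr rfl fun c _ => ?_
    rw [sum_nbr, lap]
    exact Finset.sum_congr rfl fun e _ => by rw [add_sub_right_comm]
  have h3 : ∑ a ∈ A, ∑ b ∈ nbr a ∩ A, 2 * ∑ c ∈ A.erase a, (g (b - c) - g (a - c)) =
      ∑ a ∈ A, ∑ b ∈ nbr a ∩ A, 2 * (g 0 - g (b - a)) := by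
    have e : ∀ a ∈ A, ∀ b ∈ nbr a ∩ A, 2 * ∑ c ∈ A.erase a, (g (b - c) - g (a - c)) =
        2 * ∑ c ∈ A, (g (b - c) - g (a - c)) + 2 * (g 0 - g (b - a)) := by
      intro a ha b _
      rw [← Finset.add_sum_erase A _ ha, sub_self]
      ring
    rw [Finset.sum_congr rfl fun a ha => Finset.sum_congr rfl (e a ha)]
    simp only [Finset.sum_add_distrib]
    rw [sum_adj_antisymm A (h := fun a b => 2 * ∑ c ∈ A, (g (b - c) - g (a - c))), zero_add]
    intro a b
    simp only [Finset.sum_sub_distrib]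
    ring
  have h4 : 0 ≤ ∑ a ∈ A, ∑ b ∈ nbr a ∩ A, 2 * (g 0 - g (b - a)) :=
    Finset.sum_nonneg fun a _ => Finset.sum_nonneg fun b _ => by linarith [hmax (b - a)]
  rw [h1]
  simp only [sum_nbr_sdiff, h2]
  rw [Finset.sum_sub_distrib, h3, pairSum, Finset.mul_sum]
  linarith

/-- For sums over single sites the suppressed jumps cancel exactly, by antisymmetry, so exclusion is
invisible. -/
theorem exgen_sum (h : Site d → ℝ) (A : Finset (Site d)) :
    exgen (fun B => ∑ a ∈ B, h a) A = ∑ a ∈ A, lap h a := by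
  have h1 : exgen (fun B => ∑ a ∈ B, h a) A = ∑ a ∈ A, ∑ b ∈ nbr a \ A, (h b - h a) := by
    refine Finset.sum_congr rfl fun a ha => Finset.sum_congr rfl fun b hb => ?_
    have hb' := (Finset.mem_sdiff.1 hb).2
    simp only
    rw [Finset.sum_insert fun h => hb' (Finset.mem_of_mem_erase h), ← Finset.add_sum_erase A h ha]
    ring
  rw [h1]
  simp only [sum_nbr_sdiff, Finset.sum_sub_distrib (s := A)]
  rw [sum_adj_antisymm A (h := fun a b => h b - h a) fun a b => by ring, sub_zero]
  exact Finset.sum_congr rfl fun a _ => (lap_eq_sum_nbr h a).symm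

theorem exgen_add (f g : Finset (Site d) → ℝ) (A : Finset (Site d)) :
    exgen (fun B => f B + g B) A = exgen f A + exgen g A := by
  simp only [exgen, ← Finset.sum_add_distrib]
  exact Finset.sum_congr rfl fun a _ => Finset.sum_congr rfl fun b _ => by ring

theorem exgen_const_mul (c : ℝ) (f : Finset (Site d) → ℝ) (A : Finset (Site d)) :
    exgen (fun B => c * f B) A = c * exgen f A := by
  simp only [exgen, Finset.mul_sum]
  exact Finset.sum_congr rfl fun a _ => Finset.sum_congr rfl fun b _ => by ring

theorem exgen_neg (f : Finset (Site d) → ℝ) (A : Finset (Site d)) :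
    exgen (fun B => -f B) A = -exgen f A := by
  have := exgen_const_mul (-1) f A
  simpa using this

theorem exgen_const (c : ℝ) (A : Finset (Site d)) : exgen (fun _ => c) A = 0 := by
  simp [exgen]

theorem neg_le_exgen_add {k : ℕ} {f : Finset (Site d) → ℝ} {m : ℝ}
    (hf : ∀ B : Finset (Site d), B.card = k → -m ≤ f B) {A : Finset (Site d)} (hA : A.card = k) :
    -(2 * d * k * m) ≤ exgen f A + 2 * d * k * f A := by
  have h1 : (2 * d * k : ℝ) = ∑ a ∈ A, ∑ b ∈ nbr a, (1 : ℝ) := by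
    simp only [Finset.sum_const, nsmul_eq_mul, mul_one, card_nbr, hA]
    ring
  have h2 : (2 * d * k : ℝ) * (f A + m) = ∑ a ∈ A, ∑ b ∈ nbr a, (f A + m) := by
    rw [h1, Finset.sum_mul]
    simp only [Finset.sum_mul, one_mul]
  have h3 : ∑ a ∈ A, ∑ b ∈ nbr a \ A, (f A + m) ≤ ∑ a ∈ A, ∑ b ∈ nbr a, (f A + m) :=
    Finset.sum_le_sum fun a _ => Finset.sum_le_sum_of_subset_of_nonneg Finset.sdiff_subset
      fun _ _ _ => by linarith [hf A hA]
  have h4 : 0 ≤ exgen f A + ∑ a ∈ A, ∑ b ∈ nbr a \ A, (f A + m) := by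
    rw [exgen, ← Finset.sum_add_distrib]
    refine Finset.sum_nonneg fun a ha => ?_
    rw [← Finset.sum_add_distrib]
    refine Finset.sum_nonneg fun b hb => ?_
    have := hf (insert b (A.erase a)) (by
      rw [card_insert_erase ha (Finset.mem_sdiff.1 hb).2, hA])
    linarith
  linarith

/-- Replaces the indicator of neighbouring pairs by a smooth function of the difference, on which
`exgen_pairSum_le` can act. -/
theorem adjCount_le_pairSum {g : Site d → ℝ} (h0 : ∀ z, 0 ≤ g z) (h1 : ∀ e ∈ dirs d, 1 ≤ g e)
    (A : Finset (Site d)) : adjCount A ≤ pairSum g A := by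
  refine Finset.sum_le_sum fun a _ => ?_
  calc ∑ _b ∈ nbr a ∩ A, (1 : ℝ) ≤ ∑ b ∈ nbr a ∩ A, g (a - b) := Finset.sum_le_sum fun b hb =>
        h1 _ (mem_nbr.1 (mem_nbr_comm.1 (Finset.mem_inter.1 hb).1))
    _ ≤ ∑ b ∈ A.erase a, g (a - b) := by
      refine Finset.sum_le_sum_of_subset_of_nonneg (fun b hb => ?_) fun _ _ _ => h0 _
      rw [Finset.mem_inter] at hb
      exact Finset.mem_erase.2 ⟨(ne_of_mem_nbr hb.1).symm, hb.2⟩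

theorem pairSum_le {g : Site d → ℝ} {B : ℝ} (hB : 0 ≤ B) (hg : ∀ z, g z ≤ B) (A : Finset (Site d)) :
    pairSum g A ≤ A.card ^ 2 * B := by
  calc pairSum g A ≤ ∑ a ∈ A, ∑ c ∈ A, B := Finset.sum_le_sum fun a _ =>
        (Finset.sum_le_sum fun c _ => hg _).trans
          (Finset.sum_le_sum_of_subset_of_nonneg (Finset.erase_subset _ _) fun _ _ _ => hB)
    _ = _ := by simp only [Finset.sum_const, nsmul_eq_mul]; ring

/-- The constant in the comparison of the exclusion dynamics with the heat kernel. -/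
def exConst (d k : ℕ) : ℝ := pConst d * 2 ^ d * (k ^ 2 + k)

theorem exConst_nonneg (d k : ℕ) : 0 ≤ exConst d k := by
  have := pConst_pos d
  unfold exConst; positivity

/-- An explicit supersolution is added to f and the comparison principle is applied on the sets of
size k; size is conserved by the exclusion jumps. -/
theorem exclusion_lower_bound {k : ℕ} {f s : ℝ → Finset (Site d) → ℝ} {S : ℝ → ℝ}
    (hS : Continuous S) (hS0 : ∀ r, 0 ≤ S r) {T α β M : ℝ} (hα : 0 ≤ α) (hβ : 0 ≤ β) (y : Site d)
    (hc : ∀ A : Finset (Site d), A.card = k → ContinuousOn (f · A) (Set.Icc 0 T))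
    (hd : ∀ τ ∈ Set.Ioo 0 T, ∀ A : Finset (Site d), A.card = k →
      HasDerivAt (f · A) (exgen (f τ) A + s τ A) τ)
    (hb : ∀ τ ∈ Set.Icc 0 T, ∀ A : Finset (Site d), A.card = k → -M ≤ f τ A)
    (hs : ∀ τ ∈ Set.Ioo 0 T, ∀ A : Finset (Site d), A.card = k → -(S τ * adjCount A) ≤ s τ A)
    (h0 : ∀ A : Finset (Site d), A.card = k → -(α + if y ∈ A then β else 0) ≤ f 0 A)
    {τ : ℝ} (hτ : τ ∈ Set.Icc 0 T) {A : Finset (Site d)} (hA : A.card = k) :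
    -(α + exConst d k * (∫ r in (0 : ℝ)..τ, S r * heatDecay d (τ - r)) +
      exConst d k * (β * heatDecay d τ)) ≤ f τ A := by
  have hp0 := pConst_pos d
  -- The three terms answer the constant part of the initial bound, the source on neighbouring
  -- pairs, and the excess β on sets containing y. The last kernel starts at time 1, so `pConst`
  -- times it dominates the indicator of y at the start.
  set Ψ : ℝ → Finset (Site d) → ℝ := fun τ A => α + pConst d * pairSum (heatConv S τ) A +
    β * pConst d * ∑ a ∈ A, p (τ + 1) (a - y) with hΨ
  have hΨ0 : ∀ τ, 0 ≤ τ → ∀ A, 0 ≤ Ψ τ A := by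
    intro τ hτ A
    have h1 : 0 ≤ pairSum (heatConv S τ) A := Finset.sum_nonneg fun a _ => Finset.sum_nonneg
      fun c _ => heatConv_nonneg hS0 hτ _
    have h2 : 0 ≤ ∑ a ∈ A, p (τ + 1) (a - y) := Finset.sum_nonneg fun a _ =>
      p_nonneg (by linarith) _
    simp only [hΨ]; positivity
  have hΨd : ∀ τ A, HasDerivAt (Ψ · A) (pConst d * (S τ * pairSum (p 1) A +
      2 * pairSum (lap (heatConv S τ)) A) +
      β * pConst d * ∑ a ∈ A, lap (p (τ + 1)) (a - y)) τ := by
    intro τ A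
    have e1 : HasDerivAt (fun τ => pairSum (heatConv S τ) A) (S τ * pairSum (p 1) A +
        2 * pairSum (lap (heatConv S τ)) A) τ := by
      refine (HasDerivAt.fun_sum fun a _ => HasDerivAt.fun_sum fun c _ =>
        hasDerivAt_heatConv hS τ (a - c)).congr_deriv ?_
      simp only [pairSum, Finset.mul_sum, Finset.sum_add_distrib]
    have e2 : HasDerivAt (fun τ => ∑ a ∈ A, p (τ + 1) (a - y))
        (∑ a ∈ A, lap (p (τ + 1)) (a - y)) τ :=
      HasDerivAt.fun_sum fun a _ => by
        exact ((hasDerivAt_p (τ + 1) (a - y)).comp τ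
          ((hasDerivAt_id τ).add_const 1)).congr_deriv (mul_one _)
    exact ((e1.const_mul _).const_add α).add (e2.const_mul _)
  have hΨe : ∀ τ, 0 ≤ τ → ∀ A, exgen (Ψ τ) A ≤ pConst d * (2 * pairSum (lap (heatConv S τ)) A) +
      β * pConst d * ∑ a ∈ A, lap (p (τ + 1)) (a - y) := by
    intro τ hτ A
    simp only [hΨ, exgen_add, exgen_const_mul, exgen_const, zero_add]
    rw [exgen_sum (fun a => p (τ + 1) (a - y))]
    simp only [lap_comp_sub]
    have := exgen_pairSum_le (g := heatConv S τ) (heatConv_neg S τ)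
      (heatConv_le_zero_apply hS hS0 hτ) A
    gcongr
  have key := nonneg_of_quasimonotone {A : Finset (Site d) | A.card = k}
    (fun τ A => Ψ τ A + f τ A)
    (fun τ A => (pConst d * (S τ * pairSum (p 1) A +
      2 * pairSum (lap (heatConv S τ)) A) +
      β * pConst d * ∑ a ∈ A, lap (p (τ + 1)) (a - y)) + (exgen (f τ) A + s τ A))
    (T := T) (K := 2 * d * k) (Λ := 2 * d * k) (M := M) (by positivity) (by positivity)
    (fun A hA => ((continuous_iff_continuousAt.2 fun r => (hΨd r A).continuousAt).continuousOn).add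
      (hc A hA))
    (fun τ hτ A hA => (hΨd τ A).add (hd τ hτ A hA))
    (fun τ hτ A hA => by linarith [hΨ0 τ hτ.1 A, hb τ hτ A hA])
    ?_ ?_ τ hτ A hA
  · have h1 : pairSum (heatConv S τ) A ≤
        k ^ 2 * (2 ^ d * ∫ r in (0 : ℝ)..τ, S r * heatDecay d (τ - r)) := by
      rw [← hA]
      refine pairSum_le ?_ (heatConv_le hS hS0 hτ.1) A
      exact (heatConv_nonneg hS0 hτ.1 (0 : Site d)).trans (heatConv_le hS hS0 hτ.1 0)
    have h2 : ∑ a ∈ A, p (τ + 1) (a - y) ≤ k * (2 ^ d * heatDecay d τ) := by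
      rw [← hA, ← nsmul_eq_mul, ← Finset.sum_const]
      refine Finset.sum_le_sum fun a _ => ?_
      refine (p_le_heatDecay (by linarith [hτ.1]) _).trans ?_
      have := heatDecay_antitone d hτ.1 (by linarith : τ ≤ τ + 1)
      gcongr
    have h3 : 0 ≤ ∫ r in (0 : ℝ)..τ, S r * heatDecay d (τ - r) :=
      intervalIntegral.integral_nonneg hτ.1 fun r _ => mul_nonneg (hS0 r) (heatDecay_nonneg _ _)
    have h4 := heatDecay_nonneg d τ
    have h5 : Ψ τ A ≤ α + pConst d * (k ^ 2 * (2 ^ d * ∫ r in (0 : ℝ)..τ, S r * heatDecay d (τ - r)))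
        + β * pConst d * (k * (2 ^ d * heatDecay d τ)) := by
      simp only [hΨ]; gcongr
    have h6 : Ψ τ A ≤ α + exConst d k * (∫ r in (0 : ℝ)..τ, S r * heatDecay d (τ - r)) +
        exConst d k * (β * heatDecay d τ) := by
      refine h5.trans ?_
      have e1 : 0 ≤ pConst d * 2 ^ d * k * ∫ r in (0 : ℝ)..τ, S r * heatDecay d (τ - r) := by
        positivity
      have e2 : 0 ≤ pConst d * 2 ^ d * k ^ 2 * (β * heatDecay d τ) := by positivity
      unfold exConst
      linarith
    linarith
  · intro A hA
    have h1 : (if y ∈ A then β else 0) ≤ β * pConst d * ∑ a ∈ A, p (0 + 1) (a - y) := by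
      split_ifs with hy
      · have e1 : p 1 (y - y) ≤ ∑ a ∈ A, p 1 (a - y) :=
          Finset.single_le_sum (f := fun a => p 1 (a - y))
            (fun a _ => p_nonneg zero_le_one _) hy
        rw [sub_self] at e1
        have e2 := one_le_pConst_mul_zero (d := d)
        rw [zero_add, mul_assoc]
        have e3 := mul_le_mul_of_nonneg_left e1 hp0.le
        nlinarith
      · have : 0 ≤ ∑ a ∈ A, p (0 + 1) (a - y) := Finset.sum_nonneg fun a _ =>
          p_nonneg (by norm_num) _
        positivity
    have h2 : pairSum (heatConv S 0) A = 0 := by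
      simp [pairSum, heatConv_zero]
    have := h0 A hA
    simp only [hΨ, h2]
    linarith
  · intro τ hτ A hA m hm hlow
    have h1 := neg_le_exgen_add hlow hA
    rw [exgen_add] at h1
    have h2 := hΨe τ hτ.1.le A
    have h3 := hs τ hτ A hA
    have h4 : adjCount A ≤ pConst d * pairSum (p 1) A := by
      have := adjCount_le_pairSum (g := fun z => pConst d * p 1 z)
        (fun z => mul_nonneg hp0.le (p_nonneg zero_le_one z))
        (fun e he => one_le_pConst_mul_dir he) A
      simpa only [pairSum, Finset.mul_sum] using this
    have h5 := mul_le_mul_of_nonneg_left h4 (hS0 τ)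
    linarith

/-- Solutions of the exclusion equation with a source on neighbouring pairs are controlled by the
heat kernel. -/
theorem exclusion_comparison {k : ℕ} {f s : ℝ → Finset (Site d) → ℝ} {S : ℝ → ℝ}
    (hS : Continuous S) (hS0 : ∀ r, 0 ≤ S r) {T α β M : ℝ} (hα : 0 ≤ α) (hβ : 0 ≤ β) (y : Site d)
    (hc : ∀ A : Finset (Site d), A.card = k → ContinuousOn (f · A) (Set.Icc 0 T))
    (hd : ∀ τ ∈ Set.Ioo 0 T, ∀ A : Finset (Site d), A.card = k →
      HasDerivAt (f · A) (exgen (f τ) A + s τ A) τ)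
    (hb : ∀ τ ∈ Set.Icc 0 T, ∀ A : Finset (Site d), A.card = k → |f τ A| ≤ M)
    (hs : ∀ τ ∈ Set.Ioo 0 T, ∀ A : Finset (Site d), A.card = k → |s τ A| ≤ S τ * adjCount A)
    (h0 : ∀ A : Finset (Site d), A.card = k → |f 0 A| ≤ α + if y ∈ A then β else 0)
    {τ : ℝ} (hτ : τ ∈ Set.Icc 0 T) {A : Finset (Site d)} (hA : A.card = k) :
    |f τ A| ≤ α + exConst d k * (∫ r in (0 : ℝ)..τ, S r * heatDecay d (τ - r)) +
      exConst d k * (β * heatDecay d τ) := by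
  rw [abs_le]
  constructor
  · exact exclusion_lower_bound hS hS0 hα hβ y hc hd (fun τ hτ A hA => (abs_le.1 (hb τ hτ A hA)).1)
      (fun τ hτ A hA => (abs_le.1 (hs τ hτ A hA)).1) (fun A hA => (abs_le.1 (h0 A hA)).1) hτ hA
  · have := exclusion_lower_bound (f := fun τ A => -f τ A) (s := fun τ A => -s τ A) hS hS0 hα hβ y
      (M := M) (T := T) (fun A hA => (hc A hA).neg)
      (fun τ hτ A hA => by
        rw [exgen_neg, ← neg_add]; exact (hd τ hτ A hA).neg)
      (fun τ hτ A hA => by linarith [(abs_le.1 (hb τ hτ A hA)).2])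
      (fun τ hτ A hA => by linarith [(abs_le.1 (hs τ hτ A hA)).2])
      (fun A hA => by linarith [(abs_le.1 (h0 A hA)).2]) hτ hA
    linarith

end

section

variable {d : ℕ}

/-! ### Reflections -/

/-- The reflection of the lattice in the mirror `{z | z i = c + 1/2}`. -/
def mirror (i : Fin d) (c : ℤ) (a : Site d) : Site d := Function.update a i (2 * c + 1 - a i)

theorem mirror_apply (i : Fin d) (c : ℤ) (a : Site d) (j : Fin d) :
    mirror i c a j = if j = i then 2 * c + 1 - a i else a j := by
  simp [mirror, Function.update_apply]

theorem mirror_mirror (i : Fin d) (c : ℤ) (a : Site d) : mirror i c (mirror i c a) = a := by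
  funext j
  simp only [mirror_apply, if_true]
  split_ifs with h
  · subst h; ring
  · rfl

theorem mirror_add_unitVec_self (i : Fin d) (c : ℤ) (a : Site d) :
    mirror i c (a + unitVec i) = mirror i c a + -unitVec i := by
  funext j
  simp only [mirror_apply, add_unitVec_apply, add_neg_unitVec_apply, if_true]
  split_ifs <;> ring

theorem mirror_add_neg_unitVec_self (i : Fin d) (c : ℤ) (a : Site d) :
    mirror i c (a + -unitVec i) = mirror i c a + unitVec i := by
  funext j
  simp only [mirror_apply, add_unitVec_apply, add_neg_unitVec_apply, if_true]
  split_ifs <;> ring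

theorem mirror_add_unitVec {i j : Fin d} (h : i ≠ j) (c : ℤ) (a : Site d) :
    mirror i c (a + unitVec j) = mirror i c a + unitVec j := by
  funext k
  simp only [mirror_apply, add_unitVec_apply, if_neg h]
  split_ifs <;> simp_all

theorem mirror_add_neg_unitVec {i j : Fin d} (h : i ≠ j) (c : ℤ) (a : Site d) :
    mirror i c (a + -unitVec j) = mirror i c a + -unitVec j := by
  funext k
  simp only [mirror_apply, add_neg_unitVec_apply, if_neg h]
  split_ifs <;> simp_all

theorem sum_dirs_mirror (i : Fin d) (c : ℤ) (a : Site d) (F : Site d → ℝ) :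
    ∑ e ∈ dirs d, F (mirror i c (a + e)) = ∑ e ∈ dirs d, F (mirror i c a + e) := by
  rw [sum_dirs (fun e => F (mirror i c (a + e))), sum_dirs (fun e => F (mirror i c a + e))]
  refine Finset.sum_congr rfl fun j _ => ?_
  by_cases h : i = j
  · subst h
    rw [mirror_add_unitVec_self, mirror_add_neg_unitVec_self, add_comm]
  · rw [mirror_add_unitVec h, mirror_add_neg_unitVec h]

theorem lap_comp_mirror (i : Fin d) (c : ℤ) (a : Site d) (f : Site d → ℝ) :
    lap (fun z => f (mirror i c z)) a = lap f (mirror i c a) := by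
  rw [lap_eq, lap_eq, sum_dirs_mirror]

theorem mirror_sub_mem_dirs {i : Fin d} {c : ℤ} {a b : Site d} :
    mirror i c b - mirror i c a ∈ dirs d ↔ b - a ∈ dirs d := by
  have key : ∀ a b : Site d, b - a ∈ dirs d → mirror i c b - mirror i c a ∈ dirs d := by
    intro a b h
    have hb : b = a + (b - a) := by abel
    obtain ⟨j, hj | hj⟩ := mem_dirs.1 h <;> rw [hj] at hb <;> by_cases hij : i = j
    · subst hij
      rw [hb, mirror_add_unitVec_self, add_sub_cancel_left]
      exact mem_dirs.2 ⟨i, Or.inr rfl⟩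
    · rw [hb, mirror_add_unitVec hij, add_sub_cancel_left]
      exact mem_dirs.2 ⟨j, Or.inl rfl⟩
    · subst hij
      rw [hb, mirror_add_neg_unitVec_self, add_sub_cancel_left]
      exact mem_dirs.2 ⟨i, Or.inl rfl⟩
    · rw [hb, mirror_add_neg_unitVec hij, add_sub_cancel_left]
      exact mem_dirs.2 ⟨j, Or.inr rfl⟩
  refine ⟨fun h => ?_, key a b⟩
  have := key _ _ h
  rwa [mirror_mirror, mirror_mirror] at this

/-- The i-th coordinate of the difference is at least one, so the unit step must be e_i: both sites
touch the mirror and the other coordinates agree. -/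
theorem eq_of_mirror_sub_mem_dirs {i : Fin d} {c : ℤ} {a b : Site d} (ha : a i ≤ c) (hb : b i ≤ c)
    (h : mirror i c a - b ∈ dirs d) : a = b := by
  have hk : ∀ j, (mirror i c a - b) j = (if j = i then 2 * c + 1 - a i else a j) - b j := fun j => by
    rw [Pi.sub_apply, mirror_apply]
  have hi := hk i
  rw [if_pos rfl] at hi
  obtain ⟨j, hj | hj⟩ := mem_dirs.1 h <;> rw [hj] at hk hi <;> by_cases hij : j = i
  · subst hij
    funext k
    have h1 := hk k
    by_cases hkj : k = j
    · subst hkj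
      simp only [unitVec, Pi.single_eq_same] at hi
      omega
    · simp only [unitVec, Pi.single_apply, if_neg hkj] at h1
      omega
  · simp only [unitVec, Pi.single_apply, if_neg (Ne.symm hij)] at hi
    omega
  · subst hij
    simp only [unitVec, Pi.neg_apply, Pi.single_eq_same] at hi
    omega
  · simp only [unitVec, Pi.neg_apply, Pi.single_apply, if_neg (Ne.symm hij)] at hi
    omega

theorem mirror_ne {i : Fin d} {c : ℤ} {a b : Site d} (ha : a i ≤ c) (hb : b i ≤ c) :
    mirror i c a ≠ b := by
  rintro rfl
  rw [mirror_apply, if_pos rfl] at hb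
  omega

theorem mirror_self (i : Fin d) (x : Site d) : mirror i (x i) x = x + unitVec i := by
  funext j
  simp only [mirror_apply, add_unitVec_apply]
  split_ifs with h
  · subst h; ring
  · rfl

/-- Quasi-monotonicity of the Laplacian with Dirichlet condition at a mirror, expressed through
antisymmetric functions. -/
theorem neg_le_lap_add_of_odd {i : Fin d} {c : ℤ} {f : Site d → ℝ}
    (hodd : ∀ z, f (mirror i c z) = -f z) {m : ℝ} (hm : 0 ≤ m)
    (hf : ∀ z, z i ≤ c → -m ≤ f z) {a : Site d} (ha : a i ≤ c) : -((2 * d + 1) * m) ≤ lap f a + (2 * d + 1) * f a := by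
  have hin : ∀ e ∈ dirs d, (a i = c → e ≠ unitVec i) → -m ≤ f (a + e) := by
    intro e he h
    apply hf
    obtain ⟨j, rfl | rfl⟩ := mem_dirs.1 he
    · rw [add_unitVec_apply]
      split_ifs with hj
      · subst hj
        have : a i ≠ c := fun hc => h hc rfl
        omega
      · exact ha
    · rw [add_neg_unitVec_apply]
      split_ifs <;> omega
  have hfa := hf a ha
  rw [lap_eq]
  -- Next to the mirror the neighbour across it carries the value -f(a); the additional one in the
  -- coefficient 2d + 1 cancels this term.
  by_cases hc : a i = c
  · have h1 : a + unitVec i = mirror i c a := by rw [← hc, mirror_self]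
    rw [← Finset.add_sum_erase _ _ (unitVec_mem_dirs i), h1, hodd]
    have h2 : ∑ e ∈ (dirs d).erase (unitVec i), -m ≤ ∑ e ∈ (dirs d).erase (unitVec i), f (a + e) :=
      Finset.sum_le_sum fun e he => hin e (Finset.mem_of_mem_erase he)
        fun _ => Finset.ne_of_mem_erase he
    have h3 : ∑ e ∈ dirs d, -m = -m + ∑ e ∈ (dirs d).erase (unitVec i), -m :=
      (Finset.add_sum_erase _ (fun _ => -m) (unitVec_mem_dirs i)).symm
    rw [Finset.sum_const, nsmul_eq_mul, card_dirs] at h3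
    linarith
  · have h2 : ∑ e ∈ dirs d, -m ≤ ∑ e ∈ dirs d, f (a + e) :=
      Finset.sum_le_sum fun e he => hin e he fun h => absurd h hc
    rw [Finset.sum_const, nsmul_eq_mul, card_dirs] at h2
    linarith

end

section

variable {d : ℕ}

/-! ### Two independent walks with a source on neighbouring pairs -/

/-- `u` solves the heat equation for two independent walks with zero initial condition and a source
`F` that is bounded by `B` and supported on neighbouring pairs. -/
structure FreePair (u F : ℝ → Site d → Site d → ℝ) (B : ℝ) : Prop where
  cont : ∀ a b, Continuous (u · a b)
  zero : ∀ a b, u 0 a b = 0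
  bdd : ∃ M, ∀ τ, 0 ≤ τ → ∀ a b, |u τ a b| ≤ M
  deriv : ∀ τ, 0 < τ → ∀ a b, HasDerivAt (u · a b)
    (lap (u τ · b) a + lap (u τ a ·) b + F τ a b) τ
  src : ∀ τ, 0 < τ → ∀ a b, |F τ a b| ≤ if b - a ∈ dirs d then B else 0

theorem FreePair.neg {u F : ℝ → Site d → Site d → ℝ} {B : ℝ} (h : FreePair u F B) :
    FreePair (fun τ a b => -u τ a b) (fun τ a b => -F τ a b) B where
  cont a b := (h.cont a b).neg
  zero a b := by rw [h.zero, neg_zero]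
  bdd := by
    obtain ⟨M, hM⟩ := h.bdd
    exact ⟨M, fun τ hτ a b => by rw [abs_neg]; exact hM τ hτ a b⟩
  deriv τ hτ a b := by
    refine (h.deriv τ hτ a b).neg.congr_deriv ?_
    rw [lap_neg (u τ · b), lap_neg (u τ a ·)]; ring
  src τ hτ a b := by rw [abs_neg]; exact h.src τ hτ a b

theorem p_mirror_sub (τ : ℝ) (i : Fin d) (c : ℤ) (a b : Site d) :
    p τ (a - mirror i c b) = p τ (mirror i c a - b) := by
  refine Finset.prod_congr rfl fun j _ => ?_
  rw [Pi.sub_apply, Pi.sub_apply, mirror_apply, mirror_apply]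
  split_ifs with h
  · subst h
    rw [← q_neg]; congr 1; ring
  · rfl

theorem green_mirror_sub (τ : ℝ) (i : Fin d) (c : ℤ) (a b : Site d) :
    green τ (a - mirror i c b) = green τ (mirror i c a - b) := by
  simp only [green, p_mirror_sub]

theorem p_dir (τ : ℝ) {e : Site d} (he : e ∈ dirs d) : p τ e = q τ 1 * q τ 0 ^ (d - 1) := by
  have h0 := fun i => p_add_unitVec τ (0 : Site d) i
  simp only [zero_add, Pi.zero_apply, Finset.prod_const, Finset.card_erase_of_mem (Finset.mem_univ _),
    Finset.card_univ, Fintype.card_fin] at h0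
  obtain ⟨j, rfl | rfl⟩ := mem_dirs.1 he
  · exact h0 j
  · rw [p_neg]; exact h0 j

theorem green_dir (τ : ℝ) {e e' : Site d} (he : e ∈ dirs d) (he' : e' ∈ dirs d) :
    green τ e = green τ e' := by
  simp only [green, p_dir _ he, p_dir _ he']

/-- The profile used to build the barrier for the mixed second difference. -/
def barrier (τ : ℝ) (z : Site d) : ℝ :=
  (4 * d + 4) * green τ z + (p (2 * τ) z - if z = 0 then 1 else 0)

theorem barrier_mirror_sub (τ : ℝ) (i : Fin d) (c : ℤ) (a b : Site d) :
    barrier τ (a - mirror i c b) = barrier τ (mirror i c a - b) := by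
  have h : a - mirror i c b = 0 ↔ mirror i c a - b = 0 := by
    rw [sub_eq_zero, sub_eq_zero]
    constructor <;> rintro rfl <;> rw [mirror_mirror]
  simp only [barrier, green_mirror_sub, p_mirror_sub, h]

theorem barrier_zero (z : Site d) : barrier 0 z = 0 := by
  simp [barrier, green_zero, p_zero]

theorem abs_barrier_le {τ T : ℝ} (hτ : τ ∈ Set.Icc 0 T) (z : Site d) :
    |barrier τ z| ≤ (4 * d + 4) * T + 2 := by
  have h1 := green_nonneg hτ.1 z
  have h2 := green_le hτ.1 z
  have h3 := abs_p_le_one (by linarith [hτ.1] : 0 ≤ 2 * τ) z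
  rw [barrier]
  have h4 : |(4 * d + 4) * green τ z| ≤ (4 * d + 4) * T := by
    rw [abs_of_nonneg (by positivity)]
    exact mul_le_mul_of_nonneg_left (h2.trans hτ.2) (by positivity)
  have h5 : |p (2 * τ) z - if z = 0 then 1 else 0| ≤ 1 + 1 :=
    (abs_sub _ _).trans (add_le_add h3 (by split_ifs <;> norm_num))
  exact (abs_add_le _ _).trans (by linarith)

theorem lap_ite_zero (z : Site d) : lap (fun z : Site d => if z = 0 then (1 : ℝ) else 0) z =
    (if z ∈ dirs d then 1 else 0) - 2 * d * if z = 0 then 1 else 0 := by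
  rw [lap_eq, ← sum_dirs_neg]
  congr 1
  simp only [← sub_eq_add_neg, sub_eq_zero]
  simp

/-- The Green part produces (4d+4) at the origin. The subtracted indicator produces 2 on the unit
steps and takes 4d away at the origin, which leaves 4 there. -/
theorem hasDerivAt_barrier (τ : ℝ) (z : Site d) :
    HasDerivAt (fun τ => barrier τ z)
      (2 * lap (barrier τ) z + 4 * (if z = 0 then 1 else 0) + 2 * (if z ∈ dirs d then 1 else 0)) τ := by
  have e : HasDerivAt (fun r : ℝ => 2 * r) 2 τ := by
    simpa using (hasDerivAt_id τ).const_mul 2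
  have hp := (hasDerivAt_p (2 * τ) z).comp τ e
  refine (((hasDerivAt_green τ z).const_mul (4 * d + 4 : ℝ)).add (hp.sub_const _)).congr_deriv ?_
  have h1 : lap (barrier τ) z = (4 * d + 4) * lap (green τ) z +
      (lap (p (2 * τ)) z - lap (fun z : Site d => if z = 0 then (1 : ℝ) else 0) z) := by
    rw [← lap_sub, ← lap_const_mul, ← lap_add]
    rfl
  have h2 := two_mul_lap_green τ z
  rw [h1, lap_ite_zero]
  linear_combination (-(4 * d + 4 : ℝ)) * h2

/-- By symmetry all unit steps have the same Green value, so the equation of `green` at the origin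
gives the difference exactly: (1 - p_{2τ}(0)) / (4d). After multiplication by 4d + 4 its part of
order one is cancelled by the subtracted indicator, and only 1/d is left. -/
theorem barrier_zero_sub_dir {τ : ℝ} (hτ : 0 ≤ τ) (hd : 0 < d) {e : Site d} (he : e ∈ dirs d) :
    barrier τ (0 : Site d) - barrier τ e ≤ 1 / d := by
  have he0 : e ≠ 0 := fun h => zero_notMem_dirs (h ▸ he)
  have h1 := two_mul_lap_green τ (0 : Site d)
  have h2 : lap (green τ) (0 : Site d) = 2 * d * (green τ e - green τ (0 : Site d)) := by
    rw [lap, Finset.sum_congr rfl fun e' he' => by rw [zero_add, green_dir τ he' he]]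
    rw [Finset.sum_const, nsmul_eq_mul, card_dirs]
  rw [h2, if_pos rfl] at h1
  simp only [barrier, if_pos, if_neg he0, sub_zero]
  have hd' : (0 : ℝ) < d := by exact_mod_cast hd
  have hp0 := p_nonneg (by linarith : 0 ≤ 2 * τ) (0 : Site d)
  have hpe := p_nonneg (by linarith : 0 ≤ 2 * τ) e
  have h3 : green τ (0 : Site d) - green τ e = (1 - p (2 * τ) (0 : Site d)) / (4 * d) := by
    rw [eq_div_iff (by positivity)]; linarith
  have h4 : (4 * d + 4 : ℝ) * ((1 - p (2 * τ) (0 : Site d)) / (4 * d)) =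
      (1 - p (2 * τ) (0 : Site d)) + (1 - p (2 * τ) (0 : Site d)) / d := by
    field_simp
  have h5 : (1 - p (2 * τ) (0 : Site d)) / d ≤ 1 / d := by gcongr; linarith
  have h6 : (4 * d + 4 : ℝ) * (green τ (0 : Site d) - green τ e) ≤ (1 - p (2 * τ) (0 : Site d)) + 1 / d := by
    rw [h3, h4]; linarith
  linarith

/-- The mixed difference with respect to a mirror. -/
def mixedDiff (i : Fin d) (c : ℤ) (f : Site d → Site d → ℝ) (a b : Site d) : ℝ :=
  f a b - f (mirror i c a) b - f a (mirror i c b) + f (mirror i c a) (mirror i c b)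

theorem mixedDiff_mirror_left (i : Fin d) (c : ℤ) (f : Site d → Site d → ℝ) (a b : Site d) :
    mixedDiff i c f (mirror i c a) b = -mixedDiff i c f a b := by
  simp only [mixedDiff, mirror_mirror]; ring

theorem mixedDiff_mirror_right (i : Fin d) (c : ℤ) (f : Site d → Site d → ℝ) (a b : Site d) :
    mixedDiff i c f a (mirror i c b) = -mixedDiff i c f a b := by
  simp only [mixedDiff, mirror_mirror]; ring

theorem lap_mixedDiff_left (i : Fin d) (c : ℤ) (f : Site d → Site d → ℝ) (a b : Site d) :
    lap (mixedDiff i c f · b) a = mixedDiff i c (fun a b => lap (f · b) a) a b := by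
  simp only [mixedDiff, lap_add, lap_sub]
  rw [lap_comp_mirror i c a (f · b), lap_comp_mirror i c a (f · (mirror i c b))]

theorem lap_mixedDiff_right (i : Fin d) (c : ℤ) (f : Site d → Site d → ℝ) (a b : Site d) :
    lap (mixedDiff i c f a ·) b = mixedDiff i c (fun a b => lap (f a ·) b) a b := by
  simp only [mixedDiff, lap_add, lap_sub]
  rw [lap_comp_mirror i c b (f a ·), lap_comp_mirror i c b (f (mirror i c a) ·)]

/-- The mixed difference is odd in each variable under the mirror through the bond from x to x +
e_i, hence solves a Dirichlet problem on pairs on one side of it. The antisymmetrized barrier,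
multiplied by B, dominates its source, and at (x, x) it equals B times a difference bounded by
`barrier_zero_sub_dir`. -/
theorem FreePair.mixedDiff_lower {u F : ℝ → Site d → Site d → ℝ} {B : ℝ} (h : FreePair u F B)
    (hB : 0 ≤ B) (hd : 0 < d) {τ : ℝ} (hτ : 0 ≤ τ) (x : Site d) (i : Fin d) :
    -(B / d) ≤ mixedDiff i (x i) (u τ) x x := by
  set c := x i with hc
  obtain ⟨M, hM⟩ := h.bdd
  set W : ℝ → Site d → Site d → ℝ := fun τ a b =>
    barrier τ (a - b) - barrier τ (mirror i c a - b) with hW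
  have hWl : ∀ τ a b, W τ (mirror i c a) b = -W τ a b := by
    intro τ a b; simp only [hW, mirror_mirror]; ring
  have hWr : ∀ τ a b, W τ a (mirror i c b) = -W τ a b := by
    intro τ a b
    simp only [hW, barrier_mirror_sub, mirror_mirror]; ring
  have hlap1 : ∀ τ a b, lap (W τ · b) a =
      lap (barrier τ) (a - b) - lap (barrier τ) (mirror i c a - b) := by
    intro τ a b
    simp only [hW]
    rw [lap_sub, lap_comp_sub, lap_comp_mirror i c a (fun z => barrier τ (z - b)), lap_comp_sub]
  have hlap2 : ∀ τ a b, lap (W τ a ·) b =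
      lap (barrier τ) (a - b) - lap (barrier τ) (mirror i c a - b) := by
    intro τ a b
    simp only [hW]
    rw [lap_sub, lap_comp_sub_left, lap_comp_sub_left]
  set J : Site d → ℝ := fun z =>
    4 * (if z = 0 then 1 else 0) + 2 * (if z ∈ dirs d then 1 else 0) with hJ
  have key := nonneg_of_quasimonotone {z : Site d × Site d | z.1 i ≤ c ∧ z.2 i ≤ c}
    (fun τ z => B * W τ z.1 z.2 + mixedDiff i c (u τ) z.1 z.2)
    (fun τ z => B * (lap (W τ · z.2) z.1 + lap (W τ z.1 ·) z.2 +
        (J (z.1 - z.2) - J (mirror i c z.1 - z.2))) +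
      (lap (mixedDiff i c (u τ) · z.2) z.1 + lap (mixedDiff i c (u τ) z.1 ·) z.2 +
        mixedDiff i c (F τ) z.1 z.2))
    (T := τ) (K := 2 * (2 * d + 1)) (Λ := 2 * (2 * d + 1))
    (M := B * (2 * ((4 * d + 4) * τ + 2)) + 4 * M)
    (by positivity) (by positivity) ?_ ?_ ?_ ?_ ?_ τ ⟨hτ, le_rfl⟩ (x, x) ⟨le_rfl, le_rfl⟩
  · have h1 : W τ x x ≤ 1 / d := by
      simp only [hW]
      rw [hc, mirror_self, sub_self, add_sub_cancel_left]
      exact barrier_zero_sub_dir hτ hd (unitVec_mem_dirs i)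
    have h2 := mul_le_mul_of_nonneg_left h1 hB
    rw [mul_one_div] at h2
    simp only at key
    linarith
  · rintro ⟨a, b⟩ -
    refine ContinuousOn.add (continuous_const.mul ?_).continuousOn (Continuous.continuousOn ?_)
    · exact (continuous_iff_continuousAt.2 fun r => (hasDerivAt_barrier r _).continuousAt).sub
        (continuous_iff_continuousAt.2 fun r => (hasDerivAt_barrier r _).continuousAt)
    · exact (((h.cont _ _).sub (h.cont _ _)).sub (h.cont _ _)).add (h.cont _ _)
  · rintro r hr ⟨a, b⟩ -
    refine HasDerivAt.add (HasDerivAt.const_mul B ?_) ?_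
    · refine ((hasDerivAt_barrier r (a - b)).sub
        (hasDerivAt_barrier r (mirror i c a - b))).congr_deriv ?_
      simp only [hlap1, hlap2, hJ]; ring
    · refine ((((h.deriv r hr.1 a b).sub (h.deriv r hr.1 _ b)).sub (h.deriv r hr.1 a _)).add
        (h.deriv r hr.1 _ _)).congr_deriv ?_
      rw [lap_mixedDiff_left, lap_mixedDiff_right]
      simp only [mixedDiff]; ring
  · rintro r hr ⟨a, b⟩ -
    have h1 : |W r a b| ≤ 2 * ((4 * d + 4) * τ + 2) := by
      have e1 := abs_barrier_le hr (a - b)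
      have e2 := abs_barrier_le hr (mirror i c a - b)
      exact (abs_sub _ _).trans (by linarith)
    have h2 := mul_le_mul_of_nonneg_left (abs_le.1 h1).1 hB
    have h3 := fun a b => abs_le.1 (hM r hr.1 a b)
    simp only [mixedDiff]
    linarith [(h3 a b).1, (h3 (mirror i c a) b).2, (h3 a (mirror i c b)).2,
      (h3 (mirror i c a) (mirror i c b)).1]
  · rintro ⟨a, b⟩ -
    simp [hW, barrier_zero, mixedDiff, h.zero]
  · rintro r hr ⟨a, b⟩ ⟨ha, hb⟩ m hm hlow
    -- The source of the mixed difference is at least -2B on neighbouring pairs, from the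
    -- unreflected and the doubly reflected terms. The two singly reflected terms contribute only if
    -- a = b, again at least -2B. The barrier gives 2B in the first case; in the second it gives 4B,
    -- less at most 2B for its reflection.
    have hJF : 0 ≤ B * (J (a - b) - J (mirror i c a - b)) + mixedDiff i c (F r) a b := by
      have f1 := h.src r hr.1 a b
      have f2 := h.src r hr.1 (mirror i c a) b
      have f3 := h.src r hr.1 a (mirror i c b)
      have f4 := h.src r hr.1 (mirror i c a) (mirror i c b)
      simp only [mirror_sub_mem_dirs] at f4
      have e3 : mirror i c b - a ∈ dirs d ↔ b - mirror i c a ∈ dirs d := by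
        rw [← mirror_sub_mem_dirs (i := i) (c := c), mirror_mirror]
      simp only [e3] at f3
      have e2 : mirror i c a - b ∈ dirs d ↔ b - mirror i c a ∈ dirs d := by
        rw [← neg_mem_dirs, neg_sub]
      have e1 : a - b ∈ dirs d ↔ b - a ∈ dirs d := by
        rw [← neg_mem_dirs, neg_sub]
      have n1 : ¬ (mirror i c a - b = 0) := fun h0 => mirror_ne ha hb (sub_eq_zero.1 h0)
      have n2 : b - mirror i c a ∈ dirs d → a - b = 0 := fun h0 =>
        sub_eq_zero.2 (eq_of_mirror_sub_mem_dirs ha hb (e2.2 h0))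
      have n3 : a - b = 0 → ¬ (b - a ∈ dirs d) := by
        intro h0
        rw [← neg_sub, h0, neg_zero]
        exact zero_notMem_dirs
      simp only [hJ, mixedDiff, e1, e2, if_neg n1]
      rw [abs_le] at f1 f2 f3 f4
      by_cases c1 : b - mirror i c a ∈ dirs d
      · have c2 := n2 c1
        have c3 := n3 c2
        simp only [c1, c2, c3, if_true, if_false] at *
        linarith [f1.1, f2.2, f3.2, f4.1]
      · by_cases c3 : b - a ∈ dirs d
        · have c2 : ¬ (a - b = 0) := fun h0 => n3 h0 c3
          simp only [c1, c2, c3, if_true, if_false] at *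
          linarith [f1.1, f2.2, f3.2, f4.1]
        · have : 0 ≤ B * (4 * (if a - b = 0 then (1 : ℝ) else 0)) := by positivity
          simp only [c1, c3, if_false] at *
          linarith [f1.1, f2.2, f3.2, f4.1]
    have q1 := neg_le_lap_add_of_odd (i := i) (c := c) (m := m)
      (f := fun z => B * W r z b + mixedDiff i c (u r) z b)
      (fun z => by rw [hWl, mixedDiff_mirror_left]; ring) hm (fun z hz => hlow (z, b) ⟨hz, hb⟩) ha
    have q2 := neg_le_lap_add_of_odd (i := i) (c := c) (m := m)
      (f := fun z => B * W r a z + mixedDiff i c (u r) a z)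
      (fun z => by rw [hWr, mixedDiff_mirror_right]; ring) hm (fun z hz => hlow (a, z) ⟨ha, hz⟩) hb
    rw [lap_add, lap_const_mul] at q1 q2
    simp only
    linarith

/-- The factor 1/d is the point: from d = 2 on it is at most 1/2, which makes the bootstrap for the
two-point function a contraction. -/
theorem FreePair.abs_mixedDiff_le {u F : ℝ → Site d → Site d → ℝ} {B : ℝ} (h : FreePair u F B)
    (hB : 0 ≤ B) (hd : 0 < d) {τ : ℝ} (hτ : 0 ≤ τ) {x y : Site d} (hxy : y - x ∈ dirs d) :
    |u τ x x + u τ y y - u τ x y - u τ y x| ≤ B / d := by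
  have key : ∀ (x : Site d) (i : Fin d), |u τ x x + u τ (x + unitVec i) (x + unitVec i) -
      u τ x (x + unitVec i) - u τ (x + unitVec i) x| ≤ B / d := by
    intro x i
    have h1 := h.mixedDiff_lower hB hd hτ x i
    have h2 := h.neg.mixedDiff_lower hB hd hτ x i
    simp only [mixedDiff, mirror_self] at h1 h2
    rw [abs_le]
    constructor <;> linarith
  obtain ⟨i, hi | hi⟩ := mem_dirs.1 hxy
  · have := key x i
    rwa [← hi, add_sub_cancel] at this
  · have := key y i
    have e : y + unitVec i = x := by
      rw [← neg_neg (unitVec i), ← hi]; abel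
    rw [e] at this
    refine le_trans (le_of_eq ?_) this
    congr 1; ring

end

section

variable {d : ℕ}

/-! ### The heat flow for two independent walks -/

theorem exists_linear_flow {E : Type*} [NormedAddCommGroup E] [NormedSpace ℝ E] [CompleteSpace E]
    (A : E →L[ℝ] E) (f : E) :
    ∃ U : ℝ → E, U 0 = f ∧ ∀ τ, HasDerivAt U (A (U τ)) τ := by
  refine ⟨fun τ => NormedSpace.exp (τ • A) f, by simp, fun τ => ?_⟩
  have := (hasDerivAt_exp_smul_const' (𝕂 := ℝ) A τ).clm_apply (hasDerivAt_const τ f)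
  simpa using this

/-- The generator of two independent walks as a bounded operator. -/
def pairLapCLM (d : ℕ) :
    BoundedContinuousFunction (Site d × Site d) ℝ →L[ℝ] BoundedContinuousFunction (Site d × Site d) ℝ :=
  LinearMap.mkContinuous
    { toFun := fun f => BoundedContinuousFunction.ofNormedAddCommGroupDiscrete
        (fun z => lap (fun a => f (a, z.2)) z.1 + lap (fun b => f (z.1, b)) z.2)
        (4 * d * ‖f‖ + 4 * d * ‖f‖) fun z => (norm_add_le _ _).trans (add_le_add
          (abs_lap_le _ (fun a => f.norm_coe_le_norm (a, z.2)) _)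
          (abs_lap_le _ (fun b => f.norm_coe_le_norm (z.1, b)) _))
      map_add' := fun f g => by
        ext z
        simp only [BoundedContinuousFunction.coe_add, Pi.add_apply, lap_add,
          BoundedContinuousFunction.coe_ofNormedAddCommGroupDiscrete]
        ring
      map_smul' := fun c f => by
        ext z
        simp only [BoundedContinuousFunction.coe_smul, smul_eq_mul, lap_const_mul,
          BoundedContinuousFunction.coe_ofNormedAddCommGroupDiscrete, RingHom.id_apply]
        ring }
    (4 * d + 4 * d) fun f => by
      refine (BoundedContinuousFunction.norm_le (by positivity)).2 fun z => ?_
      refine (norm_add_le _ _).trans ((add_le_add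
          (abs_lap_le _ (fun a => f.norm_coe_le_norm (a, z.2)) _)
          (abs_lap_le _ (fun b => f.norm_coe_le_norm (z.1, b)) _)).trans_eq ?_)
      ring

/-- The heat flow for two independent walks is nonnegative on nonnegative data. -/
theorem pair_nonneg (u u' : ℝ → Site d → Site d → ℝ) {T M : ℝ}
    (hc : ∀ a b, ContinuousOn (u · a b) (Set.Icc 0 T))
    (hd : ∀ τ ∈ Set.Ioo 0 T, ∀ a b, HasDerivAt (u · a b) (u' τ a b) τ)
    (hb : ∀ τ ∈ Set.Icc 0 T, ∀ a b, -M ≤ u τ a b)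
    (h0 : ∀ a b, 0 ≤ u 0 a b)
    (hq : ∀ τ ∈ Set.Ioo 0 T, ∀ a b, lap (u τ · b) a + lap (u τ a ·) b ≤ u' τ a b) :
    ∀ τ ∈ Set.Icc 0 T, ∀ a b, 0 ≤ u τ a b := by
  intro τ hτ a b
  refine nonneg_of_quasimonotone Set.univ (fun τ z => u τ z.1 z.2) (fun τ z => u' τ z.1 z.2) (T := T)
    (K := 4 * d) (Λ := 4 * d) (M := M)
    (by positivity) (by positivity) (fun x _ => hc _ _) (fun τ hτ x _ => hd τ hτ _ _)
    (fun τ hτ x _ => hb τ hτ _ _) (fun x _ => h0 _ _) ?_ τ hτ (a, b) trivial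
  rintro τ hτ ⟨a, b⟩ _ m _ hm
  have h1 := neg_le_lap_add (u τ · b) (fun y => hm (y, b) trivial) a
  have h2 := neg_le_lap_add (u τ a ·) (fun y => hm (a, y) trivial) b
  have h3 := hq τ hτ a b
  simp only
  linarith

/-- The generator is bounded on bounded functions, so the flow is an operator exponential; the sup
bound is the comparison principle for m + v and m - v. -/
theorem exists_pair_heatFlow (f : Site d → Site d → ℝ) {m : ℝ} (hf : ∀ a b, |f a b| ≤ m) :
    ∃ v : ℝ → Site d → Site d → ℝ, (∀ a b, v 0 a b = f a b) ∧
      (∀ τ a b, HasDerivAt (v · a b) (lap (v τ · b) a + lap (v τ a ·) b) τ) ∧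
      ∀ τ, 0 ≤ τ → ∀ a b, |v τ a b| ≤ m := by
  set f₀ : BoundedContinuousFunction (Site d × Site d) ℝ :=
    BoundedContinuousFunction.ofNormedAddCommGroupDiscrete (fun z => f z.1 z.2) m
      fun z => hf z.1 z.2 with hf₀
  obtain ⟨U, hU0, hUd⟩ := exists_linear_flow (pairLapCLM d) f₀
  have hv : ∀ τ a b, HasDerivAt (fun τ => U τ (a, b))
      (lap (fun z => U τ (z, b)) a + lap (fun z => U τ (a, z)) b) τ := by
    intro τ a b
    exact ((BoundedContinuousFunction.evalCLM ℝ (a, b)).hasFDerivAt.comp_hasDerivAt τ (hUd τ))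
  have h0 : ∀ a b, U 0 (a, b) = f a b := by
    intro a b; rw [hU0]; rfl
  have hUc : Continuous U := continuous_iff_continuousAt.2 fun τ => (hUd τ).continuousAt
  have hlow : ∀ σ : ℝ, |σ| = 1 → ∀ τ, 0 ≤ τ → ∀ a b, 0 ≤ m + σ * U τ (a, b) := by
    intro σ hσ τ hτ a b
    obtain ⟨M, hM⟩ := isCompact_Icc.exists_bound_of_continuousOn (s := Set.Icc 0 τ) hUc.continuousOn
    refine pair_nonneg (fun τ a b => m + σ * U τ (a, b))
      (fun τ a b => σ * (lap (fun z => U τ (z, b)) a + lap (fun z => U τ (a, z)) b)) (T := τ)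
      (M := |m| + M) ?_ ?_ ?_ ?_ ?_ τ ⟨hτ, le_rfl⟩ a b
    · intro a b
      exact (continuous_const.add (continuous_const.mul (continuous_iff_continuousAt.2 fun r =>
        (hv r a b).continuousAt))).continuousOn
    · intro r _ a b
      exact ((hv r a b).const_mul σ).const_add m
    · intro r hr a b
      have h1 : |σ * U r (a, b)| ≤ M := by
        rw [abs_mul, hσ, one_mul]
        exact ((U r).norm_coe_le_norm (a, b)).trans (hM r hr)
      linarith [neg_abs_le m, (abs_le.1 h1).1]
    · intro a b
      rw [h0]
      have h1 : |σ * f a b| ≤ m := by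
        rw [abs_mul, hσ, one_mul]; exact hf a b
      linarith [(abs_le.1 h1).1]
    · intro r _ a b
      simp only [lap_add, lap_const, lap_const_mul]
      linarith
  refine ⟨fun τ a b => U τ (a, b), h0, hv, fun τ hτ a b => abs_le.2 ⟨?_, ?_⟩⟩
  · linarith [hlow 1 (by simp) τ hτ a b]
  · linarith [hlow (-1) (by simp) τ hτ a b]

/-! ### Gradient bound for the heat flow -/

/-- The probability that the walk on `ℤ` started from `n ≥ 1` has not hit the mirror at `1/2`. -/
def surv (τ : ℝ) (n : ℕ) : ℝ := -q τ 0 + 2 * ∑ j ∈ Finset.range n, q τ j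

theorem surv_one (τ : ℝ) : surv τ 1 = q τ 0 := by simp [surv]; ring

theorem surv_zero (τ : ℝ) : surv τ 0 = -q τ 0 := by simp [surv]

theorem surv_succ (τ : ℝ) (n : ℕ) : surv τ (n + 1) = surv τ n + 2 * q τ n := by
  rw [surv, surv, Finset.sum_range_succ]; ring

theorem q_zero_le_surv {τ : ℝ} (hτ : 0 ≤ τ) {n : ℕ} (hn : 1 ≤ n) : q τ 0 ≤ surv τ n := by
  have : q τ ((0 : ℕ) : ℤ) ≤ ∑ j ∈ Finset.range n, q τ j :=
    Finset.single_le_sum (f := fun j : ℕ => q τ j) (fun j _ => q_nonneg hτ _)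
      (Finset.mem_range.2 hn)
  rw [surv]
  simp only [Nat.cast_zero] at this
  linarith

theorem hasDerivAt_surv (τ : ℝ) (n : ℕ) :
    HasDerivAt (fun τ => surv τ n) (2 * q τ n - 2 * q τ (n - 1)) τ := by
  induction n with
  | zero =>
    simp only [surv_zero]
    refine (hasDerivAt_q τ 0).neg.congr_deriv ?_
    simp only [zero_add, zero_sub, Nat.cast_zero, q_neg]; ring
  | succ n ih =>
    simp only [surv_succ]
    refine (ih.add ((hasDerivAt_q τ n).const_mul 2)).congr_deriv ?_
    push_cast
    rw [add_sub_cancel_right]; ring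

/-- The survival probability as an antisymmetric function of the site. -/
def survSite (i : Fin d) (c : ℤ) (τ : ℝ) (a : Site d) : ℝ :=
  if a i ≤ c then surv τ (c + 1 - a i).toNat else -surv τ (a i - c).toNat

theorem survSite_mirror (i : Fin d) (c : ℤ) (τ : ℝ) (a : Site d) :
    survSite i c τ (mirror i c a) = -survSite i c τ a := by
  have h : mirror i c a i = 2 * c + 1 - a i := by rw [mirror_apply, if_pos rfl]
  simp only [survSite, h]
  by_cases h1 : a i ≤ c
  · rw [if_pos h1, if_neg (by omega)]
    congr 3; ring
  · rw [if_neg h1, if_pos (by omega), neg_neg]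
    congr 2; ring

/-- The convention for n = 0 is odd, the value being minus the one for n = 1, so a single formula
also covers the first layer beyond the mirror. -/
theorem survSite_eq (i : Fin d) (c : ℤ) (τ : ℝ) {a : Site d} (ha : a i ≤ c + 1) :
    survSite i c τ a = surv τ (c + 1 - a i).toNat := by
  rw [survSite]
  split_ifs with h
  · rfl
  · have h1 : a i = c + 1 := by omega
    rw [h1]
    simp [surv_one, surv_zero]

theorem hasDerivAt_survSite (i : Fin d) (c : ℤ) (τ : ℝ) {a : Site d} (ha : a i ≤ c) :
    HasDerivAt (fun τ => survSite i c τ a) (lap (survSite i c τ) a) τ := by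
  obtain ⟨n, hn⟩ : ∃ n : ℕ, a i = c - n := ⟨(c - a i).toNat, by omega⟩
  have e0 : ∀ τ, survSite i c τ a = surv τ (n + 1) := fun τ => by
    rw [survSite_eq i c τ (by omega)]; congr 1; omega
  have hl : lap (survSite i c τ) a = surv τ n + surv τ (n + 2) - 2 * surv τ (n + 1) := by
    rw [lap, sum_dirs, ← Finset.add_sum_erase _ _ (Finset.mem_univ i), Finset.sum_eq_zero, e0]
    · rw [survSite_eq i c τ (by rw [add_unitVec_apply, if_pos rfl]; omega),
        survSite_eq i c τ (by rw [add_neg_unitVec_apply, if_pos rfl]; omega), add_unitVec_apply,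
        add_neg_unitVec_apply, if_pos rfl, if_pos rfl]
      have e1 : (c + 1 - (a i + 1)).toNat = n := by omega
      have e2 : (c + 1 - (a i - 1)).toNat = n + 2 := by omega
      rw [e1, e2]; ring
    · intro j hj
      have hij : i ≠ j := (Finset.ne_of_mem_erase hj).symm
      have f1 : (a + unitVec j) i = a i := by rw [add_unitVec_apply, if_neg hij]
      have f2 : (a + -unitVec j) i = a i := by rw [add_neg_unitVec_apply, if_neg hij]
      simp [survSite, f1, f2]
  simp only [e0, hl]
  refine (hasDerivAt_surv τ (n + 1)).congr_deriv ?_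
  rw [show n + 2 = n + 1 + 1 from rfl, surv_succ, surv_succ]
  push_cast
  rw [add_sub_cancel_right]; ring

/-- Reflection coupling in analytic form. The difference between v at a site and at its mirror image
is odd and bounded by 2m, hence dominated by 2m times the survival probability of a walk killed at
the mirror. Next to the mirror that probability is `q τ 0`. -/
theorem pair_heatFlow_gradient_lower {v : ℝ → Site d → Site d → ℝ} {m : ℝ}
    (hd : ∀ τ a b, HasDerivAt (v · a b) (lap (v τ · b) a + lap (v τ a ·) b) τ)
    (hb : ∀ τ, 0 ≤ τ → ∀ a b, |v τ a b| ≤ m) {τ : ℝ} (hτ : 0 ≤ τ) (x w : Site d) (i : Fin d) :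
    -(2 * m * q τ 0) ≤ v τ x w - v τ (x + unitVec i) w := by
  set c := x i with hc
  have hm : 0 ≤ m := (abs_nonneg _).trans (hb 0 le_rfl x w)
  have hk : ∀ {a : Site d}, a i ≤ c → 1 ≤ (c + 1 - a i).toNat := fun h => by omega
  have hlap : ∀ τ a b, lap (fun z => v τ z b - v τ (mirror i c z) b) a =
      lap (v τ · b) a - lap (v τ · b) (mirror i c a) := fun τ a b => by
    rw [lap_sub, lap_comp_mirror i c a (v τ · b)]
  have key := nonneg_of_quasimonotone {z : Site d × Site d | z.1 i ≤ c}
    (fun τ z => 2 * m * survSite i c τ z.1 + (v τ z.1 z.2 - v τ (mirror i c z.1) z.2))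
    (fun τ z => 2 * m * lap (survSite i c τ) z.1 +
      ((lap (v τ · z.2) z.1 + lap (v τ z.1 ·) z.2) - (lap (v τ · z.2) (mirror i c z.1) +
        lap (v τ (mirror i c z.1) ·) z.2)))
    (T := τ) (K := (2 * d + 1) + 2 * d) (Λ := (2 * d + 1) + 2 * d) (M := 2 * m)
    (by positivity) (by positivity) ?_ ?_ ?_ ?_ ?_ τ ⟨hτ, le_rfl⟩ (x, w)
    (show x i ≤ c from le_rfl)
  · simp only [hc, mirror_self] at key
    rw [survSite_eq i _ τ (by omega)] at key
    have : (x i + 1 - x i).toNat = 1 := by omega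
    rw [this, surv_one] at key
    linarith
  · rintro ⟨a, b⟩ ha
    have h1 : Continuous fun τ => survSite i c τ a := continuous_iff_continuousAt.2 fun r =>
      (hasDerivAt_survSite i c r ha).continuousAt
    have h2 : ∀ a b, Continuous fun τ => v τ a b := fun a b => continuous_iff_continuousAt.2
      fun r => (hd r a b).continuousAt
    exact ((continuous_const.mul h1).add ((h2 _ _).sub (h2 _ _))).continuousOn
  · rintro r hr ⟨a, b⟩ ha
    exact ((hasDerivAt_survSite i c r ha).const_mul _).add ((hd r a b).sub (hd r _ b))
  · rintro r hr ⟨a, b⟩ ha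
    have h1 : 0 ≤ survSite i c r a := by
      rw [survSite_eq i c r (le_trans ha (by omega))]
      exact (q_nonneg hr.1 0).trans (q_zero_le_surv hr.1 (hk ha))
    have h2 := (abs_le.1 (hb r hr.1 a b)).1
    have h3 := (abs_le.1 (hb r hr.1 (mirror i c a) b)).2
    have h4 : 0 ≤ 2 * m * survSite i c r a := by positivity
    simp only
    linarith
  · rintro ⟨a, b⟩ ha
    have h1 : 1 ≤ survSite i c 0 a := by
      rw [survSite_eq i c 0 (le_trans ha (by omega))]
      have := q_zero_le_surv le_rfl (hk ha)
      rwa [q_zero, if_pos rfl] at this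
    have h2 := (abs_le.1 (hb 0 le_rfl a b)).1
    have h3 := (abs_le.1 (hb 0 le_rfl (mirror i c a) b)).2
    have h4 := mul_le_mul_of_nonneg_left h1 (by positivity : 0 ≤ 2 * m)
    simp only
    linarith
  · rintro r hr ⟨a, b⟩ ha m' hm' hlow
    have q1 := neg_le_lap_add_of_odd (i := i) (c := c) (m := m')
      (f := fun z => 2 * m * survSite i c r z + (v r z b - v r (mirror i c z) b))
      (fun z => by rw [survSite_mirror, mirror_mirror]; ring) hm' (fun z hz => hlow (z, b) hz) ha
    have q2 := neg_le_lap_add (m := m')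
      (fun z => 2 * m * survSite i c r a + (v r a z - v r (mirror i c a) z))
      (fun z => hlow (a, z) ha) b
    rw [lap_add, lap_const_mul, hlap] at q1
    rw [lap_add, lap_const, lap_sub] at q2
    simp only
    linarith

theorem pair_heatFlow_gradient {v : ℝ → Site d → Site d → ℝ} {m : ℝ}
    (hd : ∀ τ a b, HasDerivAt (v · a b) (lap (v τ · b) a + lap (v τ a ·) b) τ)
    (hb : ∀ τ, 0 ≤ τ → ∀ a b, |v τ a b| ≤ m) {τ : ℝ} (hτ : 0 ≤ τ) (x w : Site d) {e : Site d}
    (he : e ∈ dirs d) : |v τ (x + e) w - v τ x w| ≤ 2 * m * q τ 0 := by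
  have key : ∀ (x : Site d) (i : Fin d), |v τ (x + unitVec i) w - v τ x w| ≤ 2 * m * q τ 0 := by
    intro x i
    have h1 := pair_heatFlow_gradient_lower hd hb hτ x w i
    have h2 := pair_heatFlow_gradient_lower (v := fun τ a b => -v τ a b) (m := m)
      (fun τ a b => by
        refine (hd τ a b).neg.congr_deriv ?_
        rw [lap_neg (v τ · b), lap_neg (v τ a ·)]; ring)
      (fun τ hτ a b => by rw [abs_neg]; exact hb τ hτ a b) hτ x w i
    rw [abs_le]
    constructor <;> linarith
  obtain ⟨i, rfl | rfl⟩ := mem_dirs.1 he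
  · exact key x i
  · have := key (x + -unitVec i) i
    rwa [neg_add_cancel_right, abs_sub_comm] at this

end

section

variable {d : ℕ}

/-! ### The integrated heat decay -/

/-- The integral `∫₀^τ (1 + r)^{-d/2} dr`. -/
def ell (d : ℕ) (τ : ℝ) : ℝ := ∫ r in (0 : ℝ)..τ, heatDecay d r

theorem intervalIntegrable_heatDecay (d : ℕ) {a b : ℝ} (ha : 0 ≤ a) (hb : 0 ≤ b) :
    IntervalIntegrable (heatDecay d) volume a b :=
  ((continuousOn_heatDecay d).mono fun _ hr => (le_inf ha hb).trans hr.1).intervalIntegrable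

theorem ell_nonneg (d : ℕ) {τ : ℝ} (hτ : 0 ≤ τ) : 0 ≤ ell d τ :=
  intervalIntegral.integral_nonneg hτ fun r _ => heatDecay_nonneg d r

theorem ell_mono (d : ℕ) {τ τ' : ℝ} (hτ : 0 ≤ τ) (h : τ ≤ τ') : ell d τ ≤ ell d τ' := by
  have h1 := intervalIntegral.integral_add_adjacent_intervals
    (intervalIntegrable_heatDecay d le_rfl hτ) (intervalIntegrable_heatDecay d hτ (hτ.trans h))
  have h2 : 0 ≤ ∫ r in τ..τ', heatDecay d r :=
    intervalIntegral.integral_nonneg h fun r _ => heatDecay_nonneg d r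
  unfold ell
  linarith

theorem integral_heatDecay_sub (d : ℕ) (τ : ℝ) :
    ∫ r in (0 : ℝ)..τ, heatDecay d (τ - r) = ell d τ := by
  rw [intervalIntegral.integral_comp_sub_left (fun r => heatDecay d r)]
  simp [ell]

theorem heatDecay_le_of_le {d d' : ℕ} (h : d ≤ d') {τ : ℝ} (hτ : 0 ≤ τ) :
    heatDecay d' τ ≤ heatDecay d τ := by
  have : 1 ≤ √(1 + τ) := Real.one_le_sqrt.2 (by linarith)
  exact pow_le_pow_of_le_one (by positivity) (by rw [div_le_one (by linarith)]; exact this) h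

theorem ell_le_of_le {d d' : ℕ} (h : d ≤ d') {τ : ℝ} (hτ : 0 ≤ τ) : ell d' τ ≤ ell d τ :=
  intervalIntegral.integral_mono_on hτ (intervalIntegrable_heatDecay d' le_rfl hτ)
    (intervalIntegrable_heatDecay d le_rfl hτ) fun _ hr => heatDecay_le_of_le h hr.1

theorem heatDecay_two {τ : ℝ} (hτ : 0 ≤ τ) : heatDecay 2 τ = 1 / (1 + τ) := by
  rw [heatDecay, div_pow, one_pow, Real.sq_sqrt (by linarith)]

theorem ell_two {τ : ℝ} (hτ : 0 ≤ τ) : ell 2 τ = Real.log (1 + τ) := by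
  have h := intervalIntegral.integral_eq_sub_of_hasDerivAt (a := 0) (b := τ)
    (f := fun r => Real.log (1 + r)) (f' := fun r => heatDecay 2 r) (fun r hr => ?_)
    (intervalIntegrable_heatDecay 2 le_rfl hτ)
  · rw [ell, h]; simp
  · rw [Set.uIcc_of_le hτ] at hr
    rw [heatDecay_two hr.1]
    exact ((hasDerivAt_id r).const_add 1).log (by simp only [id]; linarith [hr.1])

theorem ell_three_le {τ : ℝ} (hτ : 0 ≤ τ) : ell 3 τ ≤ 2 := by
  have h := intervalIntegral.integral_eq_sub_of_hasDerivAt (a := 0) (b := τ)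
    (f := fun r => -2 / √(1 + r)) (f' := fun r => heatDecay 3 r) (fun r hr => ?_)
    (intervalIntegrable_heatDecay 3 le_rfl hτ)
  · rw [ell, h]
    have h2 : 0 ≤ 2 / √(1 + τ) := by positivity
    simp only [neg_div, add_zero, Real.sqrt_one, div_one]
    linarith
  · rw [Set.uIcc_of_le hτ] at hr
    have hr0 : 0 < 1 + r := by linarith [hr.1]
    have hs : 0 < √(1 + r) := Real.sqrt_pos.2 hr0
    have h1 : HasDerivAt (fun r => √(1 + r)) (1 / (2 * √(1 + r))) r :=
      ((hasDerivAt_id r).const_add 1).sqrt hr0.ne'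
    refine ((hasDerivAt_const r (-2 : ℝ)).div h1 hs.ne').congr_deriv ?_
    rw [heatDecay]
    field_simp
    ring

/-- In dimension at least two the growth is at most logarithmic. A quarter power is a convenient
bound, still beaten by the half power gained in a gradient. -/
theorem ell_le_sqrt_sqrt (hd : 2 ≤ d) {τ : ℝ} (hτ : 0 ≤ τ) : ell d τ ≤ 4 * √√(1 + τ) := by
  have h1 : 0 < 1 + τ := by linarith
  have h2 : 0 < √√(1 + τ) := Real.sqrt_pos.2 (Real.sqrt_pos.2 h1)
  have h3 : √√(1 + τ) ^ 4 = 1 + τ := by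
    rw [show (4 : ℕ) = 2 * 2 from rfl, pow_mul, Real.sq_sqrt (Real.sqrt_nonneg _),
      Real.sq_sqrt h1.le]
  calc ell d τ ≤ ell 2 τ := ell_le_of_le hd hτ
    _ = Real.log (√√(1 + τ) ^ 4) := by rw [ell_two hτ, h3]
    _ = 4 * Real.log √√(1 + τ) := by rw [Real.log_pow]; norm_num
    _ ≤ 4 * √√(1 + τ) := by
      have := Real.log_le_sub_one_of_pos h2
      linarith

/-! ### Gradient bound for pairs with a source on neighbouring sites -/

/-- The difference of two independent walks is a walk at double speed, so `heatConv` with unit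
source, taken at a - b, is a supersolution up to constants. -/
theorem FreePair.lower {u F : ℝ → Site d → Site d → ℝ} {B : ℝ} (h : FreePair u F B)
    (hB : 0 ≤ B) {τ : ℝ} (hτ : 0 ≤ τ) (a b : Site d) :
    -(B * (pConst d * 2 ^ d * ell d τ)) ≤ u τ a b := by
  have hp := pConst_pos d
  obtain ⟨M, hM⟩ := h.bdd
  have h1 := fun τ z => hasDerivAt_heatConv (d := d) (S := fun _ => 1) continuous_const τ z
  have key := pair_nonneg
    (fun τ a b => B * pConst d * heatConv (fun _ => 1) τ (a - b) + u τ a b)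
    (fun τ a b => B * pConst d * (1 * p 1 (a - b) + 2 * lap (heatConv (fun _ => 1) τ) (a - b)) +
      (lap (u τ · b) a + lap (u τ a ·) b + F τ a b)) (T := τ) (M := M) ?_ ?_ ?_ ?_ ?_ τ ⟨hτ, le_rfl⟩ a b
  · have h2 := heatConv_le (d := d) (S := fun _ => 1) continuous_const (fun _ => zero_le_one) hτ (a - b)
    simp only [one_mul] at h2
    rw [integral_heatDecay_sub] at h2
    have h3 := mul_le_mul_of_nonneg_left h2 (by positivity : 0 ≤ B * pConst d)
    linarith
  · intro a b
    exact ((continuous_const.mul (continuous_iff_continuousAt.2 fun r =>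
      (h1 r (a - b)).continuousAt)).add (h.cont a b)).continuousOn
  · intro r hr a b
    exact ((h1 r (a - b)).const_mul _).add (h.deriv r hr.1 a b)
  · intro r hr a b
    have h2 := heatConv_nonneg (d := d) (S := fun _ => 1) (fun _ => zero_le_one) hr.1 (a - b)
    have h3 := (abs_le.1 (hM r hr.1 a b)).1
    have : 0 ≤ B * pConst d * heatConv (fun _ => 1) r (a - b) := by positivity
    linarith
  · intro a b
    simp [heatConv_zero, h.zero]
  · intro r hr a b
    rw [lap_add, lap_add, lap_const_mul, lap_const_mul, lap_comp_sub, lap_comp_sub_left]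
    have h2 := (abs_le.1 (h.src r hr.1 a b)).1
    have h3 : (if b - a ∈ dirs d then B else 0) ≤ B * (pConst d * p 1 (a - b)) := by
      split_ifs with hab
      · have := one_le_pConst_mul_dir (d := d) (e := a - b) (by rwa [← neg_mem_dirs, neg_sub])
        nlinarith
      · have := p_nonneg zero_le_one (a - b)
        positivity
    linarith

theorem FreePair.abs_le {u F : ℝ → Site d → Site d → ℝ} {B : ℝ} (h : FreePair u F B)
    (hB : 0 ≤ B) {τ : ℝ} (hτ : 0 ≤ τ) (a b : Site d) :
    |u τ a b| ≤ B * (pConst d * 2 ^ d * ell d τ) := by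
  have h1 := h.lower hB hτ a b
  have h2 := h.neg.lower hB hτ a b
  rw [_root_.abs_le]
  constructor <;> linarith

/-- Restart at time τ. The solution at 2τ is the heat flow of its value at τ plus a new solution
with zero initial data and the same source bound. The flow has gradient of order B `ell d τ`
τ^{-1/2}, hence B τ^{-1/4}, which is summable over dyadic times. -/
theorem FreePair.gradient_step (hd : 2 ≤ d) {B K τ : ℝ} (hB : 0 ≤ B) (hτ : 0 < τ)
    (ih : ∀ u F, FreePair (d := d) u F B → ∀ x w : Site d, ∀ e ∈ dirs d,
      |u τ (x + e) w - u τ x w| ≤ B * K)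
    {u F : ℝ → Site d → Site d → ℝ} (h : FreePair u F B) (x w : Site d) {e : Site d}
    (he : e ∈ dirs d) :
    |u (τ + τ) (x + e) w - u (τ + τ) x w| ≤
      B * (K + 16 * (pConst d * 2 ^ d) / √√(1 + τ)) := by
  have hp := pConst_pos d
  obtain ⟨v, hv0, hvd, hvb⟩ := exists_pair_heatFlow (u τ) (h.abs_le hB hτ.le)
  have hrest : FreePair (fun r a b => u (τ + r) a b - v r a b) (fun r => F (τ + r)) B := by
    refine ⟨fun a b => ?_, fun a b => ?_, ?_, fun r hr a b => ?_, fun r hr a b => ?_⟩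
    · have h1 := h.cont a b
      have h2 : Continuous fun r => v r a b := continuous_iff_continuousAt.2 fun r =>
        (hvd r a b).continuousAt
      exact (h1.comp (continuous_const.add continuous_id)).sub h2
    · simp [hv0]
    · obtain ⟨M, hM⟩ := h.bdd
      exact ⟨M + B * (pConst d * 2 ^ d * ell d τ), fun r hr a b => (abs_sub _ _).trans
        (add_le_add (hM _ (by linarith) a b) (hvb r hr a b))⟩
    · have h1 := (h.deriv (τ + r) (by linarith) a b).comp r ((hasDerivAt_id r).const_add τ)
      refine (h1.sub (hvd r a b)).congr_deriv ?_
      rw [lap_sub, lap_sub]; ring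
    · exact h.src (τ + r) (by linarith) a b
  have h1 := ih _ _ hrest x w e he
  have h2 := pair_heatFlow_gradient hvd hvb hτ.le x w he
  have hs : 0 < √√(1 + τ) := Real.sqrt_pos.2 (Real.sqrt_pos.2 (by linarith))
  have h3 : 2 * (B * (pConst d * 2 ^ d * ell d τ)) * q τ 0 ≤
      B * (16 * (pConst d * 2 ^ d) / √√(1 + τ)) := by
    calc 2 * (B * (pConst d * 2 ^ d * ell d τ)) * q τ 0
        ≤ 2 * (B * (pConst d * 2 ^ d * (4 * √√(1 + τ)))) * (2 / √(1 + τ)) := by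
          have := q_nonneg hτ.le 0
          gcongr
          · exact ell_le_sqrt_sqrt hd hτ.le
          · exact q_zero_le hτ.le
      _ = B * (16 * (pConst d * 2 ^ d) / √√(1 + τ)) := by
        have e1 : √(1 + τ) = √√(1 + τ) * √√(1 + τ) := (Real.mul_self_sqrt (Real.sqrt_nonneg _)).symm
        have e2 : √√(1 + τ) / √(1 + τ) = 1 / √√(1 + τ) := by
          rw [div_eq_div_iff (Real.sqrt_pos.2 (by linarith)).ne' hs.ne', one_mul, ← e1]
        calc _ = B * (16 * (pConst d * 2 ^ d)) * (√√(1 + τ) / √(1 + τ)) := by ring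
          _ = _ := by rw [e2]; ring
  have e : u (τ + τ) (x + e) w - u (τ + τ) x w =
      ((u (τ + τ) (x + e) w - v τ (x + e) w) - (u (τ + τ) x w - v τ x w)) +
        (v τ (x + e) w - v τ x w) := by ring
  rw [e]
  refine (abs_add_le _ _).trans ?_
  rw [mul_add]
  exact add_le_add h1 (h2.trans h3)

theorem FreePair.gradient_dyadic (hd : 2 ≤ d) {B : ℝ} (hB : 0 ≤ B) (k : ℕ) :
    ∀ τ : ℝ, 0 ≤ τ → τ ≤ 2 ^ k → ∀ u F, FreePair (d := d) u F B → ∀ x w : Site d, ∀ e ∈ dirs d,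
      |u τ (x + e) w - u τ x w| ≤
        B * (pConst d * 2 ^ d * (2 + 32 * ∑ j ∈ Finset.range k, (1 / √√2) ^ j)) := by
  have hp := pConst_pos d
  induction k with
  | zero =>
    intro τ hτ hτ1 u F h x w e he
    rw [pow_zero] at hτ1
    have h1 : ell d τ ≤ 1 := by
      have : ∫ r in (0 : ℝ)..τ, heatDecay d r ≤ ∫ r in (0 : ℝ)..τ, (1 : ℝ) :=
        intervalIntegral.integral_mono_on hτ (intervalIntegrable_heatDecay d le_rfl hτ)
          (continuous_const.intervalIntegrable _ _) fun r hr => heatDecay_le_one d hr.1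
      simp only [intervalIntegral.integral_const, smul_eq_mul, mul_one, sub_zero] at this
      exact this.trans hτ1
    have h2 : B * (pConst d * 2 ^ d * ell d τ) ≤ B * (pConst d * 2 ^ d * 1) := by gcongr
    have h3 := h.abs_le hB hτ (x + e) w
    have h4 := h.abs_le hB hτ x w
    simp only [Finset.range_zero, Finset.sum_empty, mul_zero, add_zero]
    exact (abs_sub _ _).trans (by linarith)
  | succ k ih =>
    intro τ hτ hτk u F h x w e he
    rcases le_or_gt τ (2 ^ k) with hle | hgt
    · refine (ih τ hτ hle u F h x w e he).trans ?_
      rw [Finset.sum_range_succ]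
      gcongr
      have : 0 ≤ (1 / √√2) ^ k := by positivity
      linarith
    · have hpow : (0 : ℝ) < 2 ^ k := by positivity
      have h1 : 0 < τ / 2 := by linarith
      have h2 := FreePair.gradient_step hd hB h1
        (ih (τ / 2) h1.le (by rw [pow_succ] at hτk; linarith)) h x w he
      rw [add_halves] at h2
      refine h2.trans ?_
      -- Fourth powers reduce this to 2^k ≤ 16 (1 + τ/2), which follows from τ > 2^k.
      have h3 : √√2 ^ k ≤ 2 * √√(1 + τ / 2) := by
        have e4 : ∀ {x : ℝ}, 0 ≤ x → √√x ^ 4 = x := fun hx => by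
          rw [show (4 : ℕ) = 2 * 2 from rfl, pow_mul, Real.sq_sqrt (Real.sqrt_nonneg _),
            Real.sq_sqrt hx]
        refine le_of_pow_le_pow_left₀ (n := 4) (by norm_num) (by positivity) ?_
        rw [mul_pow, e4 (by linarith), ← pow_mul, mul_comm k 4, pow_mul, e4 (by norm_num)]
        linarith
      have hs : 0 < √√(1 + τ / 2) := Real.sqrt_pos.2 (Real.sqrt_pos.2 (by linarith))
      have hs2 : 0 < √√(2 : ℝ) := by positivity
      have h4 : 1 / √√(1 + τ / 2) ≤ 2 * (1 / √√2) ^ k := by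
        rw [div_pow, one_pow, mul_one_div, div_le_div_iff₀ hs (by positivity), one_mul]
        exact h3
      rw [Finset.sum_range_succ]
      have h5 : 16 * (pConst d * 2 ^ d) / √√(1 + τ / 2) ≤
          16 * (pConst d * 2 ^ d) * (2 * (1 / √√2) ^ k) := by
        rw [← mul_one_div]
        gcongr
      have h6 := mul_le_mul_of_nonneg_left h5 hB
      linarith

/-- The constant in the gradient bound. -/
def gradConst (d : ℕ) : ℝ := pConst d * 2 ^ d * (2 + 32 * (1 - 1 / √√2)⁻¹)

theorem one_div_sqrt_sqrt_two_lt : 1 / √√(2 : ℝ) < 1 := by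
  rw [div_lt_one (by positivity), Real.lt_sqrt (by norm_num), one_pow, Real.lt_sqrt (by norm_num)]
  norm_num

theorem gradConst_nonneg (d : ℕ) : 0 ≤ gradConst d := by
  have hp := pConst_pos d
  have : 0 ≤ 1 - 1 / √√(2 : ℝ) := by linarith [one_div_sqrt_sqrt_two_lt]
  unfold gradConst; positivity

theorem FreePair.abs_gradient_le (hd : 2 ≤ d) {u F : ℝ → Site d → Site d → ℝ} {B : ℝ}
    (h : FreePair u F B) (hB : 0 ≤ B) {τ : ℝ} (hτ : 0 ≤ τ) (x w : Site d) {e : Site d}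
    (he : e ∈ dirs d) : |u τ (x + e) w - u τ x w| ≤ B * gradConst d := by
  have hp := pConst_pos d
  obtain ⟨k, hk⟩ := pow_unbounded_of_one_lt τ (by norm_num : (1 : ℝ) < 2)
  refine (FreePair.gradient_dyadic hd hB k τ hτ hk.le u F h x w e he).trans ?_
  unfold gradConst
  have h1 : ∑ j ∈ Finset.range k, (1 / √√(2 : ℝ)) ^ j ≤ (1 - 1 / √√2)⁻¹ := by
    have h0 : 0 ≤ 1 / √√(2 : ℝ) := by positivity
    rw [← tsum_geometric_of_lt_one h0 one_div_sqrt_sqrt_two_lt]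
    exact (summable_geometric_of_lt_one h0 one_div_sqrt_sqrt_two_lt).sum_le_tsum _
      fun j _ => by positivity
  gcongr

end

section

variable {d : ℕ}

/-! ### The hierarchy of correlation functions -/

/-- The source term in the equation of the correlation functions of the exclusion process with
density profile `ρ`. -/
def source (ρ : Site d → ℝ) (f : Finset (Site d) → ℝ) (A : Finset (Site d)) : ℝ :=
  ∑ a ∈ A, ∑ b ∈ nbr a ∩ A, (-((ρ a - ρ b) ^ 2 / 2) * f ((A.erase a).erase b) +
    (ρ a - ρ b) * (f (A.erase a) - f (A.erase b)))

/-- A bounded solution of the hierarchy of correlation equations, for a density profile whose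
discrete gradient is at most `δ`. -/
structure Hierarchy (δ : ℝ) (ρ : ℝ → Site d → ℝ) (ψ : ℝ → Finset (Site d) → ℝ) : Prop where
  cont : ∀ A, Continuous (ψ · A)
  bdd : ∀ τ A, |ψ τ A| ≤ 1
  deriv : ∀ τ, 0 < τ → ∀ A, HasDerivAt (ψ · A) (exgen (ψ τ) A + source (ρ τ) (ψ τ) A) τ
  grad : ∀ τ, 0 ≤ τ → ∀ a, ∀ b ∈ nbr a, |ρ τ a - ρ τ b| ≤ δ

theorem abs_source_le {δ P G : ℝ} {ρ : Site d → ℝ} {f : Finset (Site d) → ℝ} {A : Finset (Site d)}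
    (hδ : 0 ≤ δ) (hρ : ∀ a, ∀ b ∈ nbr a, |ρ a - ρ b| ≤ δ)
    (hP : ∀ a ∈ A, ∀ b ∈ nbr a ∩ A, |f ((A.erase a).erase b)| ≤ P)
    (hG : ∀ a ∈ A, ∀ b ∈ nbr a ∩ A, |f (A.erase a) - f (A.erase b)| ≤ G) :
    |source ρ f A| ≤ (δ ^ 2 * P + δ * G) * adjCount A := by
  rw [source, adjCount, Finset.mul_sum]
  refine (Finset.abs_sum_le_sum_abs _ _).trans (Finset.sum_le_sum fun a ha => ?_)
  rw [Finset.mul_sum]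
  refine (Finset.abs_sum_le_sum_abs _ _).trans (Finset.sum_le_sum fun b hb => ?_)
  have h1 := hρ a b (Finset.mem_inter.1 hb).1
  have h2 := hP a ha b hb
  have h3 := hG a ha b hb
  have h4 : |(ρ a - ρ b) ^ 2 / 2| ≤ δ ^ 2 := by
    rw [abs_of_nonneg (by positivity)]
    have := sq_le_sq' (by linarith [(abs_le.1 h1).1]) (abs_le.1 h1).2
    linarith [sq_nonneg δ]
  rw [mul_one]
  refine (abs_add_le _ _).trans (add_le_add ?_ ?_)
  · rw [abs_mul, abs_neg]
    exact mul_le_mul h4 h2 (abs_nonneg _) (sq_nonneg δ)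
  · rw [abs_mul]
    exact mul_le_mul h1 h3 (abs_nonneg _) hδ

theorem exgen_pair (f : Finset (Site d) → ℝ) {x w : Site d} (h : x ≠ w) :
    exgen f {x, w} = ∑ b ∈ nbr x \ {x, w}, (f {b, w} - f {x, w}) +
      ∑ b ∈ nbr w \ {x, w}, (f {x, b} - f {x, w}) := by
  have e1 : ({x, w} : Finset (Site d)).erase x = {w} := by
    ext z; simp only [Finset.mem_erase, Finset.mem_insert, Finset.mem_singleton]; grind
  have e2 : ({x, w} : Finset (Site d)).erase w = {x} := by
    ext z; simp only [Finset.mem_erase, Finset.mem_insert, Finset.mem_singleton]; grind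
  rw [exgen, Finset.sum_pair h, e1, e2]
  congr 1
  exact Finset.sum_congr rfl fun b _ => by rw [Finset.pair_comm]

theorem nbr_inter_pair_left {x w : Site d} :
    nbr x ∩ {x, w} = if w ∈ nbr x then {w} else ∅ := by
  have := self_notMem_nbr x
  ext z
  split_ifs <;> simp only [Finset.mem_inter, Finset.mem_insert, Finset.mem_singleton,
    Finset.notMem_empty] <;> grind

theorem nbr_inter_pair_right {x w : Site d} :
    nbr w ∩ {x, w} = if w ∈ nbr x then {x} else ∅ := by
  rw [Finset.pair_comm, nbr_inter_pair_left]
  simp only [mem_nbr_comm (a := w) (b := x)]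

theorem source_pair {ρ : Site d → ℝ} {f : Finset (Site d) → ℝ} (h0 : f ∅ = 1)
    (h1 : ∀ x, f {x} = 0) {x w : Site d} (h : x ≠ w) :
    source ρ f {x, w} = if w ∈ nbr x then -(ρ x - ρ w) ^ 2 else 0 := by
  have e1 : ({x, w} : Finset (Site d)).erase x = {w} := by
    ext z; simp only [Finset.mem_erase, Finset.mem_insert, Finset.mem_singleton]; grind
  have e2 : ({x, w} : Finset (Site d)).erase w = {x} := by
    ext z; simp only [Finset.mem_erase, Finset.mem_insert, Finset.mem_singleton]; grind
  rw [source, Finset.sum_pair h, nbr_inter_pair_left, nbr_inter_pair_right]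
  split_ifs with hw
  · simp only [Finset.sum_singleton, e1, e2, h1, Finset.erase_singleton, h0]
    ring
  · simp

/-- The auxiliary diagonal values, which make the two-point function solve the heat equation for
independent walks on the diagonal. -/
def diagExt (ψ : ℝ → Finset (Site d) → ℝ) (τ : ℝ) (x : Site d) : ℝ :=
  Real.exp (-(4 * d * τ)) * ∫ r in (0 : ℝ)..τ, Real.exp (4 * d * r) * (2 * ∑ e ∈ dirs d, ψ r {x, x + e})

/-- The two-point function, extended to the diagonal. -/
def pairExt (ψ : ℝ → Finset (Site d) → ℝ) (τ : ℝ) (x w : Site d) : ℝ :=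
  if x = w then diagExt ψ τ x else ψ τ {x, w}

theorem pairExt_comm (ψ : ℝ → Finset (Site d) → ℝ) (τ : ℝ) (x w : Site d) :
    pairExt ψ τ x w = pairExt ψ τ w x := by
  simp only [pairExt, Finset.pair_comm x w, eq_comm (a := x) (b := w)]
  split_ifs with h
  · rw [h]
  · rfl

theorem hasDerivAt_diagExt {ψ : ℝ → Finset (Site d) → ℝ} (hc : ∀ A, Continuous (ψ · A)) (τ : ℝ)
    (x : Site d) : HasDerivAt (diagExt ψ · x)
      (2 * ∑ e ∈ dirs d, ψ τ {x, x + e} - 4 * d * diagExt ψ τ x) τ := by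
  have hcont : Continuous fun r => Real.exp (4 * d * r) * (2 * ∑ e ∈ dirs d, ψ r {x, x + e}) := by
    have := fun e => hc {x, x + e}
    fun_prop
  have h1 : HasDerivAt (fun τ : ℝ => Real.exp (-(4 * d * τ)))
      (Real.exp (-(4 * d * τ)) * -(4 * d)) τ := by
    simpa using ((hasDerivAt_id τ).const_mul (4 * d : ℝ)).fun_neg.exp
  have h2 := intervalIntegral.integral_hasDerivAt_right (hcont.intervalIntegrable 0 τ)
    hcont.stronglyMeasurable.stronglyMeasurableAtFilter hcont.continuousAt
  refine (h1.mul h2).congr_deriv ?_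
  have h3 : Real.exp (-(4 * d * τ)) * Real.exp (4 * d * τ) = 1 := by
    rw [← Real.exp_add]; simp
  rw [diagExt]
  linear_combination (2 * ∑ e ∈ dirs d, ψ τ {x, x + e}) * h3

theorem abs_diagExt_le {ψ : ℝ → Finset (Site d) → ℝ} (hc : ∀ A, Continuous (ψ · A))
    (hb : ∀ τ A, |ψ τ A| ≤ 1) {τ : ℝ} (hτ : 0 ≤ τ) (x : Site d) : |diagExt ψ τ x| ≤ 1 := by
  have hcont : Continuous fun r => Real.exp (4 * d * r) * (2 * ∑ e ∈ dirs d, ψ r {x, x + e}) := by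
    have := fun e => hc {x, x + e}
    fun_prop
  have h1 : |∫ r in (0 : ℝ)..τ, Real.exp (4 * d * r) * (2 * ∑ e ∈ dirs d, ψ r {x, x + e})| ≤
      ∫ r in (0 : ℝ)..τ, Real.exp (4 * d * r) * (4 * d) := by
    refine (intervalIntegral.abs_integral_le_integral_abs hτ).trans ?_
    refine intervalIntegral.integral_mono_on hτ (hcont.abs.intervalIntegrable _ _)
      ((by fun_prop : Continuous _).intervalIntegrable _ _) fun r _ => ?_
    rw [abs_mul, abs_of_pos (Real.exp_pos _), abs_mul, abs_of_pos (by norm_num : (0 : ℝ) < 2)]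
    refine mul_le_mul_of_nonneg_left ?_ (Real.exp_pos _).le
    have h2 : |∑ e ∈ dirs d, ψ r {x, x + e}| ≤ ∑ e ∈ dirs d, 1 :=
      (Finset.abs_sum_le_sum_abs _ _).trans (Finset.sum_le_sum fun e _ => hb _ _)
    rw [Finset.sum_const, nsmul_eq_mul, mul_one, card_dirs] at h2
    linarith
  have h3 : ∫ r in (0 : ℝ)..τ, Real.exp (4 * d * r) * (4 * d) = Real.exp (4 * d * τ) - 1 := by
    rw [intervalIntegral.integral_eq_sub_of_hasDerivAt (f := fun r => Real.exp (4 * d * r))]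
    · simp
    · intro r _
      simpa using ((hasDerivAt_id r).const_mul (4 * d : ℝ)).exp
    · exact (by fun_prop : Continuous _).intervalIntegrable _ _
  rw [diagExt, abs_mul, abs_of_pos (Real.exp_pos _), Real.exp_neg, inv_mul_le_iff₀ (Real.exp_pos _)]
  linarith

/-- Two independent walks at neighbouring sites have two jumps that exclusion forbids, namely onto
each other. These land on the diagonal, and their increments add up to the mixed second difference.
-/
theorem lap_pairExt_of_ne (ψ : ℝ → Finset (Site d) → ℝ) (τ : ℝ) {x w : Site d} (h : x ≠ w) :
    lap (pairExt ψ τ · w) x + lap (pairExt ψ τ x ·) w = exgen (ψ τ) {x, w} +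
      if w ∈ nbr x then pairExt ψ τ x x + pairExt ψ τ w w - pairExt ψ τ x w - pairExt ψ τ w x
      else 0 := by
  have hne : pairExt ψ τ x w = ψ τ {x, w} := if_neg h
  have h1 : lap (pairExt ψ τ · w) x = ∑ b ∈ nbr x \ {x, w}, (ψ τ {b, w} - ψ τ {x, w}) +
      if w ∈ nbr x then pairExt ψ τ w w - pairExt ψ τ x w else 0 := by
    rw [lap_eq_sum_nbr, ← Finset.sum_inter_add_sum_sdiff (nbr x) {x, w}, add_comm,
      nbr_inter_pair_left]
    congr 1
    · refine Finset.sum_congr rfl fun b hb => ?_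
      have : b ≠ w := by rintro rfl; simp at hb
      rw [hne, pairExt, if_neg this]
    · split_ifs <;> simp
  have h2 : lap (pairExt ψ τ x ·) w = ∑ b ∈ nbr w \ {x, w}, (ψ τ {x, b} - ψ τ {x, w}) +
      if w ∈ nbr x then pairExt ψ τ x x - pairExt ψ τ x w else 0 := by
    rw [lap_eq_sum_nbr, ← Finset.sum_inter_add_sum_sdiff (nbr w) {x, w}, add_comm,
      nbr_inter_pair_right]
    congr 1
    · refine Finset.sum_congr rfl fun b hb => ?_
      have : x ≠ b := by rintro rfl; simp at hb
      rw [hne, pairExt, if_neg this]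
    · split_ifs <;> simp
  rw [h1, h2, exgen_pair _ h, pairExt_comm ψ τ w x]
  split_ifs <;> ring

/-- The source in the equation of the extended two-point function. -/
def pairSource (ρ : ℝ → Site d → ℝ) (ψ : ℝ → Finset (Site d) → ℝ) (τ : ℝ) (x w : Site d) : ℝ :=
  if w - x ∈ dirs d then -(ρ τ x - ρ τ w) ^ 2 -
    (pairExt ψ τ x x + pairExt ψ τ w w - pairExt ψ τ x w - pairExt ψ τ w x) else 0

variable {δ : ℝ} {ρ : ℝ → Site d → ℝ} {ψ : ℝ → Finset (Site d) → ℝ}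

theorem Hierarchy.abs_pairExt_le (h : Hierarchy δ ρ ψ) {τ : ℝ} (hτ : 0 ≤ τ) (x w : Site d) :
    |pairExt ψ τ x w| ≤ 1 := by
  rw [pairExt]
  split_ifs
  · exact abs_diagExt_le h.cont h.bdd hτ x
  · exact h.bdd _ _

theorem Hierarchy.abs_pairSource_le (h : Hierarchy δ ρ ψ) {D τ : ℝ} (hτ : 0 < τ)
    (x w : Site d) (hD : w - x ∈ dirs d → |pairExt ψ τ x x + pairExt ψ τ w w - pairExt ψ τ x w -
      pairExt ψ τ w x| ≤ D) :
    |pairSource ρ ψ τ x w| ≤ if w - x ∈ dirs d then δ ^ 2 + D else 0 := by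
  rw [pairSource]
  split_ifs with hw
  · have h1 := h.grad τ hτ.le x w (mem_nbr.2 hw)
    have h2 : |-(ρ τ x - ρ τ w) ^ 2| ≤ δ ^ 2 := by
      rw [abs_neg, abs_of_nonneg (sq_nonneg _)]
      exact sq_le_sq' (by linarith [(abs_le.1 h1).1]) (abs_le.1 h1).2
    exact (abs_sub _ _).trans (add_le_add h2 (hD hw))
  · simp

theorem Hierarchy.freePair (h : Hierarchy δ ρ ψ) (h0 : ∀ τ, ψ τ ∅ = 1) (h1 : ∀ τ x, ψ τ {x} = 0)
    (hi : ∀ A : Finset (Site d), A.Nonempty → ψ 0 A = 0) {B : ℝ}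
    (hB : ∀ τ, 0 < τ → ∀ a b, |pairSource ρ ψ τ a b| ≤ if b - a ∈ dirs d then B else 0) :
    FreePair (pairExt ψ) (pairSource ρ ψ) B where
  cont a b := by
    unfold pairExt
    split_ifs
    · exact continuous_iff_continuousAt.2 fun r => (hasDerivAt_diagExt h.cont r a).continuousAt
    · exact h.cont _
  zero a b := by
    unfold pairExt
    split_ifs
    · simp [diagExt]
    · exact hi _ ⟨a, by simp⟩
  bdd := ⟨1, fun τ hτ a b => h.abs_pairExt_le hτ a b⟩
  deriv τ hτ a b := by
    by_cases hab : a = b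
    · subst hab
      have e1 : (pairExt ψ · a a) = (diagExt ψ · a) := by
        funext τ; simp [pairExt]
      rw [e1]
      refine (hasDerivAt_diagExt h.cont τ a).congr_deriv ?_
      have e2 : ∀ e ∈ dirs d, pairExt ψ τ a (a + e) = ψ τ {a, a + e} := fun e he => by
        refine if_neg fun h => zero_notMem_dirs (d := d) ?_
        have : e = 0 := by simpa using h.symm
        rwa [← this]
      have e3 : ∀ z, pairExt ψ τ z a = pairExt ψ τ a z := fun z => pairExt_comm ψ τ z a
      rw [pairSource, sub_self, if_neg zero_notMem_dirs, lap_eq, lap_eq]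
      simp only [e3]
      rw [Finset.sum_congr rfl e2]
      have e4 : pairExt ψ τ a a = diagExt ψ τ a := if_pos rfl
      rw [e4]; ring
    · have e1 : (pairExt ψ · a b) = (ψ · {a, b}) := by
        funext τ; simp [pairExt, hab]
      rw [e1, lap_pairExt_of_ne ψ τ hab]
      refine (h.deriv τ hτ {a, b}).congr_deriv ?_
      rw [source_pair (h0 τ) (h1 τ) hab, pairSource]
      simp only [mem_nbr]
      split_ifs <;> ring
  src := hB

/-- The two-point function has gradient of order `δ²`. -/
theorem Hierarchy.abs_gradient_pairExt_le (hd : 2 ≤ d) (h : Hierarchy δ ρ ψ)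
    (h0 : ∀ τ, ψ τ ∅ = 1) (h1 : ∀ τ x, ψ τ {x} = 0)
    (hi : ∀ A : Finset (Site d), A.Nonempty → ψ 0 A = 0) {τ : ℝ} (hτ : 0 ≤ τ) (x w : Site d)
    {e : Site d} (he : e ∈ dirs d) :
    |pairExt ψ τ (x + e) w - pairExt ψ τ x w| ≤ 2 * δ ^ 2 * gradConst d := by
  -- Bootstrap: a bound B on the source returns δ² + B/d, at most δ² + B/2, whose fixed point is
  -- 2δ². The start 2δ² + 4 is allowed because the four values in the mixed difference are at most
  -- one.
  have key : ∀ k : ℕ, ∀ τ, 0 < τ → ∀ a b, |pairSource ρ ψ τ a b| ≤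
      if b - a ∈ dirs d then 2 * δ ^ 2 + 4 / 2 ^ k else 0 := by
    intro k
    induction k with
    | zero =>
      intro τ hτ a b
      refine (h.abs_pairSource_le hτ a b (D := 4) fun _ => ?_).trans ?_
      · have hh := fun a b => abs_le.1 (h.abs_pairExt_le hτ.le a b)
        rw [abs_le]
        constructor <;> linarith [(hh a a).1, (hh a a).2, (hh b b).1, (hh b b).2, (hh a b).1,
          (hh a b).2, (hh b a).1, (hh b a).2]
      · split_ifs
        · rw [pow_zero]; linarith [sq_nonneg δ]
        · exact le_rfl
    | succ k ih =>
      intro τ hτ a b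
      have hF := h.freePair h0 h1 hi ih
      refine (h.abs_pairSource_le hτ a b (D := (2 * δ ^ 2 + 4 / 2 ^ k) / 2) fun hab => ?_).trans ?_
      · refine (hF.abs_mixedDiff_le (by positivity) (by omega) hτ.le hab).trans ?_
        gcongr
        exact_mod_cast hd
      · split_ifs
        · rw [pow_succ (2 : ℝ) k]
          have : (4 : ℝ) / (2 ^ k * 2) = 4 / 2 ^ k / 2 := by rw [div_div]
          rw [this]; linarith
        · exact le_rfl
  have hlim : ∀ τ, 0 < τ → ∀ a b, |pairSource ρ ψ τ a b| ≤
      if b - a ∈ dirs d then 2 * δ ^ 2 else 0 := by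
    intro τ hτ a b
    split_ifs with hab
    · have ht : Tendsto (fun k : ℕ => 2 * δ ^ 2 + 4 / 2 ^ k) atTop (𝓝 (2 * δ ^ 2 + 0)) :=
        tendsto_const_nhds.add (tendsto_const_nhds.div_atTop
          (tendsto_pow_atTop_atTop_of_one_lt (by norm_num)))
      rw [add_zero] at ht
      refine ge_of_tendsto' ht fun k => ?_
      have := key k τ hτ a b
      rwa [if_pos hab] at this
    · have := key 0 τ hτ a b
      rwa [if_neg hab] at this
  exact (h.freePair h0 h1 hi hlim).abs_gradient_le hd (by positivity) hτ x w he

end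

section

variable {d : ℕ}

/-! ### Convolutions of heat decays -/

theorem heatDecay_half_le (d : ℕ) {τ : ℝ} (hτ : 0 ≤ τ) :
    heatDecay d (τ / 2) ≤ 2 ^ d * heatDecay d τ := by
  rw [heatDecay, heatDecay, ← mul_pow]
  have h1 : 0 < √(1 + τ / 2) := Real.sqrt_pos.2 (by linarith)
  have h2 : 0 < √(1 + τ) := Real.sqrt_pos.2 (by linarith)
  refine pow_le_pow_left₀ (by positivity) ?_ d
  rw [mul_one_div, div_le_div_iff₀ h1 h2, one_mul, Real.sqrt_le_left (by positivity), mul_pow,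
    Real.sq_sqrt (by linarith)]
  linarith

theorem intervalIntegrable_heatDecay_mul (a b : ℕ) {τ : ℝ} (hτ : 0 ≤ τ) :
    IntervalIntegrable (fun r => heatDecay a r * heatDecay b (τ - r)) volume 0 τ :=
  intervalIntegrable_mul_heatDecay_sub b hτ ((continuousOn_heatDecay a).mono fun _ hr => hr.1)

/-- Split at τ/2: on either half one of the two factors is at most its value at τ/2. -/
theorem integral_heatDecay_mul_le (a b : ℕ) {τ : ℝ} (hτ : 0 ≤ τ) :
    ∫ r in (0 : ℝ)..τ, heatDecay a r * heatDecay b (τ - r) ≤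
      heatDecay b (τ / 2) * ell a τ + heatDecay a (τ / 2) * ell b τ := by
  have i1 := intervalIntegrable_heatDecay a le_rfl hτ
  have i2 : IntervalIntegrable (fun r => heatDecay b (τ - r)) volume 0 τ := by
    have := intervalIntegrable_mul_heatDecay_sub (S := fun _ => 1) b hτ continuousOn_const
    simpa using this
  rw [← integral_heatDecay_sub b τ, ell, ← intervalIntegral.integral_const_mul,
    ← intervalIntegral.integral_const_mul,
    ← intervalIntegral.integral_add (i1.const_mul _) (i2.const_mul _)]
  refine intervalIntegral.integral_mono_on hτ (intervalIntegrable_heatDecay_mul a b hτ)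
    ((i1.const_mul _).add (i2.const_mul _)) fun r hr => ?_
  have ha := heatDecay_nonneg a r
  have hb := heatDecay_nonneg b (τ - r)
  have ha' := heatDecay_nonneg a (τ / 2)
  have hb' := heatDecay_nonneg b (τ / 2)
  rcases le_total r (τ / 2) with h | h
  · have h1 := heatDecay_antitone b (by linarith : 0 ≤ τ / 2) (by linarith : τ / 2 ≤ τ - r)
    have h2 := mul_le_mul_of_nonneg_left h1 ha
    have h3 := mul_nonneg ha' hb
    linarith
  · have h1 := heatDecay_antitone a (by linarith : 0 ≤ τ / 2) h
    have h2 := mul_le_mul_of_nonneg_right h1 hb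
    have h3 := mul_nonneg hb' ha
    linarith

theorem integral_heatDecay_self_le (d : ℕ) {τ : ℝ} (hτ : 0 ≤ τ) :
    ∫ r in (0 : ℝ)..τ, heatDecay d r * heatDecay d (τ - r) ≤ 2 * 2 ^ d * (ell d τ * heatDecay d τ) := by
  have h1 := integral_heatDecay_mul_le d d hτ
  have h2 := mul_le_mul_of_nonneg_right (heatDecay_half_le d hτ) (ell_nonneg d hτ)
  linarith

/-- The additional half power makes the integral of one factor bounded, and `ell d τ` costs at most
the half power that `heatDecay (d + 1)` has to spare. So no logarithm appears in d = 2. -/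
theorem integral_heatDecay_succ_le (hd : 2 ≤ d) {τ : ℝ} (hτ : 0 ≤ τ) :
    ∫ r in (0 : ℝ)..τ, heatDecay (d + 1) r * heatDecay d (τ - r) ≤ 10 * 2 ^ d * heatDecay d τ := by
  have h1 := integral_heatDecay_mul_le (d + 1) d hτ
  have h2 : ell (d + 1) τ ≤ 2 := (ell_le_of_le (by omega) hτ).trans (ell_three_le hτ)
  have hD := heatDecay_nonneg d τ
  have h3 : heatDecay d (τ / 2) * ell (d + 1) τ ≤ (2 ^ d * heatDecay d τ) * 2 :=
    mul_le_mul (heatDecay_half_le d hτ) h2 (ell_nonneg _ hτ) (by positivity)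
  have hs : 0 < √(1 + τ) := Real.sqrt_pos.2 (by linarith)
  have h4 : ell d τ ≤ 4 * √(1 + τ) := by
    refine (ell_le_sqrt_sqrt hd hτ).trans ?_
    have : √√(1 + τ) ≤ √(1 + τ) := by
      rw [Real.sqrt_le_left hs.le, sq]
      exact le_mul_of_one_le_left hs.le (Real.one_le_sqrt.2 (by linarith))
    linarith
  have h5 : heatDecay (d + 1) (τ / 2) * ell d τ ≤ (2 ^ (d + 1) * heatDecay (d + 1) τ) * (4 * √(1 + τ)) :=
    mul_le_mul (heatDecay_half_le (d + 1) hτ) h4 (ell_nonneg _ hτ)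
      (mul_nonneg (by positivity) (heatDecay_nonneg _ _))
  have h6 : heatDecay (d + 1) τ * √(1 + τ) = heatDecay d τ := by
    rw [heatDecay, heatDecay, pow_succ, mul_assoc, one_div_mul_cancel hs.ne', mul_one]
  calc _ ≤ (2 ^ d * heatDecay d τ) * 2 + (2 ^ (d + 1) * heatDecay (d + 1) τ) * (4 * √(1 + τ)) := by
        linarith
    _ = (2 ^ d * heatDecay d τ) * 2 + 2 ^ (d + 1) * 4 * (heatDecay (d + 1) τ * √(1 + τ)) := by ring
    _ = 10 * 2 ^ d * heatDecay d τ := by rw [h6, pow_succ]; ring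

/-! ### Correlations at equal times -/

variable {δ : ℝ} {ρ : ℝ → Site d → ℝ} {ψ : ℝ → Finset (Site d) → ℝ}

theorem Hierarchy.nonneg (hd : 0 < d) (h : Hierarchy δ ρ ψ) : 0 ≤ δ :=
  (abs_nonneg _).trans (h.grad 0 le_rfl 0 (unitVec ⟨0, hd⟩) (mem_nbr.2 (by
    rw [sub_zero]; exact unitVec_mem_dirs _)))

/-- Bounds by a time-independent source, for vanishing initial data. -/
theorem Hierarchy.abs_le_of_source (h : Hierarchy δ ρ ψ) {k : ℕ} {s τ : ℝ} (hs0 : 0 ≤ s)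
    (hi : ∀ A : Finset (Site d), A.card = k → ψ 0 A = 0)
    (hs : ∀ r ∈ Set.Ioo 0 τ, ∀ A : Finset (Site d), A.card = k →
      |source (ρ r) (ψ r) A| ≤ s * adjCount A) (hτ : 0 ≤ τ)
    {A : Finset (Site d)} (hA : A.card = k) : |ψ τ A| ≤ exConst d k * (s * ell d τ) := by
  have := exclusion_comparison (f := ψ) (s := fun r A => source (ρ r) (ψ r) A) (S := fun _ => s)
    (k := k) continuous_const (fun _ => hs0) (T := τ) (α := 0) (β := 0) (M := 1) le_rfl le_rfl
    (0 : Site d) (fun A _ => (h.cont A).continuousOn) (fun r hr A _ => h.deriv r hr.1 A)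
    (fun r _ A _ => h.bdd r A) hs (fun A hA => by simp [hi A hA]) ⟨hτ, le_rfl⟩ hA
  rw [intervalIntegral.integral_const_mul, integral_heatDecay_sub] at this
  simpa using this

/-- The initial and normalization conditions of the equal-time correlation functions. -/
structure EqualTime (δ : ℝ) (ρ : ℝ → Site d → ℝ) (ψ : ℝ → Finset (Site d) → ℝ) : Prop
    extends Hierarchy δ ρ ψ where
  empty : ∀ τ, ψ τ ∅ = 1
  single : ∀ τ x, ψ τ {x} = 0
  init : ∀ A : Finset (Site d), A.Nonempty → ψ 0 A = 0

theorem EqualTime.init_card (h : EqualTime δ ρ ψ) {k : ℕ} (hk : 0 < k) (A : Finset (Site d))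
    (hA : A.card = k) : ψ 0 A = 0 := h.init A (Finset.card_pos.1 (hA ▸ hk))

theorem card_erase_erase {A : Finset (Site d)} {k : ℕ} (hA : A.card = k + 2) {a b : Site d}
    (ha : a ∈ A) (hb : b ∈ nbr a ∩ A) : ((A.erase a).erase b).card = k := by
  rw [Finset.mem_inter] at hb
  rw [Finset.card_erase_of_mem (Finset.mem_erase.2 ⟨(ne_of_mem_nbr hb.1).symm, hb.2⟩),
    Finset.card_erase_of_mem ha, hA]
  rfl

theorem card_erase_eq {A : Finset (Site d)} {k : ℕ} (hA : A.card = k + 1) {a : Site d}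
    (ha : a ∈ A) : (A.erase a).card = k := by
  rw [Finset.card_erase_of_mem ha, hA]; rfl

/-- Only the value 1 on the empty set feeds the two-point function, since the one-point functions
vanish. -/
theorem EqualTime.two_le (hd : 2 ≤ d) (h : EqualTime δ ρ ψ) {τ : ℝ} (hτ : 0 ≤ τ)
    {A : Finset (Site d)} (hA : A.card = 2) : |ψ τ A| ≤ exConst d 2 * (δ ^ 2 * ell d τ) := by
  have hδ := h.toHierarchy.nonneg (by omega)
  refine h.abs_le_of_source (by positivity) (h.init_card two_pos) (fun r hr A hA => ?_) hτ hA
  refine (abs_source_le (P := 1) (G := 0) hδ (h.grad r hr.1.le) (fun a _ b _ => h.bdd _ _)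
    fun a ha b hb => ?_).trans_eq (by ring)
  obtain ⟨z, hz⟩ := Finset.card_eq_one.1 (card_erase_eq hA ha)
  obtain ⟨z', hz'⟩ := Finset.card_eq_one.1 (card_erase_eq hA (Finset.mem_inter.1 hb).2)
  rw [hz, hz', h.single, h.single]
  simp

theorem EqualTime.abs_sub_le (hd : 2 ≤ d) (h : EqualTime δ ρ ψ) {τ : ℝ} (hτ : 0 ≤ τ)
    {A : Finset (Site d)} (hA : A.card = 3) {a b : Site d} (ha : a ∈ A) (hb : b ∈ nbr a ∩ A) :
    |ψ τ (A.erase a) - ψ τ (A.erase b)| ≤ 2 * δ ^ 2 * gradConst d := by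
  rw [Finset.mem_inter] at hb
  have hab := ne_of_mem_nbr hb.1
  obtain ⟨w, hw⟩ := Finset.card_eq_one.1 (card_erase_erase (k := 1) hA ha (Finset.mem_inter.2 hb))
  have hwm : w ∈ (A.erase a).erase b := by rw [hw]; simp
  rw [Finset.mem_erase, Finset.mem_erase] at hwm
  have e1 : A.erase a = {b, w} := by
    rw [← Finset.insert_erase (Finset.mem_erase.2 ⟨hab.symm, hb.2⟩ : b ∈ A.erase a), hw]
  have e2 : A.erase b = {a, w} := by
    rw [← Finset.insert_erase (Finset.mem_erase.2 ⟨hab, ha⟩ : a ∈ A.erase b),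
      Finset.erase_right_comm, hw]
  have := h.abs_gradient_pairExt_le hd h.empty h.single h.init hτ a w (mem_nbr.1 hb.1)
  rw [add_sub_cancel, pairExt, if_neg hwm.1.symm, pairExt, if_neg hwm.2.1.symm] at this
  rwa [e1, e2]

/-- The δ² part of the source contains one-point functions and vanishes. The other part is δ times a
gradient of the two-point function, of order δ² without logarithm, so only one factor `ell` is paid.
-/
theorem EqualTime.three_le (hd : 2 ≤ d) (h : EqualTime δ ρ ψ) {τ : ℝ} (hτ : 0 ≤ τ)
    {A : Finset (Site d)} (hA : A.card = 3) :
    |ψ τ A| ≤ exConst d 3 * (2 * gradConst d) * (δ ^ 3 * ell d τ) := by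
  have hδ := h.toHierarchy.nonneg (by omega)
  have hg := gradConst_nonneg d
  refine (h.abs_le_of_source (s := δ * (2 * δ ^ 2 * gradConst d)) (by positivity)
    (h.init_card three_pos) (fun r hr A hA => ?_) hτ hA).trans_eq (by ring)
  refine (abs_source_le (P := 0) hδ (h.grad r hr.1.le) (fun a ha b hb => ?_)
    fun a ha b hb => h.abs_sub_le hd hr.1.le hA ha hb).trans_eq (by ring)
  obtain ⟨w, hw⟩ := Finset.card_eq_one.1 (card_erase_erase (k := 1) hA ha hb)
  rw [hw, h.single, abs_zero]

/-- Here no cancellation is used: the sizes of the two- and three-point functions, already carrying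
one `ell`, are inserted into the source, which costs a second one. -/
theorem EqualTime.four_le (hd : 2 ≤ d) (h : EqualTime δ ρ ψ) {τ : ℝ} (hτ : 0 ≤ τ)
    {A : Finset (Site d)} (hA : A.card = 4) :
    |ψ τ A| ≤ exConst d 4 * (exConst d 2 + 2 * (exConst d 3 * (2 * gradConst d))) *
      (δ ^ 4 * ell d τ ^ 2) := by
  have hδ := h.toHierarchy.nonneg (by omega)
  have hg := gradConst_nonneg d
  have h2 := exConst_nonneg d 2
  have h3 := exConst_nonneg d 3
  have hl := ell_nonneg d hτ
  refine (h.abs_le_of_source (s := δ ^ 2 * (exConst d 2 * (δ ^ 2 * ell d τ)) +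
    δ * (exConst d 3 * (2 * gradConst d) * (δ ^ 3 * ell d τ) +
      exConst d 3 * (2 * gradConst d) * (δ ^ 3 * ell d τ))) (by positivity)
    (h.init_card four_pos) (fun r hr A hA => ?_) hτ hA).trans_eq (by ring)
  have hm := ell_mono d hr.1.le hr.2.le
  refine abs_source_le hδ (h.grad r hr.1.le) (fun a ha b hb => ?_) fun a ha b hb => ?_
  · refine (h.two_le hd hr.1.le (card_erase_erase hA ha hb)).trans ?_
    gcongr
  · have f : ∀ a ∈ A, |ψ r (A.erase a)| ≤ exConst d 3 * (2 * gradConst d) * (δ ^ 3 * ell d τ) := by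
      intro a ha
      refine (h.three_le hd hr.1.le (card_erase_eq hA ha)).trans ?_
      gcongr
    exact (abs_sub _ _).trans (add_le_add (f a ha) (f b (Finset.mem_inter.1 hb).2))

/-! ### Correlations at two times -/

/-- The correlation functions of the field at a site `y` at an earlier time `τ₀` with the field at
later times. -/
structure TwoTime (δ : ℝ) (ρ : ℝ → Site d → ℝ) (ψ : ℝ → Finset (Site d) → ℝ) (τ₀ : ℝ) (y : Site d)
    (ρ' : ℝ → Site d → ℝ) (χ : ℝ → Finset (Site d) → ℝ) : Prop
    extends Hierarchy δ ρ' χ where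
  equal : EqualTime δ ρ ψ
  time_nonneg : 0 ≤ τ₀
  empty : ∀ τ, χ τ ∅ = 0
  init_notMem : ∀ A, y ∉ A → χ 0 A = ψ τ₀ (insert y A)
  init_mem : ∃ r ∈ Set.Icc (0 : ℝ) 1, ∀ A, y ∈ A →
    χ 0 A = (1 - 2 * r) * ψ τ₀ A + r * (1 - r) * ψ τ₀ (A.erase y)

variable {τ₀ : ℝ} {y : Site d} {ρ' : ℝ → Site d → ℝ} {χ : ℝ → Finset (Site d) → ℝ}

theorem TwoTime.init_mem_le (h : TwoTime δ ρ ψ τ₀ y ρ' χ) {A : Finset (Site d)} (hy : y ∈ A) :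
    |χ 0 A| ≤ |ψ τ₀ A| + |ψ τ₀ (A.erase y)| := by
  obtain ⟨r, hr, hA⟩ := h.init_mem
  rw [hA A hy]
  have h1 : |1 - 2 * r| ≤ 1 := abs_le.2 ⟨by linarith [hr.2], by linarith [hr.1]⟩
  have h2 : |r * (1 - r)| ≤ 1 := by
    rw [abs_le]
    constructor <;> nlinarith [hr.1, hr.2, mul_nonneg hr.1 (sub_nonneg.2 hr.2)]
  refine (abs_add_le _ _).trans ?_
  rw [abs_mul, abs_mul]
  exact add_le_add (mul_le_of_le_one_left (abs_nonneg _) h1)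
    (mul_le_of_le_one_left (abs_nonneg _) h2)

theorem source_singleton (ρ : Site d → ℝ) (f : Finset (Site d) → ℝ) (x : Site d) :
    source ρ f {x} = 0 := by
  have : nbr x ∩ {x} = ∅ := by
    rw [Finset.inter_singleton_of_notMem (self_notMem_nbr x)]
  simp [source, this]

theorem exgen_singleton (f : Finset (Site d) → ℝ) (x : Site d) :
    exgen f {x} = lap (fun z => f {z}) x := by
  have : nbr x \ {x} = nbr x := by
    rw [Finset.sdiff_singleton_eq_erase, Finset.erase_eq_of_notMem (self_notMem_nbr x)]
  simp [exgen, this, lap_eq_sum_nbr]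

/-- Singletons have no source. The initial value is an equal-time two-point function away from y and
of order one at y, hence β = 1. -/
theorem TwoTime.one_le (hd : 2 ≤ d) (h : TwoTime δ ρ ψ τ₀ y ρ' χ) {τ : ℝ} (hτ : 0 ≤ τ)
    {A : Finset (Site d)} (hA : A.card = 1) :
    |χ τ A| ≤ exConst d 2 * (δ ^ 2 * ell d τ₀) + exConst d 1 * heatDecay d τ := by
  have h2 := exConst_nonneg d 2
  have hl := ell_nonneg d h.time_nonneg
  have := exclusion_comparison (f := χ) (s := fun r A => source (ρ' r) (χ r) A) (S := fun _ => 0)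
    (k := 1) continuous_const (fun _ => le_rfl) (T := τ) (α := exConst d 2 * (δ ^ 2 * ell d τ₀))
    (β := 1) (M := 1) (by positivity) zero_le_one
    y (fun A _ => (h.cont A).continuousOn) (fun r hr A _ => h.deriv r hr.1 A)
    (fun r _ A _ => h.bdd r A) (fun r hr A hA => ?_) (fun A hA => ?_) ⟨hτ, le_rfl⟩ hA
  · simpa using this
  · obtain ⟨x, rfl⟩ := Finset.card_eq_one.1 hA
    simp [source_singleton]
  · split_ifs with hy
    · have : 0 ≤ exConst d 2 * (δ ^ 2 * ell d τ₀) := by positivity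
      linarith [h.bdd 0 A]
    · rw [h.init_notMem A hy, add_zero]
      exact h.equal.two_le hd h.time_nonneg (by rw [Finset.card_insert_of_notMem hy, hA])

theorem heat_abs_le {u : ℝ → Site d → ℝ} {T M m : ℝ}
    (hc : ∀ x, ContinuousOn (u · x) (Set.Icc 0 T))
    (hd : ∀ τ ∈ Set.Ioo 0 T, ∀ x, HasDerivAt (u · x) (lap (u τ) x) τ)
    (hb : ∀ τ ∈ Set.Icc 0 T, ∀ x, |u τ x| ≤ M)
    (h0 : ∀ x, |u 0 x| ≤ m) {τ : ℝ} (hτ : τ ∈ Set.Icc 0 T) (x : Site d) : |u τ x| ≤ m := by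
  have key : ∀ σ : ℝ, |σ| = 1 → 0 ≤ m + σ * u τ x := by
    intro σ hσ
    have hσu : ∀ {a b : ℝ}, |a| ≤ b → -b ≤ σ * a := fun {a b} hab => by
      have : |σ * a| ≤ b := by rwa [abs_mul, hσ, one_mul]
      exact (abs_le.1 this).1
    refine heat_nonneg (fun τ x => m + σ * u τ x) (fun τ x => σ * lap (u τ) x) (M := M - m)
      (fun x => continuousOn_const.add (continuousOn_const.mul (hc x)))
      (fun r hr x => ((hd r hr x).const_mul σ).const_add m)
      (fun r hr x => by linarith [hσu (hb r hr x)]) (fun x => by linarith [hσu (h0 x)])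
      (fun r hr x => ?_) τ hτ x
    rw [lap_add, lap_const, lap_const_mul, zero_add]
  rw [abs_le]
  constructor
  · linarith [key 1 (by simp)]
  · linarith [key (-1) (by simp)]

/-- The initial value is the extended two-point function x ↦ `pairExt ψ τ₀ x y`, except for a point
mass β at y that corrects the artificial diagonal value. The point mass evolves into β times the
heat kernel, whose gradient decays by an additional half power; the rest keeps its initial gradient
O(δ²) by the maximum principle. -/
theorem TwoTime.abs_gradient_le (hd : 2 ≤ d) (h : TwoTime δ ρ ψ τ₀ y ρ' χ) {τ : ℝ} (hτ : 0 ≤ τ)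
    (x : Site d) {e : Site d} (he : e ∈ dirs d) :
    |χ τ {x + e} - χ τ {x}| ≤ 2 * δ ^ 2 * gradConst d + 2 ^ (d + 2) * heatDecay (d + 1) τ := by
  set β : ℝ := χ 0 {y} - pairExt ψ τ₀ y y with hβ
  have hβ2 : |β| ≤ 2 := by
    have h1 := h.bdd 0 {y}
    have h2 := h.equal.abs_pairExt_le h.time_nonneg y y
    exact (abs_sub _ _).trans (by linarith)
  have hχ : ∀ r, 0 < r → ∀ x, HasDerivAt (fun r => χ r {x}) (lap (fun z => χ r {z}) x) r := by
    intro r hr x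
    refine (h.deriv r hr {x}).congr_deriv ?_
    rw [exgen_singleton, source_singleton, add_zero]
  set v : ℝ → Site d → ℝ := fun r x =>
    (χ r {x + e} - β * p r (x + e - y)) - (χ r {x} - β * p r (x - y)) with hv
  have hinit : ∀ x, χ 0 {x} - β * p 0 (x - y) = pairExt ψ τ₀ x y := by
    intro x
    rw [p_zero]
    simp only [sub_eq_zero]
    split_ifs with hxy
    · rw [hxy, hβ]; ring
    · rw [pairExt, if_neg hxy, h.init_notMem _ (by simpa using Ne.symm hxy), Finset.pair_comm]
      ring
  have hvb := heat_abs_le (u := v) (T := τ) (M := 2 + 2 * 2) (m := 2 * δ ^ 2 * gradConst d) ?_ ?_ ?_ ?_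
    ⟨hτ, le_rfl⟩ x
  · have h1 := abs_p_add_sub_le hτ (x - y) he
    have e1 : χ τ {x + e} - χ τ {x} = v τ x + β * (p τ (x - y + e) - p τ (x - y)) := by
      simp only [hv]
      rw [show x + e - y = x - y + e by abel]; ring
    rw [e1]
    refine (abs_add_le _ _).trans (add_le_add hvb ?_)
    rw [abs_mul]
    calc |β| * |p τ (x - y + e) - p τ (x - y)| ≤ 2 * (2 ^ (d + 1) * heatDecay (d + 1) τ) := by gcongr
      _ = _ := by ring
  · intro x
    have c1 := fun x : Site d => h.cont {x}
    have c2 := fun x : Site d => continuous_p x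
    exact (((c1 _).sub (continuous_const.mul (c2 _))).sub
      ((c1 _).sub (continuous_const.mul (c2 _)))).continuousOn
  · intro r hr x
    refine (((hχ r hr.1 (x + e)).sub ((hasDerivAt_p r (x + e - y)).const_mul β)).sub
      ((hχ r hr.1 x).sub ((hasDerivAt_p r (x - y)).const_mul β))).congr_deriv ?_
    simp only [hv]
    rw [lap_sub, lap_sub, lap_sub, lap_const_mul, lap_const_mul, lap_comp_sub (p r) x y,
      lap_comp_add (fun z => χ r {z}) x e]
    congr 3
    have : ∀ z, z + e - y = z + (e - y) := fun z => by abel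
    simp only [this]
    rw [lap_comp_add]
  · intro r hr x
    have c1 : ∀ x : Site d, |χ r {x} - β * p r (x - y)| ≤ 1 + 2 := by
      intro x
      refine (abs_sub _ _).trans (add_le_add (h.bdd _ _) ?_)
      rw [abs_mul]
      calc |β| * |p r (x - y)| ≤ 2 * 1 :=
            mul_le_mul hβ2 (abs_p_le_one hr.1 _) (abs_nonneg _) (by norm_num)
        _ = 2 := by norm_num
    exact (abs_sub _ _).trans ((add_le_add (c1 _) (c1 _)).trans (by norm_num))
  · intro x
    simp only [hv, hinit]
    exact h.equal.abs_gradient_pairExt_le hd h.equal.empty h.equal.single h.equal.init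
      h.time_nonneg x y he

/-- The comparison theorem wants a source bound that is continuous on the whole line; the absolute
value changes nothing at positive times. -/
theorem continuous_heatDecay_abs (d : ℕ) : Continuous fun r => heatDecay d |r| := by
  have : ContinuousOn (heatDecay d ∘ fun r => |r|) Set.univ :=
    (continuousOn_heatDecay d).comp continuous_abs.continuousOn fun r _ => abs_nonneg r
  exact continuousOn_univ.1 this

/-- Bounds by a source that is the sum of a constant and a multiple of a heat decay. -/
theorem Hierarchy.abs_le_of_decaying_source (h : Hierarchy δ ρ ψ) {k j : ℕ} {α β s s' τ : ℝ}
    {y : Site d} (hα : 0 ≤ α) (hβ : 0 ≤ β) (hs0 : 0 ≤ s) (hs0' : 0 ≤ s')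
    (hi : ∀ A : Finset (Site d), A.card = k → |ψ 0 A| ≤ α + if y ∈ A then β else 0)
    (hs : ∀ r ∈ Set.Ioo 0 τ, ∀ A : Finset (Site d), A.card = k →
      |source (ρ r) (ψ r) A| ≤ (s + s' * heatDecay j r) * adjCount A) (hτ : 0 ≤ τ)
    {A : Finset (Site d)} (hA : A.card = k) :
    |ψ τ A| ≤ α + exConst d k * (s * ell d τ +
      s' * ∫ r in (0 : ℝ)..τ, heatDecay j r * heatDecay d (τ - r)) +
        exConst d k * (β * heatDecay d τ) := by
  have hcont := continuous_heatDecay_abs j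
  have h1 := exclusion_comparison (f := ψ) (s := fun r A => source (ρ r) (ψ r) A)
    (S := fun r => s + s' * heatDecay j |r|) (k := k) (by fun_prop)
    (fun r => add_nonneg hs0 (mul_nonneg hs0' (heatDecay_nonneg _ _))) (T := τ) (M := 1) hα hβ
    y (fun A _ => (h.cont A).continuousOn) (fun r hr A _ => h.deriv r hr.1 A)
    (fun r _ A _ => h.bdd r A) (fun r hr A hA => by
      rw [abs_of_pos hr.1]; exact hs r hr A hA) hi ⟨hτ, le_rfl⟩ hA
  refine h1.trans_eq ?_
  congr 3
  have i2 : IntervalIntegrable (fun r => heatDecay d (τ - r)) volume 0 τ := by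
    have := intervalIntegrable_mul_heatDecay_sub (S := fun _ => 1) d hτ continuousOn_const
    simpa using this
  rw [← integral_heatDecay_sub d τ, ← intervalIntegral.integral_const_mul,
    ← intervalIntegral.integral_const_mul, ← intervalIntegral.integral_add (i2.const_mul _)
      ((intervalIntegrable_heatDecay_mul j d hτ).const_mul _)]
  refine intervalIntegral.integral_congr fun r hr => ?_
  rw [Set.uIcc_of_le hτ] at hr
  simp only [abs_of_nonneg hr.1]
  ring

/-- The source sees only the gradient of the one-point function, because the function vanishes on
the empty set; its decaying part convolves by `integral_heatDecay_succ_le` without logarithm. On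
sets containing y the initial value is O(δ²Λ), since the remaining one-point function is zero. -/
theorem TwoTime.exists_two_le (hd : 2 ≤ d) : ∃ C : ℝ, 0 ≤ C ∧
    ∀ {δ : ℝ} {ρ : ℝ → Site d → ℝ} {ψ : ℝ → Finset (Site d) → ℝ} {τ₀ : ℝ} {y : Site d}
      {ρ' : ℝ → Site d → ℝ} {χ : ℝ → Finset (Site d) → ℝ}, TwoTime δ ρ ψ τ₀ y ρ' χ →
    ∀ {τ Λ : ℝ}, 0 ≤ τ → ell d τ₀ ≤ Λ → ell d τ ≤ Λ → ∀ {A : Finset (Site d)}, A.card = 2 →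
      |χ τ A| ≤ C * (δ ^ 3 * Λ + (δ + δ ^ 2 * Λ) * heatDecay d τ) := by
  have hg := gradConst_nonneg d
  have e2 := exConst_nonneg d 2
  have e3 := exConst_nonneg d 3
  refine ⟨exConst d 3 * (2 * gradConst d) + exConst d 2 * (2 * gradConst d) +
    exConst d 2 * (2 ^ (d + 2) * (10 * 2 ^ d)) + exConst d 2 * exConst d 2, by positivity, ?_⟩
  intro δ ρ ψ τ₀ y ρ' χ h τ Λ hτ h0 h1 A hA
  have hδ := h.toHierarchy.nonneg (by omega)
  have hl := ell_nonneg d h.time_nonneg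
  have hl' := ell_nonneg d hτ
  have hΛ : 0 ≤ Λ := hl.trans h0
  have hD := heatDecay_nonneg d τ
  have key := h.abs_le_of_decaying_source (k := 2) (j := d + 1) (y := y)
    (α := exConst d 3 * (2 * gradConst d) * (δ ^ 3 * Λ)) (β := exConst d 2 * (δ ^ 2 * Λ))
    (s := δ * (2 * δ ^ 2 * gradConst d)) (s' := δ * 2 ^ (d + 2)) (τ := τ) (by positivity)
    (by positivity) (by positivity) (by positivity) (fun A hA => ?_) (fun r hr A hA => ?_) hτ hA
  · have f1 := integral_heatDecay_succ_le hd hτ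
    have f2 : exConst d 2 * (δ * (2 * δ ^ 2 * gradConst d) * ell d τ +
        δ * 2 ^ (d + 2) * ∫ r in (0 : ℝ)..τ, heatDecay (d + 1) r * heatDecay d (τ - r)) ≤
        exConst d 2 * (δ * (2 * δ ^ 2 * gradConst d) * Λ +
        δ * 2 ^ (d + 2) * (10 * 2 ^ d * heatDecay d τ)) := by gcongr
    refine (key.trans (by linarith : _ ≤ exConst d 3 * (2 * gradConst d) * (δ ^ 3 * Λ) +
      exConst d 2 * (δ * (2 * δ ^ 2 * gradConst d) * Λ +
        δ * 2 ^ (d + 2) * (10 * 2 ^ d * heatDecay d τ)) +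
        exConst d 2 * (exConst d 2 * (δ ^ 2 * Λ) * heatDecay d τ))).trans ?_
    have g1 : 0 ≤ exConst d 3 * (2 * gradConst d) * ((δ + δ ^ 2 * Λ) * heatDecay d τ) := by positivity
    have g2 : 0 ≤ exConst d 2 * (2 * gradConst d) * ((δ + δ ^ 2 * Λ) * heatDecay d τ) := by positivity
    have g3 : 0 ≤ exConst d 2 * (2 ^ (d + 2) * (10 * 2 ^ d)) * (δ ^ 3 * Λ + δ ^ 2 * Λ * heatDecay d τ) := by
      positivity
    have g4 : 0 ≤ exConst d 2 * exConst d 2 * (δ ^ 3 * Λ + δ * heatDecay d τ) := by positivity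
    linarith
  · split_ifs with hy
    · refine (h.init_mem_le hy).trans ?_
      obtain ⟨z, hz⟩ := Finset.card_eq_one.1 (card_erase_eq hA hy)
      rw [hz, h.equal.single, abs_zero, add_zero]
      have f1 := h.equal.two_le hd h.time_nonneg hA
      have f2 : exConst d 2 * (δ ^ 2 * ell d τ₀) ≤ exConst d 2 * (δ ^ 2 * Λ) := by gcongr
      have f3 : 0 ≤ exConst d 3 * (2 * gradConst d) * (δ ^ 3 * Λ) := by positivity
      linarith
    · rw [h.init_notMem A hy, add_zero]
      refine (h.equal.three_le hd h.time_nonneg (by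
        rw [Finset.card_insert_of_notMem hy, hA])).trans ?_
      gcongr
  · refine (abs_source_le (P := 0)
      (G := 2 * δ ^ 2 * gradConst d + 2 ^ (d + 2) * heatDecay (d + 1) r) hδ (h.grad r hr.1.le)
      (fun a ha b hb => ?_) (fun a ha b hb => ?_)).trans_eq (by ring)
    · rw [Finset.card_eq_zero.1 (card_erase_erase hA ha hb), h.empty, abs_zero]
    · have hbA := (Finset.mem_inter.1 hb).2
      have hab := ne_of_mem_nbr (Finset.mem_inter.1 hb).1
      obtain ⟨z, hz⟩ := Finset.card_eq_one.1 (card_erase_eq hA ha)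
      obtain ⟨z', hz'⟩ := Finset.card_eq_one.1 (card_erase_eq hA hbA)
      have m1 : b ∈ A.erase a := Finset.mem_erase.2 ⟨hab.symm, hbA⟩
      have m2 : a ∈ A.erase b := Finset.mem_erase.2 ⟨hab, ha⟩
      rw [hz, Finset.mem_singleton] at m1
      rw [hz', Finset.mem_singleton] at m2
      rw [hz, hz', ← m1, ← m2]
      have := h.abs_gradient_le hd hr.1.le a (mem_nbr.1 (Finset.mem_inter.1 hb).1)
      rwa [add_sub_cancel] at this

end

section

variable {d : ℕ}

/-- The sizes of the one- and two-point functions are inserted into the source. Their constant parts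
give δ⁴Λ²; their decaying parts convolve with the heat decay at the price of one Λ. The δ³ in the
statement comes from initial sets containing y. -/
theorem TwoTime.exists_three_le (hd : 2 ≤ d) : ∃ C : ℝ, 0 ≤ C ∧
    ∀ {δ : ℝ} {ρ : ℝ → Site d → ℝ} {ψ : ℝ → Finset (Site d) → ℝ} {τ₀ : ℝ} {y : Site d}
      {ρ' : ℝ → Site d → ℝ} {χ : ℝ → Finset (Site d) → ℝ}, TwoTime δ ρ ψ τ₀ y ρ' χ →
    ∀ {τ Λ : ℝ}, 0 ≤ τ → ell d τ₀ ≤ Λ → ell d τ ≤ Λ → ∀ {A : Finset (Site d)}, A.card = 3 →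
      |χ τ A| ≤ C * (δ ^ 4 * Λ ^ 2 + (δ ^ 2 + δ ^ 3 + δ ^ 3 * Λ) * Λ * heatDecay d τ) := by
  obtain ⟨C₂, hC₂, h2⟩ := TwoTime.exists_two_le hd
  have hg := gradConst_nonneg d
  have k1 := exConst_nonneg d 1
  have k2 := exConst_nonneg d 2
  have k3 := exConst_nonneg d 3
  have k4 := exConst_nonneg d 4
  set c₄ := exConst d 4 * (exConst d 2 + 2 * (exConst d 3 * (2 * gradConst d))) with hc₄
  set c₃ := exConst d 3 * (2 * gradConst d) with hc₃
  have hc₄' : 0 ≤ c₄ := by positivity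
  have hc₃' : 0 ≤ c₃ := by positivity
  refine ⟨c₄ + exConst d 3 * (exConst d 2 + 2 * C₂) +
    exConst d 3 * ((exConst d 1 + 2 * C₂) * (2 * 2 ^ d)) + exConst d 3 * (c₃ + exConst d 2),
    by positivity, ?_⟩
  intro δ ρ ψ τ₀ y ρ' χ h τ Λ hτ h0 h1 A hA
  have hδ := h.toHierarchy.nonneg (by omega)
  have hl := ell_nonneg d h.time_nonneg
  have hl' := ell_nonneg d hτ
  have hΛ : 0 ≤ Λ := hl.trans h0
  have hD := heatDecay_nonneg d τ
  have key := h.abs_le_of_decaying_source (k := 3) (j := d) (y := y)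
    (α := c₄ * (δ ^ 4 * Λ ^ 2)) (β := c₃ * (δ ^ 3 * Λ) + exConst d 2 * (δ ^ 2 * Λ))
    (s := (exConst d 2 + 2 * C₂) * (δ ^ 4 * Λ))
    (s' := δ ^ 2 * exConst d 1 + 2 * C₂ * (δ ^ 2 + δ ^ 3 * Λ)) (τ := τ) (by positivity)
    (by positivity) (by positivity) (by positivity) (fun A hA => ?_) (fun r hr A hA => ?_) hτ hA
  · have f1 : ∫ r in (0 : ℝ)..τ, heatDecay d r * heatDecay d (τ - r) ≤
        2 * 2 ^ d * (Λ * heatDecay d τ) := by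
      refine (integral_heatDecay_self_le d hτ).trans ?_
      gcongr
    have f2 : exConst d 3 * ((exConst d 2 + 2 * C₂) * (δ ^ 4 * Λ) * ell d τ +
        (δ ^ 2 * exConst d 1 + 2 * C₂ * (δ ^ 2 + δ ^ 3 * Λ)) *
          ∫ r in (0 : ℝ)..τ, heatDecay d r * heatDecay d (τ - r)) ≤
        exConst d 3 * ((exConst d 2 + 2 * C₂) * (δ ^ 4 * Λ) * Λ +
        (δ ^ 2 * exConst d 1 + 2 * C₂ * (δ ^ 2 + δ ^ 3 * Λ)) *
          (2 * 2 ^ d * (Λ * heatDecay d τ))) := by gcongr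
    set D := heatDecay d τ
    have t1 : 0 ≤ δ ^ 4 * Λ ^ 2 := by positivity
    have t2 : 0 ≤ δ ^ 2 * Λ * D := by positivity
    have t3 : 0 ≤ δ ^ 3 * Λ * D := by positivity
    have t4 : 0 ≤ δ ^ 3 * Λ ^ 2 * D := by positivity
    have m1 : 0 ≤ exConst d 3 * (exConst d 2 + 2 * C₂) := by positivity
    have m2 : 0 ≤ exConst d 3 * ((exConst d 1 + 2 * C₂) * (2 * 2 ^ d)) := by positivity
    have m2' : 0 ≤ exConst d 3 * (exConst d 1 * (2 * 2 ^ d)) := by positivity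
    have m3 : 0 ≤ exConst d 3 * c₃ := by positivity
    have m4 : 0 ≤ exConst d 3 * exConst d 2 := by positivity
    have g1 := mul_nonneg hc₄' (add_nonneg (add_nonneg t2 t3) t4)
    have g2 := mul_nonneg m1 (add_nonneg (add_nonneg t2 t3) t4)
    have g3 := mul_nonneg m2 (add_nonneg t1 t3)
    have g4 := mul_nonneg m3 (add_nonneg (add_nonneg t1 t2) t4)
    have g5 := mul_nonneg m4 (add_nonneg (add_nonneg t1 t3) t4)
    have g6 := mul_nonneg m2' t4
    refine (key.trans (add_le_add (add_le_add le_rfl f2) le_rfl)).trans ?_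
    linarith
  · split_ifs with hy
    · refine (h.init_mem_le hy).trans ?_
      have f1 : |ψ τ₀ A| ≤ c₃ * (δ ^ 3 * Λ) :=
        (h.equal.three_le hd h.time_nonneg hA).trans (by gcongr)
      have f2 : |ψ τ₀ (A.erase y)| ≤ exConst d 2 * (δ ^ 2 * Λ) :=
        (h.equal.two_le hd h.time_nonneg (card_erase_eq hA hy)).trans (by gcongr)
      have f3 : 0 ≤ c₄ * (δ ^ 4 * Λ ^ 2) := by positivity
      linarith
    · rw [h.init_notMem A hy, add_zero]
      refine (h.equal.four_le hd h.time_nonneg (by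
        rw [Finset.card_insert_of_notMem hy, hA])).trans ?_
      gcongr
  · have hΛr : ell d r ≤ Λ := (ell_mono d hr.1.le hr.2.le).trans h1
    refine (abs_source_le (P := exConst d 2 * (δ ^ 2 * Λ) + exConst d 1 * heatDecay d r)
      (G := 2 * (C₂ * (δ ^ 3 * Λ + (δ + δ ^ 2 * Λ) * heatDecay d r))) hδ (h.grad r hr.1.le)
      (fun a ha b hb => ?_) (fun a ha b hb => ?_)).trans_eq (by ring)
    · refine (h.one_le hd hr.1.le (card_erase_erase (k := 1) hA ha hb)).trans ?_
      gcongr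
    · have f := fun a (ha : a ∈ A) => h2 h hr.1.le h0 hΛr (card_erase_eq (k := 2) hA ha)
      refine (abs_sub _ _).trans ((add_le_add (f a ha) (f b (Finset.mem_inter.1 hb).2)).trans_eq ?_)
      ring

end

section

variable {d : ℕ}

/-! ### The generator on local functions -/

/-- The weight that makes a sum over neighbouring pairs meeting `A` count each bond once. -/
def bondWeight (A : Finset (Site d)) (b : Site d) : ℝ := if b ∈ A then 1 / 2 else 1

theorem exchange_comm (η : Config d) (x y : Site d) : exchange η x y = exchange η y x := by
  unfold exchange; rw [Equiv.swap_comm]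

theorem occ_exchange (η : Config d) (x y z : Site d) :
    occ (exchange η x y) z = occ η (Equiv.swap x y z) := rfl

theorem exchange_sub_eq_zero {f : Config d → ℝ} {A : Finset (Site d)} (hf : DependsOn f (A : Set (Site d)))
    (η : Config d) {x y : Site d} (hx : x ∉ A) (hy : y ∉ A) : f (exchange η x y) - f η = 0 := by
  rw [sub_eq_zero]
  refine hf fun z hz => ?_
  rw [exchange, Equiv.swap_apply_of_ne_of_ne]
  · rintro rfl; exact hx hz
  · rintro rfl; exact hy hz

/-- The generator applied to a function of the configuration in `A`, as a finite sum. -/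
theorem generator_eq {f : Config d → ℝ} {A : Finset (Site d)} (hf : DependsOn f (A : Set (Site d)))
    (η : Config d) : generator f η =
      ∑ a ∈ A, ∑ b ∈ nbr a, bondWeight A b * (f (exchange η a b) - f η) := by
  set g : Site d → Site d → ℝ := fun a b => f (exchange η a b) - f η with hg
  set φ : Site d → Site d → ℝ := fun a b => if a ∈ A then bondWeight A b * g a b else 0 with hφ
  have hsplit : ∀ x (j : Fin d), g x (x + unitVec j) =
      φ x (x + unitVec j) + φ (x + unitVec j) x := by
    intro x j
    have hs : g (x + unitVec j) x = g x (x + unitVec j) := by simp only [hg, exchange_comm]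
    simp only [hφ, bondWeight, hs]
    by_cases h1 : x ∈ A <;> by_cases h2 : x + unitVec j ∈ A
    · rw [if_pos h1, if_pos h2, if_pos h2, if_pos h1]; ring
    · rw [if_pos h1, if_neg h2, if_neg h2]; ring
    · rw [if_neg h1, if_pos h2, if_neg h1]; ring
    · rw [if_neg h1, if_neg h2, add_zero]; exact exchange_sub_eq_zero hf η h1 h2
  have hz1 : ∀ j : Fin d, ∀ x ∉ A, φ x (x + unitVec j) = 0 := fun j x hx => if_neg hx
  have hz2 : ∀ j : Fin d, ∀ x ∉ A, φ x (x - unitVec j) = 0 := fun j x hx => if_neg hx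
  have hs2 : ∀ j : Fin d, HasSum (fun x => φ (x + unitVec j) x) (∑ x ∈ A, φ x (x - unitVec j)) := by
    intro j
    have h1 : HasSum (fun x => φ x (x - unitVec j)) (∑ x ∈ A, φ x (x - unitVec j)) :=
      hasSum_sum_of_ne_finset_zero (hz2 j)
    rw [← (Equiv.addRight (unitVec j : Site d)).hasSum_iff] at h1
    refine h1.congr_fun fun x => ?_
    simp
  have hs : HasSum (fun x => ∑ j : Fin d, g x (x + unitVec j))
      (∑ j : Fin d, (∑ x ∈ A, φ x (x + unitVec j) + ∑ x ∈ A, φ x (x - unitVec j))) := by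
    refine hasSum_sum fun j _ => ?_
    simp only [hsplit]
    exact (hasSum_sum_of_ne_finset_zero (hz1 j)).add (hs2 j)
  rw [generator, hs.tsum_eq]
  simp only [← Finset.sum_add_distrib]
  rw [Finset.sum_comm]
  refine Finset.sum_congr rfl fun a ha => ?_
  rw [sum_nbr, sum_dirs]
  refine Finset.sum_congr rfl fun j _ => ?_
  simp only [hφ, if_pos ha, sub_eq_add_neg a]
  rfl

theorem DependsOn.exchange {f : Config d → ℝ} {A : Finset (Site d)}
    (hf : DependsOn f (A : Set (Site d))) {x y : Site d} {S : Finset (Site d)} (hA : A ⊆ S) (hx : x ∈ S)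
    (hy : y ∈ S) : DependsOn (fun η => f (exchange η x y)) (S : Set (Site d)) := by
  intro η ζ h
  refine hf fun z hz => h _ ?_
  rw [Equiv.swap_apply_def]
  split_ifs
  · exact hy
  · exact hx
  · exact hA hz

theorem isLocal_generator {f : Config d → ℝ} (hf : IsLocal f) : IsLocal (generator f) := by
  obtain ⟨A, hA⟩ := hf
  refine ⟨A ∪ A.biUnion nbr, ?_⟩
  intro η ζ h
  rw [generator_eq hA, generator_eq hA]
  refine Finset.sum_congr rfl fun a ha => Finset.sum_congr rfl fun b hb => ?_
  have h1 := DependsOn.exchange hA (x := a) (y := b) (S := A ∪ A.biUnion nbr)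
    Finset.subset_union_left (Finset.mem_union_left _ ha)
    (Finset.mem_union_right _ (Finset.mem_biUnion.2 ⟨a, ha, hb⟩)) h
  have h2 : f η = f ζ := hA fun z hz => h z (Finset.mem_union_left _ hz)
  simp only at h1
  rw [h1, h2]

/-- The centered product `∏_{a ∈ A} (η(a) - c(a))`. -/
def cprod (c : Site d → ℝ) (A : Finset (Site d)) (η : Config d) : ℝ := ∏ a ∈ A, (occ η a - c a)

theorem dependsOn_cprod (c : Site d → ℝ) {A S : Finset (Site d)} (h : A ⊆ S) :
    DependsOn (cprod c A) (S : Set (Site d)) := by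
  intro η ζ hz
  exact Finset.prod_congr rfl fun a ha => by rw [occ, occ, hz a (h ha)]

theorem cprod_eq_mul (c : Site d → ℝ) {A : Finset (Site d)} {a : Site d} (ha : a ∈ A) (η : Config d) :
    cprod c A η = (occ η a - c a) * cprod c (A.erase a) η :=
  (Finset.mul_prod_erase A _ ha).symm

theorem cprod_exchange_of_notMem (c : Site d → ℝ) {A : Finset (Site d)} {a b : Site d} (ha : a ∈ A)
    (hb : b ∉ A) (η : Config d) : cprod c A (exchange η a b) - cprod c A η =
      (cprod c (insert b (A.erase a)) η - cprod c A η) - (c a - c b) * cprod c (A.erase a) η := by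
  have hb' : b ∉ A.erase a := fun h => hb (Finset.mem_of_mem_erase h)
  have h1 : cprod c (A.erase a) (exchange η a b) = cprod c (A.erase a) η := by
    refine Finset.prod_congr rfl fun z hz => ?_
    rw [occ_exchange, Equiv.swap_apply_of_ne_of_ne (Finset.ne_of_mem_erase hz)]
    rintro rfl; exact hb' hz
  rw [cprod_eq_mul c ha (exchange η a b), h1, occ_exchange, Equiv.swap_apply_left,
    cprod_eq_mul c (Finset.mem_insert_self b (A.erase a)), Finset.erase_insert hb']
  ring

/-- With X, Y the centered variables at a, b and k = c(a) - c(b), the exchange replaces XY by (Y -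
k)(X + k). -/
theorem cprod_exchange_of_mem (c : Site d → ℝ) {A : Finset (Site d)} {a b : Site d} (ha : a ∈ A)
    (hb : b ∈ A) (hab : a ≠ b) (η : Config d) : cprod c A (exchange η a b) - cprod c A η =
      (c a - c b) * (cprod c (A.erase a) η - cprod c (A.erase b) η) -
        (c a - c b) ^ 2 * cprod c ((A.erase a).erase b) η := by
  have hb' : b ∈ A.erase a := Finset.mem_erase.2 ⟨hab.symm, hb⟩
  have ha' : a ∈ A.erase b := Finset.mem_erase.2 ⟨hab, ha⟩
  have h1 : cprod c ((A.erase a).erase b) (exchange η a b) = cprod c ((A.erase a).erase b) η := by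
    refine Finset.prod_congr rfl fun z hz => ?_
    rw [occ_exchange, Equiv.swap_apply_of_ne_of_ne
      (Finset.ne_of_mem_erase (Finset.mem_of_mem_erase hz)) (Finset.ne_of_mem_erase hz)]
  rw [cprod_eq_mul c ha (exchange η a b), cprod_eq_mul c ha η, cprod_eq_mul c hb' (exchange η a b),
    cprod_eq_mul c hb' η, cprod_eq_mul c ha' η, Finset.erase_right_comm (s := A) (a := b) (b := a), h1,
    occ_exchange, occ_exchange, Equiv.swap_apply_left, Equiv.swap_apply_right]
  ring

theorem sum_adj_eq_half (A : Finset (Site d)) (h : Site d → Site d → ℝ) :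
    ∑ a ∈ A, ∑ b ∈ nbr a ∩ A, h a b = ∑ a ∈ A, ∑ b ∈ nbr a ∩ A, (h a b + h b a) / 2 := by
  have h1 := sum_adj_swap A h
  have h2 : ∑ a ∈ A, ∑ b ∈ nbr a ∩ A, (h a b + h b a) / 2 =
      (∑ a ∈ A, ∑ b ∈ nbr a ∩ A, h a b + ∑ a ∈ A, ∑ b ∈ nbr a ∩ A, h b a) / 2 := by
    rw [← Finset.sum_add_distrib, Finset.sum_div]
    refine Finset.sum_congr rfl fun a _ => ?_
    rw [← Finset.sum_add_distrib, Finset.sum_div]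
  rw [h2, ← h1]; ring

/-- The pointwise identity behind the hierarchy of correlation equations. -/
theorem generator_cprod (c : Site d → ℝ) (A : Finset (Site d)) (η : Config d) :
    generator (cprod c A) η - ∑ a ∈ A, lap c a * cprod c (A.erase a) η =
      exgen (fun B => cprod c B η) A + source c (fun B => cprod c B η) A := by
  -- The drift of the centering is split according to whether the neighbour lies in A. The outside
  -- part cancels the gradient terms from jumps leaving A. The inside part, symmetrized in a and b,
  -- supplies the second half of the gradient term of `source`.
  have h1 : ∑ a ∈ A, lap c a * cprod c (A.erase a) η =
      -(∑ a ∈ A, ∑ b ∈ nbr a \ A, (c a - c b) * cprod c (A.erase a) η +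
        ∑ a ∈ A, ∑ b ∈ nbr a ∩ A, (c a - c b) * cprod c (A.erase a) η) := by
    rw [← Finset.sum_add_distrib, ← Finset.sum_neg_distrib]
    refine Finset.sum_congr rfl fun a _ => ?_
    rw [sum_nbr_sdiff, sub_add_cancel, lap_eq_sum_nbr, Finset.sum_mul, ← Finset.sum_neg_distrib]
    exact Finset.sum_congr rfl fun b _ => by ring
  have h2 : generator (cprod c A) η = ∑ a ∈ A, ∑ b ∈ nbr a \ A,
      ((cprod c (insert b (A.erase a)) η - cprod c A η) - (c a - c b) * cprod c (A.erase a) η) +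
      ∑ a ∈ A, ∑ b ∈ nbr a ∩ A, 1 / 2 * ((c a - c b) * (cprod c (A.erase a) η - cprod c (A.erase b) η) -
        (c a - c b) ^ 2 * cprod c ((A.erase a).erase b) η) := by
    rw [generator_eq (dependsOn_cprod c subset_rfl), ← Finset.sum_add_distrib]
    refine Finset.sum_congr rfl fun a ha => ?_
    rw [← Finset.sum_inter_add_sum_sdiff (nbr a) A, add_comm]
    congr 1
    · refine Finset.sum_congr rfl fun b hb => ?_
      have hb := (Finset.mem_sdiff.1 hb).2
      rw [cprod_exchange_of_notMem c ha hb, bondWeight, if_neg hb, one_mul]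
    · refine Finset.sum_congr rfl fun b hb => ?_
      have hb := Finset.mem_inter.1 hb
      rw [cprod_exchange_of_mem c ha hb.2 (ne_of_mem_nbr hb.1), bondWeight, if_pos hb.2]
  rw [h1, h2, exgen, source, sum_adj_eq_half A fun a b => (c a - c b) * cprod c (A.erase a) η]
  simp only [Finset.sum_sub_distrib (s := nbr _ \ A)]
  rw [Finset.sum_sub_distrib]
  have h3 : ∀ x y z w v : ℝ, z + w = v → x - y + z - -(y + w) = x + v := by intros; linarith
  apply h3
  rw [← Finset.sum_add_distrib]
  refine Finset.sum_congr rfl fun a _ => ?_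
  rw [← Finset.sum_add_distrib]
  exact Finset.sum_congr rfl fun b _ => by ring

theorem occ_nonneg (η : Config d) (x : Site d) : 0 ≤ occ η x := by
  rw [occ]; split_ifs <;> norm_num

theorem occ_le_one (η : Config d) (x : Site d) : occ η x ≤ 1 := by
  rw [occ]; split_ifs <;> norm_num

theorem occ_mul_self (η : Config d) (x : Site d) : occ η x * occ η x = occ η x := by
  rw [occ]; split_ifs <;> norm_num

theorem abs_cprod_le {c : Site d → ℝ} (hc : ∀ x, c x ∈ Set.Icc (0 : ℝ) 1) (A : Finset (Site d))
    (η : Config d) : |cprod c A η| ≤ 1 := by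
  rw [cprod, Finset.abs_prod]
  refine Finset.prod_le_one (fun _ _ => abs_nonneg _) fun a _ => ?_
  rw [abs_le]
  constructor <;> linarith [occ_nonneg η a, occ_le_one η a, (hc a).1, (hc a).2]

/-- The expansion of the centered product in products of occupation numbers. -/
theorem cprod_expand (c : Site d → ℝ) (A : Finset (Site d)) (η : Config d) :
    cprod c A η = ∑ B ∈ A.powerset, (∏ a ∈ A \ B, -c a) * cprod 0 B η := by
  simp only [cprod, sub_eq_add_neg, Pi.zero_apply, neg_zero, add_zero]
  rw [Finset.prod_add]
  exact Finset.sum_congr rfl fun B _ => mul_comm _ _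

theorem generator_cprod_expand (c : Site d → ℝ) (A : Finset (Site d)) (η : Config d) :
    generator (cprod c A) η =
      ∑ B ∈ A.powerset, (∏ a ∈ A \ B, -c a) * generator (cprod 0 B) η := by
  rw [generator_eq (dependsOn_cprod c subset_rfl)]
  have : ∀ B ∈ A.powerset, (∏ a ∈ A \ B, -c a) * generator (cprod 0 B) η =
      ∑ x ∈ A, ∑ y ∈ nbr x, bondWeight A y * ((∏ a ∈ A \ B, -c a) * cprod 0 B (exchange η x y) -
        (∏ a ∈ A \ B, -c a) * cprod 0 B η) := by
    intro B hB
    rw [generator_eq (dependsOn_cprod 0 (Finset.mem_powerset.1 hB)), Finset.mul_sum]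
    refine Finset.sum_congr rfl fun x _ => ?_
    rw [Finset.mul_sum]
    exact Finset.sum_congr rfl fun y _ => by ring
  rw [Finset.sum_congr rfl this, Finset.sum_comm]
  refine Finset.sum_congr rfl fun x _ => ?_
  rw [Finset.sum_comm]
  refine Finset.sum_congr rfl fun y _ => ?_
  rw [← Finset.mul_sum, Finset.sum_sub_distrib, ← cprod_expand, ← cprod_expand]

/-! ### Local functions are bounded, measurable and continuous -/

theorem IsLocal.exists_comp {f : Config d → ℝ} (hf : IsLocal f) :
    ∃ (S : Finset (Site d)) (g : (S → Bool) → ℝ), f = fun η => g fun x => η x := by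
  obtain ⟨S, hS⟩ := hf
  obtain ⟨g, hg⟩ := dependsOn_iff_exists_comp.1 hS
  exact ⟨S, g, hg⟩

theorem IsLocal.continuous {f : Config d → ℝ} (hf : IsLocal f) : Continuous f := by
  obtain ⟨S, g, rfl⟩ := hf.exists_comp
  exact continuous_of_discreteTopology.comp (continuous_pi fun x => continuous_apply _)

theorem IsLocal.measurable {f : Config d → ℝ} (hf : IsLocal f) : Measurable f := by
  obtain ⟨S, g, rfl⟩ := hf.exists_comp
  exact (measurable_of_finite g).comp (measurable_pi_lambda _ fun x => measurable_pi_apply _)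

theorem IsLocal.exists_bound {f : Config d → ℝ} (hf : IsLocal f) : ∃ K : ℝ, 0 ≤ K ∧ ∀ η, |f η| ≤ K := by
  obtain ⟨S, g, rfl⟩ := hf.exists_comp
  refine ⟨∑ z, |g z|, Finset.sum_nonneg fun _ _ => abs_nonneg _, fun η => ?_⟩
  exact Finset.single_le_sum (f := fun z => |g z|) (fun _ _ => abs_nonneg _) (Finset.mem_univ _)

theorem isLocal_cprod (c : Site d → ℝ) (A : Finset (Site d)) : IsLocal (cprod c A) :=
  ⟨A, dependsOn_cprod c subset_rfl⟩

end

section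

/-! ### Forward equations for the exclusion process -/

/-- A right-continuous process is jointly measurable. -/
theorem measurable_uncurry_of_rightContinuous {Ω : Type*} [MeasurableSpace Ω] {X : ℝ≥0 → Ω → ℝ}
    (hm : ∀ t, Measurable (X t)) (hc : ∀ ω t, ContinuousWithinAt (X · ω) (Set.Ici t) t) :
    Measurable fun p : ℝ≥0 × Ω => X p.1 p.2 := by
  -- The next grid point of mesh 1/(m+1) to the right of t: it takes countably many values and tends
  -- to t from above, where right-continuity applies.
  obtain ⟨r, hr⟩ : ∃ r : ℕ → ℝ≥0 → ℝ≥0, ∀ m t, r m t = ((⌊t * (m + 1)⌋₊ : ℝ≥0) + 1) / (m + 1) :=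
    ⟨_, fun _ _ => rfl⟩
  have hr1 : ∀ m t, t ≤ r m t := by
    intro m t
    rw [hr, le_div_iff₀ (by positivity)]
    exact (Nat.lt_floor_add_one _).le
  have hr2 : ∀ m t, r m t ≤ t + 1 / (m + 1) := by
    intro m t
    rw [hr, div_le_iff₀ (by positivity), add_mul, one_div_mul_cancel (by positivity)]
    gcongr
    exact Nat.floor_le (by positivity)
  have hr3 : ∀ t, Tendsto (r · t) atTop (𝓝[≥] t) := by
    intro t
    refine tendsto_nhdsWithin_iff.2 ⟨?_, Eventually.of_forall fun m => hr1 m t⟩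
    refine tendsto_of_tendsto_of_tendsto_of_le_of_le tendsto_const_nhds ?_ (hr1 · t) (hr2 · t)
    have h1 : Tendsto (fun m : ℕ => 1 / ((m : ℝ≥0) + 1)) atTop (𝓝 0) :=
      tendsto_one_div_add_atTop_nhds_zero_nat
    simpa using h1.const_add t
  have hr4 : ∀ m, Measurable fun p : ℝ≥0 × Ω => X (r m p.1) p.2 := by
    intro m
    have h1 : Measurable fun q : ℕ × Ω => X (((q.1 : ℝ≥0) + 1) / (m + 1)) q.2 :=
      measurable_from_prod_countable_right fun k => hm (((k : ℝ≥0) + 1) / (m + 1))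
    have h2 : Measurable fun p : ℝ≥0 × Ω => ((⌊p.1 * (m + 1)⌋₊, p.2) : ℕ × Ω) :=
      (Nat.measurable_floor.comp (measurable_fst.mul_const _)).prodMk measurable_snd
    have h3 := h1.comp h2
    simp only [Function.comp_def] at h3
    simp only [hr]
    convert h3
  refine measurable_of_tendsto_metrizable hr4 (tendsto_pi_nhds.2 fun p => ?_)
  exact Tendsto.comp (g := fun t => X t p.2) (hc p.2 p.1) (hr3 p.1)

variable {d n : ℕ} {μ : Measure (Config d)} {Ω : Type*} [mΩ : MeasurableSpace Ω] {P : Measure Ω}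
  {η : ℝ≥0 → Ω → Config d}

/-- The filtration generated by the process. -/
def IsExclusionProcess.filtration (h : IsExclusionProcess n μ P η) : Filtration ℝ≥0 mΩ :=
  Filtration.natural η fun t => (h.measurable t).stronglyMeasurable

theorem IsExclusionProcess.measurable_comp (h : IsExclusionProcess n μ P η) {g : Config d → ℝ}
    (hg : IsLocal g) : Measurable fun p : ℝ≥0 × Ω => g (η p.1 p.2) := by
  refine measurable_uncurry_of_rightContinuous (X := fun t ω => g (η t ω))
    (fun t => hg.measurable.comp (h.measurable t)) fun ω t => ?_
  exact hg.continuous.continuousAt.comp_continuousWithinAt (h.cadlag ω t).1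

theorem IsExclusionProcess.measurable_comp_toNNReal (h : IsExclusionProcess n μ P η)
    {g : Config d → ℝ} (hg : IsLocal g) : Measurable fun p : ℝ × Ω => g (η p.1.toNNReal p.2) :=
  (h.measurable_comp hg).comp ((measurable_real_toNNReal.comp measurable_fst).prodMk measurable_snd)

theorem IsExclusionProcess.intervalIntegrable (h : IsExclusionProcess n μ P η) {g : Config d → ℝ}
    (hg : IsLocal g) (ω : Ω) (a b : ℝ) :
    IntervalIntegrable (fun r => g (η r.toNNReal ω)) volume a b := by
  obtain ⟨K, -, hK⟩ := hg.exists_bound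
  refine (intervalIntegrable_const (c := K)).mono_fun
    ((h.measurable_comp_toNNReal hg).comp measurable_prodMk_right).aestronglyMeasurable
    (Eventually.of_forall fun r => ?_)
  simp only [Real.norm_eq_abs]
  exact (hK _).trans (le_abs_self K)

/-- The expectation of `G f(η_v)`. -/
def expect (P : Measure Ω) (η : ℝ≥0 → Ω → Config d) (G : Ω → ℝ) (f : Config d → ℝ) (v : ℝ) : ℝ :=
  ∫ ω, G ω * f (η v.toNNReal ω) ∂P

variable [IsProbabilityMeasure P] {s : ℝ≥0} {G : Ω → ℝ}

theorem integrable_mul_comp {G : Ω → ℝ} (hG : Measurable G) (hG1 : ∀ ω, |G ω| ≤ 1)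
    (h : IsExclusionProcess n μ P η) {f : Config d → ℝ} (hf : IsLocal f) (t : ℝ≥0) :
    Integrable (fun ω => G ω * f (η t ω)) P := by
  obtain ⟨K, hK0, hK⟩ := hf.exists_bound
  refine Integrable.of_bound (hG.mul (hf.measurable.comp (h.measurable t))).aestronglyMeasurable K
    (Eventually.of_forall fun ω => ?_)
  rw [Real.norm_eq_abs, abs_mul]
  exact (mul_le_mul (hG1 ω) (hK _) (abs_nonneg _) zero_le_one).trans (one_mul K).le

theorem measurable_expect (hG : Measurable G) (h : IsExclusionProcess n μ P η) {f : Config d → ℝ}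
    (hf : IsLocal f) : Measurable (expect P η G f) := by
  have h1 : StronglyMeasurable fun p : ℝ × Ω => G p.2 * f (η p.1.toNNReal p.2) :=
    ((hG.comp measurable_snd).mul (h.measurable_comp_toNNReal hf)).stronglyMeasurable
  exact h1.integral_prod_right.measurable

theorem abs_expect_le (hG1 : ∀ ω, |G ω| ≤ 1) {f : Config d → ℝ} {K : ℝ}
    (hK : ∀ ζ, |f ζ| ≤ K) (v : ℝ) : |expect P η G f v| ≤ K := by
  have := norm_integral_le_of_norm_le_const (μ := P) (f := fun ω => G ω * f (η v.toNNReal ω)) (C := K)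
    (Eventually.of_forall fun ω => by
      rw [Real.norm_eq_abs, abs_mul]
      exact (mul_le_mul (hG1 ω) (hK _) (abs_nonneg _) zero_le_one).trans (one_mul K).le)
  simpa [expect] using this

/-- Orthogonality of martingale increments to the past. -/
theorem integral_mul_martingale {ℱ : Filtration ℝ≥0 mΩ} {M : ℝ≥0 → Ω → ℝ} (hM : Martingale M ℱ P)
    {s t : ℝ≥0} (hst : s ≤ t) (hG : StronglyMeasurable[ℱ s] G) (hG1 : ∀ ω, |G ω| ≤ 1) :
    ∫ ω, G ω * M t ω ∂P = ∫ ω, G ω * M s ω ∂P := by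
  have hi : Integrable (G * M t) P :=
    (hM.integrable t).bdd_mul (c := 1) (hG.mono (ℱ.le s)).aestronglyMeasurable
      (Eventually.of_forall fun ω => by rw [Real.norm_eq_abs]; exact hG1 ω)
  have h1 := condExp_mul_of_stronglyMeasurable_left hG hi (hM.integrable t)
  have h2 := hM.condExp_ae_eq hst
  calc ∫ ω, G ω * M t ω ∂P = ∫ ω, (P[G * M t | ℱ s]) ω ∂P := (integral_condExp (ℱ.le s)).symm
    _ = ∫ ω, G ω * M s ω ∂P := by
      refine integral_congr_ae ?_
      filter_upwards [h1, h2] with ω e1 e2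
      rw [e1, Pi.mul_apply, e2]

/-- The martingale increment after s is orthogonal to G, which is measurable at time s; Fubini then
moves the expectation inside the time integral. -/
theorem expect_sub (h : IsExclusionProcess n μ P η) (hG : StronglyMeasurable[h.filtration s] G)
    (hG1 : ∀ ω, |G ω| ≤ 1) {f : Config d → ℝ} (hf : IsLocal f) {t : ℝ} (hst : s ≤ t) :
    expect P η G f t - expect P η G f s =
      ∫ r in (s : ℝ)..t, (n : ℝ) ^ 2 * expect P η G (generator f) r := by
  have hGm : Measurable G := (hG.mono (h.filtration.le s)).measurable
  have hL := isLocal_generator hf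
  obtain ⟨K, hK0, hK⟩ := hL.exists_bound
  have ht0 : 0 ≤ t := s.coe_nonneg.trans hst
  have hst' : s ≤ t.toNNReal := Real.le_toNNReal_iff_coe_le ht0 |>.2 hst
  have hM := integral_mul_martingale (h.martingale f hf) hst' hG hG1
  set I : Ω → ℝ := fun ω => ∫ r in (s : ℝ)..t, (n : ℝ) ^ 2 * generator f (η r.toNNReal ω) with hI
  have hint : ∀ ω a b, IntervalIntegrable
      (fun r => (n : ℝ) ^ 2 * generator f (η r.toNNReal ω)) volume a b :=
    fun ω a b => (h.intervalIntegrable hL ω a b).const_mul _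
  have hMi := fun u => ((h.martingale f hf).integrable u).bdd_mul (c := 1) hGm.aestronglyMeasurable
      (Eventually.of_forall fun ω => by rw [Real.norm_eq_abs]; exact hG1 ω)
  have i1 := integrable_mul_comp hGm hG1 h hf t.toNNReal
  have i2 := integrable_mul_comp hGm hG1 h hf s
  have hpt : ∀ ω, G ω * I ω = (G ω * f (η t.toNNReal ω) - G ω * f (η s ω)) -
      (G ω * (f (η t.toNNReal ω) - f (η 0 ω) -
        ∫ r in (0 : ℝ)..t.toNNReal, (n : ℝ) ^ 2 * generator f (η r.toNNReal ω)) -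
      G ω * (f (η s ω) - f (η 0 ω) -
        ∫ r in (0 : ℝ)..s, (n : ℝ) ^ 2 * generator f (η r.toNNReal ω))) := by
    intro ω
    rw [Real.coe_toNNReal t ht0, hI]
    simp only
    rw [← intervalIntegral.integral_interval_sub_left (hint ω 0 t) (hint ω 0 s)]
    ring
  have hGI : ∫ ω, G ω * I ω ∂P = expect P η G f t - expect P η G f s := by
    simp only [hpt]
    refine (integral_sub (i1.sub i2) ((hMi t.toNNReal).sub (hMi s))).trans ?_
    refine (congrArg₂ (· - ·) (integral_sub i1 i2)
      (integral_sub (hMi t.toNNReal) (hMi s))).trans ?_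
    simp only [hM, sub_self, sub_zero, expect, Real.toNNReal_coe]
  rw [← hGI, intervalIntegral.integral_of_le hst]
  have hswap := integral_integral_swap (μ := volume.restrict (Set.Ioc (s : ℝ) t)) (ν := P)
    (f := fun r ω => G ω * ((n : ℝ) ^ 2 * generator f (η r.toNNReal ω))) ?_
  · calc ∫ ω, G ω * I ω ∂P
        = ∫ ω, (∫ r in Set.Ioc (s : ℝ) t, G ω * ((n : ℝ) ^ 2 * generator f (η r.toNNReal ω))) ∂P := by
          refine integral_congr_ae (Eventually.of_forall fun ω => ?_)
          simp only [hI]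
          rw [intervalIntegral.integral_of_le hst, ← integral_const_mul]
      _ = _ := by
          rw [← hswap]
          refine integral_congr_ae (Eventually.of_forall fun r => ?_)
          simp only [expect]
          rw [← integral_const_mul]
          refine integral_congr_ae (Eventually.of_forall fun ω => ?_)
          simp only
          ring
  · refine Integrable.of_bound (C := (n : ℝ) ^ 2 * K)
      ((hGm.comp measurable_snd).mul ((h.measurable_comp_toNNReal hL).const_mul _)).aestronglyMeasurable
      (Eventually.of_forall fun p => ?_)
    simp only [Function.uncurry, Real.norm_eq_abs]
    rw [abs_mul, abs_mul, abs_of_nonneg (by positivity : (0 : ℝ) ≤ (n : ℝ) ^ 2)]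
    refine (mul_le_of_le_one_left (by positivity) (hG1 _)).trans ?_
    gcongr
    exact hK _

theorem continuousOn_expect (h : IsExclusionProcess n μ P η) (hG : StronglyMeasurable[h.filtration s] G)
    (hG1 : ∀ ω, |G ω| ≤ 1) {f : Config d → ℝ} (hf : IsLocal f) :
    ContinuousOn (expect P η G f) (Set.Ici s) := by
  have hL := isLocal_generator hf
  obtain ⟨K, hK0, hK⟩ := hL.exists_bound
  have hGm : Measurable G := (hG.mono (h.filtration.le s)).measurable
  have hi : ∀ a b, IntervalIntegrable
      (fun r => (n : ℝ) ^ 2 * expect P η G (generator f) r) volume a b := by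
    intro a b
    refine ((intervalIntegrable_const (c := K)).mono_fun
      (measurable_expect hGm h hL).aestronglyMeasurable (Eventually.of_forall fun r => ?_)).const_mul _
    simp only [Real.norm_eq_abs]
    exact (abs_expect_le hG1 hK r).trans (le_abs_self K)
  have hc : Continuous fun t => expect P η G f s +
      ∫ r in (s : ℝ)..t, (n : ℝ) ^ 2 * expect P η G (generator f) r :=
    continuous_const.add (intervalIntegral.continuous_primitive hi s)
  refine hc.continuousOn.congr fun t ht => ?_
  simp only
  rw [← expect_sub h hG hG1 hf ht]
  ring

/-- The generator of a local function is again local, so the integrand in `expect_sub` is itself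
continuous in time and the integral equation can be differentiated. -/
theorem hasDerivAt_expect (h : IsExclusionProcess n μ P η) (hG : StronglyMeasurable[h.filtration s] G)
    (hG1 : ∀ ω, |G ω| ≤ 1) {f : Config d → ℝ} (hf : IsLocal f) {t : ℝ} (ht : s < t) :
    HasDerivAt (expect P η G f) ((n : ℝ) ^ 2 * expect P η G (generator f) t) t := by
  have hc := continuousOn_expect h hG hG1 (isLocal_generator hf)
  have hGm : Measurable G := (hG.mono (h.filtration.le s)).measurable
  have h1 : HasDerivAt (fun t => expect P η G f s +
      ∫ r in (s : ℝ)..t, (n : ℝ) ^ 2 * expect P η G (generator f) r)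
      ((n : ℝ) ^ 2 * expect P η G (generator f) t) t := by
    refine (intervalIntegral.integral_hasDerivAt_right ?_ ?_ ?_).const_add _
    · refine ContinuousOn.intervalIntegrable ?_
      rw [Set.uIcc_of_le ht.le]
      exact continuousOn_const.mul (hc.mono fun r hr => hr.1)
    · exact ((measurable_expect hGm h (isLocal_generator hf)).const_mul _
        ).stronglyMeasurable.stronglyMeasurableAtFilter
    · exact continuousAt_const.mul (hc.continuousAt (Ici_mem_nhds ht))
  refine h1.congr_of_eventuallyEq ?_
  filter_upwards [Ioi_mem_nhds ht] with r hr
  rw [← expect_sub h hG hG1 hf (le_of_lt hr)]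
  ring

/-! ### The microscopic time scale -/

/-- The expectation of `G f` at the microscopic time `τ` after the macroscopic time `s`. -/
def microExpect (n : ℕ) (P : Measure Ω) (η : ℝ≥0 → Ω → Config d) (s : ℝ≥0) (G : Ω → ℝ)
    (f : Config d → ℝ) (τ : ℝ) : ℝ := expect P η G f (s + max τ 0 / (n : ℝ) ^ 2)

theorem le_microTime (n : ℕ) (s : ℝ≥0) (τ : ℝ) : (s : ℝ) ≤ s + max τ 0 / (n : ℝ) ^ 2 :=
  le_add_of_nonneg_right (by positivity)

/-- The truncation `max τ 0` freezes the value at negative times, so continuity holds on the whole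
line, as required by `Hierarchy`. -/
theorem continuous_microExpect (h : IsExclusionProcess n μ P η)
    (hG : StronglyMeasurable[h.filtration s] G) (hG1 : ∀ ω, |G ω| ≤ 1) {f : Config d → ℝ}
    (hf : IsLocal f) : Continuous (microExpect n P η s G f) := by
  have h1 : Continuous fun τ : ℝ => (s : ℝ) + max τ 0 / (n : ℝ) ^ 2 := by fun_prop
  exact (continuousOn_expect h hG hG1 hf).comp_continuous h1 fun τ => le_microTime n s τ

theorem hasDerivAt_microExpect (hn : 1 ≤ n) (h : IsExclusionProcess n μ P η)
    (hG : StronglyMeasurable[h.filtration s] G) (hG1 : ∀ ω, |G ω| ≤ 1) {f : Config d → ℝ}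
    (hf : IsLocal f) {τ : ℝ} (hτ : 0 < τ) :
    HasDerivAt (microExpect n P η s G f) (microExpect n P η s G (generator f) τ) τ := by
  have hn0 : (n : ℝ) ≠ 0 := by positivity
  have h1 : HasDerivAt (fun τ : ℝ => (s : ℝ) + τ / (n : ℝ) ^ 2) (1 / (n : ℝ) ^ 2) τ :=
    ((hasDerivAt_id τ).div_const _).const_add _
  have h2 := hasDerivAt_expect h hG hG1 hf (t := (s : ℝ) + τ / (n : ℝ) ^ 2)
    (lt_add_of_pos_right _ (by positivity))
  refine ((h2.comp τ h1).congr_deriv ?_).congr_of_eventuallyEq ?_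
  · rw [microExpect, max_eq_left hτ.le]
    field_simp
  · filter_upwards [Ioi_mem_nhds hτ] with r hr
    rw [microExpect, max_eq_left (le_of_lt hr)]
    rfl

theorem microExpect_sum (h : IsExclusionProcess n μ P η) (hG : Measurable G) (hG1 : ∀ ω, |G ω| ≤ 1)
    {ι : Type*} (S : Finset ι) (c : ι → ℝ) {f : ι → Config d → ℝ} (hf : ∀ i, IsLocal (f i)) (τ : ℝ) :
    ∑ i ∈ S, c i * microExpect n P η s G (f i) τ =
      microExpect n P η s G (fun ζ => ∑ i ∈ S, c i * f i ζ) τ := by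
  simp only [microExpect, expect, Finset.mul_sum]
  rw [integral_finsetSum _ fun i _ => ?_]
  · refine Finset.sum_congr rfl fun i _ => ?_
    rw [← integral_const_mul]
    refine integral_congr_ae (Eventually.of_forall fun ω => ?_)
    simp only
    ring
  · have := (integrable_mul_comp hG hG1 h (hf i)
      (s + max τ 0 / (n : ℝ) ^ 2 : ℝ).toNNReal).const_mul (c i)
    refine this.congr (Eventually.of_forall fun ω => ?_)
    simp only
    ring

end

section

variable {d : ℕ}

/-! ### Finite linear combinations of evaluations -/

/-- A functional of set functions that is a finite linear combination of evaluations. -/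
def IsFinComb (L : (Finset (Site d) → ℝ) → ℝ) : Prop :=
  ∃ S : Finset (Site d) →₀ ℝ, ∀ f, L f = S.sum fun B k => k * f B

theorem IsFinComb.eval (B : Finset (Site d)) : IsFinComb fun f => f B :=
  ⟨Finsupp.single B 1, fun f => by simp⟩

theorem IsFinComb.add {L L' : (Finset (Site d) → ℝ) → ℝ} (h : IsFinComb L) (h' : IsFinComb L') :
    IsFinComb fun f => L f + L' f := by
  obtain ⟨S, hS⟩ := h
  obtain ⟨S', hS'⟩ := h'
  refine ⟨S + S', fun f => ?_⟩
  simp only [hS, hS']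
  rw [Finsupp.sum_add_index' (fun _ => zero_mul _) (fun _ _ _ => add_mul _ _ _)]

theorem IsFinComb.const_mul {L : (Finset (Site d) → ℝ) → ℝ} (c : ℝ) (h : IsFinComb L) :
    IsFinComb fun f => c * L f := by
  obtain ⟨S, hS⟩ := h
  refine ⟨c • S, fun f => ?_⟩
  rw [Finsupp.sum_smul_index fun _ => zero_mul _]
  simp only [hS, Finsupp.mul_sum, mul_assoc]

theorem IsFinComb.sub {L L' : (Finset (Site d) → ℝ) → ℝ} (h : IsFinComb L) (h' : IsFinComb L') :
    IsFinComb fun f => L f - L' f := by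
  simpa [sub_eq_add_neg] using h.add (h'.const_mul (-1))

theorem IsFinComb.sum {ι : Type*} (s : Finset ι) {L : ι → (Finset (Site d) → ℝ) → ℝ}
    (h : ∀ i, IsFinComb (L i)) : IsFinComb fun f => ∑ i ∈ s, L i f := by
  classical
  induction s using Finset.induction_on with
  | empty => exact ⟨0, fun f => by simp⟩
  | insert i s hi ih =>
    simp only [Finset.sum_insert hi]
    exact (h i).add ih

theorem isFinComb_exgen (A : Finset (Site d)) : IsFinComb fun f => exgen f A :=
  .sum _ fun _ => .sum _ fun _ => (IsFinComb.eval _).sub (.eval _)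

theorem isFinComb_source (c : Site d → ℝ) (A : Finset (Site d)) : IsFinComb fun f => source c f A :=
  .sum _ fun _ => .sum _ fun _ =>
    ((IsFinComb.eval _).const_mul _).add (((IsFinComb.eval _).sub (.eval _)).const_mul _)

variable {n : ℕ} {μ : Measure (Config d)} {Ω : Type*} [mΩ : MeasurableSpace Ω] {P : Measure Ω}
  {η : ℝ≥0 → Ω → Config d} {s : ℝ≥0} {G : Ω → ℝ}

/-! ### The density and the correlation functions -/

/-- The density profile at the microscopic time `τ` after `s`. -/
def microDensity (n : ℕ) (P : Measure Ω) (η : ℝ≥0 → Ω → Config d) (s : ℝ≥0) (τ : ℝ) (x : Site d) : ℝ :=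
  microExpect n P η s (fun _ => 1) (cprod 0 {x}) τ

/-- The expectation of `G` times a product of centered occupation numbers at the microscopic time `τ`
after `s`. -/
def microCorr (n : ℕ) (P : Measure Ω) (η : ℝ≥0 → Ω → Config d) (s : ℝ≥0) (G : Ω → ℝ) (τ : ℝ)
    (A : Finset (Site d)) : ℝ :=
  microExpect n P η s G (cprod (microDensity n P η s τ) A) τ

theorem microDensity_eq (τ : ℝ) (x : Site d) : microDensity n P η s τ x =
    ∫ ω, occ (η (s + max τ 0 / (n : ℝ) ^ 2 : ℝ).toNNReal ω) x ∂P := by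
  simp [microDensity, microExpect, expect, cprod]

theorem expect_time_shift {G : Ω → ℝ} {f : Config d → ℝ} (hn : 1 ≤ n) {τ : ℝ} (hτ : 0 ≤ τ) :
    microExpect n P η s G f τ = microExpect n P η 0 G f ((n : ℝ) ^ 2 * s + τ) := by
  have hn0 : (n : ℝ) ≠ 0 := by positivity
  rw [microExpect, microExpect, max_eq_left hτ, max_eq_left (by positivity)]
  congr 1
  rw [NNReal.coe_zero, zero_add]
  field_simp

variable [IsProbabilityMeasure P]

/-- Lets expectations pass through `exgen` and `source`, which are finite linear combinations of
evaluations at finite sets. -/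
theorem microExpect_finComb (h : IsExclusionProcess n μ P η) (hG : Measurable G)
    (hG1 : ∀ ω, |G ω| ≤ 1) {L : (Finset (Site d) → ℝ) → ℝ} (hL : IsFinComb L) (c : Site d → ℝ) (τ : ℝ) :
    microExpect n P η s G (fun ζ => L fun B => cprod c B ζ) τ =
      L fun B => microExpect n P η s G (cprod c B) τ := by
  obtain ⟨S, hS⟩ := hL
  simp only [hS]
  exact (microExpect_sum h hG hG1 _ _ (fun B => isLocal_cprod c B) τ).symm

theorem integrable_occ (h : IsExclusionProcess n μ P η) (t : ℝ≥0) (x : Site d) :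
    Integrable (fun ω => occ (η t ω) x) P := by
  have := integrable_mul_comp (G := fun _ => 1) measurable_const (by simp) h (isLocal_cprod 0 {x}) t
  simpa [cprod] using this

theorem integral_occ_mem (h : IsExclusionProcess n μ P η) (t : ℝ≥0) (x : Site d) :
    ∫ ω, occ (η t ω) x ∂P ∈ Set.Icc (0 : ℝ) 1 := by
  refine ⟨integral_nonneg fun ω => occ_nonneg _ _, ?_⟩
  refine (integral_mono (integrable_occ h t x) (integrable_const 1) fun ω => occ_le_one _ _).trans ?_
  simp

theorem microDensity_mem (h : IsExclusionProcess n μ P η) (τ : ℝ) (x : Site d) :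
    microDensity n P η s τ x ∈ Set.Icc (0 : ℝ) 1 := by
  rw [microDensity_eq]; exact integral_occ_mem h _ x

theorem continuous_microDensity (h : IsExclusionProcess n μ P η) (x : Site d) :
    Continuous (microDensity n P η s · x) :=
  continuous_microExpect h stronglyMeasurable_const (by simp) (isLocal_cprod 0 {x})

theorem hasDerivAt_microDensity (hn : 1 ≤ n) (h : IsExclusionProcess n μ P η) {τ : ℝ} (hτ : 0 < τ)
    (x : Site d) :
    HasDerivAt (microDensity n P η s · x) (lap (microDensity n P η s τ) x) τ := by
  refine (hasDerivAt_microExpect hn h stronglyMeasurable_const (by simp)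
    (isLocal_cprod 0 {x}) hτ).congr_deriv ?_
  have h1 : generator (cprod (0 : Site d → ℝ) {x}) =
      fun ζ => exgen (fun B => cprod (0 : Site d → ℝ) B ζ) {x} := by
    funext ζ
    have := generator_cprod 0 {x} ζ
    rw [source_singleton, add_zero] at this
    rw [← this]
    have h0 : lap (0 : Site d → ℝ) x = 0 := lap_const 0 x
    simp [h0]
  rw [h1, microExpect_finComb h measurable_const (by simp) (isFinComb_exgen _), exgen_singleton]
  rfl

/-- The centering moves with time, so this is not the expectation of one fixed local function. The
expansion puts the time dependence into coefficients, to which the product rule applies. -/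
theorem microCorr_expand (h : IsExclusionProcess n μ P η) (hG : Measurable G) (hG1 : ∀ ω, |G ω| ≤ 1)
    (τ : ℝ) (A : Finset (Site d)) : microCorr n P η s G τ A =
      ∑ B ∈ A.powerset, (∏ a ∈ A \ B, -microDensity n P η s τ a) *
        microExpect n P η s G (cprod 0 B) τ := by
  rw [microExpect_sum h hG hG1 _ _ fun B => isLocal_cprod 0 B, microCorr]
  congr 1
  funext ζ
  exact cprod_expand _ _ _

theorem continuous_microCorr (h : IsExclusionProcess n μ P η)
    (hG : StronglyMeasurable[h.filtration s] G) (hG1 : ∀ ω, |G ω| ≤ 1) (A : Finset (Site d)) :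
    Continuous (microCorr n P η s G · A) := by
  simp only [microCorr_expand h (hG.mono (h.filtration.le s)).measurable hG1]
  refine continuous_finsetSum _ fun B _ => Continuous.mul ?_
    (continuous_microExpect h hG hG1 (isLocal_cprod 0 B))
  exact continuous_finsetProd _ fun a _ => (continuous_microDensity h a).neg

theorem abs_microCorr_le (h : IsExclusionProcess n μ P η) (hG1 : ∀ ω, |G ω| ≤ 1) (τ : ℝ)
    (A : Finset (Site d)) : |microCorr n P η s G τ A| ≤ 1 :=
  abs_expect_le hG1 (abs_cprod_le (microDensity_mem h τ) A) _

theorem hasDerivAt_microCorr (hn : 1 ≤ n) (h : IsExclusionProcess n μ P η)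
    (hG : StronglyMeasurable[h.filtration s] G) (hG1 : ∀ ω, |G ω| ≤ 1) {τ : ℝ} (hτ : 0 < τ)
    (A : Finset (Site d)) :
    HasDerivAt (microCorr n P η s G · A) (exgen (microCorr n P η s G τ) A +
      source (microDensity n P η s τ) (microCorr n P η s G τ) A) τ := by
  have hGm := (hG.mono (h.filtration.le s)).measurable
  set ρ := microDensity n P η s with hρ
  have hρd := fun x => hasDerivAt_microDensity hn h (s := s) hτ x
  rw [← hρ] at hρd
  set D : Finset (Site d) → ℝ := fun B =>
    ∑ i ∈ A \ B, (∏ j ∈ (A \ B).erase i, -ρ τ j) • -lap (ρ τ) i with hD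
  have hDd : ∀ B, HasDerivAt (fun r => ∏ a ∈ A \ B, -ρ r a) (D B) τ := fun B =>
    HasDerivAt.fun_finsetProd fun a _ => (hρd a).fun_neg
  -- For a fixed configuration the centered product is differentiated twice, through its expansion
  -- and directly; uniqueness of the derivative yields the identity.
  have hpt : ∀ ζ : Config d, ∑ B ∈ A.powerset, D B * cprod 0 B ζ =
      -∑ a ∈ A, lap (ρ τ) a * cprod (ρ τ) (A.erase a) ζ := by
    intro ζ
    have h1 : HasDerivAt (fun r => cprod (ρ r) A ζ) (∑ B ∈ A.powerset, D B * cprod 0 B ζ) τ := by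
      rw [show (fun r => cprod (ρ r) A ζ) = fun r => ∑ B ∈ A.powerset,
        (∏ a ∈ A \ B, -ρ r a) * cprod 0 B ζ from funext fun r => cprod_expand _ _ _]
      exact HasDerivAt.fun_sum fun B _ => (hDd B).mul_const _
    have h2 : HasDerivAt (fun r => cprod (ρ r) A ζ)
        (∑ i ∈ A, (∏ j ∈ A.erase i, (occ ζ j - ρ τ j)) • -lap (ρ τ) i) τ :=
      HasDerivAt.fun_finsetProd fun a _ => (hρd a).const_sub _
    rw [h1.unique h2, ← Finset.sum_neg_distrib]
    refine Finset.sum_congr rfl fun a _ => ?_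
    rw [cprod, smul_eq_mul]; ring
  have hmain : HasDerivAt (microCorr n P η s G · A)
      (∑ B ∈ A.powerset, (D B * microExpect n P η s G (cprod 0 B) τ +
        (∏ a ∈ A \ B, -ρ τ a) * microExpect n P η s G (generator (cprod 0 B)) τ)) τ := by
    simp only [microCorr_expand h hGm hG1]
    exact HasDerivAt.fun_sum fun B _ => (hDd B).mul
      (hasDerivAt_microExpect hn h hG hG1 (isLocal_cprod 0 B) hτ)
  refine hmain.congr_deriv ?_
  have hL := (isFinComb_exgen A).add (isFinComb_source (ρ τ) A)
  have e1 := microExpect_finComb (s := s) h hGm hG1 hL (ρ τ) τ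
  -- The terms from moving coefficients and those from the generator are indexed by a disjoint sum,
  -- so that a single linear combination of local functions represents both.
  have e2 : ∀ ζ, exgen (fun B => cprod (ρ τ) B ζ) A + source (ρ τ) (fun B => cprod (ρ τ) B ζ) A =
      ∑ i ∈ A.powerset.disjSum A.powerset, (Sum.elim D (fun B => ∏ a ∈ A \ B, -ρ τ a) i) *
        (Sum.elim (fun B => cprod 0 B) (fun B => generator (cprod 0 B)) i : Config d → ℝ) ζ := by
    intro ζ
    rw [← generator_cprod, Finset.sum_disjSum]
    simp only [Sum.elim_inl, Sum.elim_inr]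
    rw [hpt, generator_cprod_expand]
    ring
  simp only [e2] at e1
  rw [← microExpect_sum h hGm hG1, Finset.sum_disjSum] at e1
  · simp only [Sum.elim_inl, Sum.elim_inr] at e1
    rw [Finset.sum_add_distrib, e1]
    rfl
  · rintro (B | B)
    · exact isLocal_cprod 0 B
    · exact isLocal_generator (isLocal_cprod 0 B)

/-! ### The gradient of the density -/

/-- The density solves the heat equation from time 0 on, hence so does its difference along a fixed
step; the maximum principle carries the initial bound to time n²s + τ. -/
theorem abs_microDensity_sub_le (hn : 1 ≤ n) (h : IsExclusionProcess n μ P η) {δ : ℝ}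
    (h0 : ∀ a, ∀ b ∈ nbr a, |microDensity n P η 0 0 a - microDensity n P η 0 0 b| ≤ δ) {τ : ℝ}
    (hτ : 0 ≤ τ) (a : Site d) {b : Site d} (hb : b ∈ nbr a) :
    |microDensity n P η s τ a - microDensity n P η s τ b| ≤ δ := by
  have h1 : ∀ x, microDensity n P η s τ x = microDensity n P η 0 ((n : ℝ) ^ 2 * s + τ) x := fun x =>
    expect_time_shift hn hτ
  have hT : 0 ≤ (n : ℝ) ^ 2 * s + τ := by positivity
  have h2 := heat_abs_le (T := (n : ℝ) ^ 2 * s + τ) (M := 2) (m := δ)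
    (u := fun τ x => microDensity n P η 0 τ x - microDensity n P η 0 τ (x + (b - a)))
    (fun x => ((continuous_microDensity h x).sub (continuous_microDensity h _)).continuousOn)
    (fun r hr x => ?_) (fun r hr x => ?_) (fun x => ?_) ⟨hT, le_rfl⟩ a
  · rw [add_sub_cancel] at h2
    rwa [h1, h1]
  · rw [lap_sub, lap_comp_add (microDensity n P η 0 r) x]
    exact (hasDerivAt_microDensity hn h hr.1 x).sub (hasDerivAt_microDensity hn h hr.1 _)
  · have e1 := microDensity_mem (s := 0) h r x
    have e2 := microDensity_mem (s := 0) h r (x + (b - a))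
    rw [abs_le]
    constructor <;> linarith [e1.1, e1.2, e2.1, e2.2]
  · refine h0 x _ (mem_nbr.2 ?_)
    rw [add_sub_cancel_left]
    exact mem_nbr.1 hb

/-- The correlation functions of the exclusion process solve the hierarchy. -/
theorem hierarchy_microCorr (hn : 1 ≤ n) (h : IsExclusionProcess n μ P η) {δ : ℝ}
    (h0 : ∀ a, ∀ b ∈ nbr a, |microDensity n P η 0 0 a - microDensity n P η 0 0 b| ≤ δ)
    (hG : StronglyMeasurable[h.filtration s] G) (hG1 : ∀ ω, |G ω| ≤ 1) :
    Hierarchy δ (microDensity n P η s) (microCorr n P η s G) where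
  cont := continuous_microCorr h hG hG1
  bdd := abs_microCorr_le h hG1
  deriv _ hτ A := hasDerivAt_microCorr hn h hG hG1 hτ A
  grad _ hτ a _ hb := abs_microDensity_sub_le hn h h0 hτ a hb

end

section

/-! ### Bounded functions with bounded fourth derivative are Lipschitz -/

theorem abs_le_pow_succ_of_hasDerivAt {f f' : ℝ → ℝ} {K : ℝ} {k : ℕ} (h0 : f 0 = 0)
    (hd : ∀ s, HasDerivAt f (f' s) s) (hb : ∀ s, |f' s| ≤ K * |s| ^ k) (hK : 0 ≤ K) (s : ℝ) :
    |f s| ≤ K * |s| ^ (k + 1) := by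
  have h1 := (convex_Icc (-|s|) |s|).norm_image_sub_le_of_norm_hasDerivWithin_le (f := f) (f' := f')
    (C := K * |s| ^ k) (x := 0) (y := s) (fun r _ => (hd r).hasDerivWithinAt) (fun r hr => ?_)
    ⟨by simp, by simp⟩ ⟨neg_abs_le s, le_abs_self s⟩
  · rw [h0, sub_zero, sub_zero, Real.norm_eq_abs, Real.norm_eq_abs] at h1
    rw [pow_succ]; linarith
  · refine (hb r).trans ?_
    exact mul_le_mul_of_nonneg_left (pow_le_pow_left₀ (abs_nonneg r) (abs_le.2 hr) k) hK

/-- A Landau–Kolmogorov inequality. -/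
theorem abs_deriv_le_of_fourth {g₀ g₁ g₂ g₃ g₄ : ℝ → ℝ} {K : ℝ} (hK : 0 ≤ K)
    (h0 : ∀ s, HasDerivAt g₀ (g₁ s) s) (h1 : ∀ s, HasDerivAt g₁ (g₂ s) s)
    (h2 : ∀ s, HasDerivAt g₂ (g₃ s) s) (h3 : ∀ s, HasDerivAt g₃ (g₄ s) s)
    (h4 : ∀ s, |g₄ s| ≤ K) (hg : ∀ s, g₀ s ∈ Set.Icc (0 : ℝ) 1) : |g₁ 0| ≤ 1 + 4 * K := by
  have r3 : ∀ s, |g₃ s - g₃ 0| ≤ K * |s| ^ (0 + 1) :=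
    abs_le_pow_succ_of_hasDerivAt (by ring) (fun s => (h3 s).sub_const _) (by simpa using h4) hK
  have r2 : ∀ s, |g₂ s - g₂ 0 - g₃ 0 * s| ≤ K * |s| ^ (0 + 1 + 1) := by
    refine abs_le_pow_succ_of_hasDerivAt (by ring) (fun s => ?_) r3 hK
    exact (((h2 s).sub_const _).sub ((hasDerivAt_id s).const_mul _)).congr_deriv (by ring)
  have r1 : ∀ s, |g₁ s - g₁ 0 - g₂ 0 * s - g₃ 0 * (s ^ 2 / 2)| ≤ K * |s| ^ (0 + 1 + 1 + 1) := by
    refine abs_le_pow_succ_of_hasDerivAt (by ring) (fun s => ?_) r2 hK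
    exact ((((h1 s).sub_const _).sub ((hasDerivAt_id s).const_mul _)).sub
      (((hasDerivAt_pow 2 s).div_const 2).const_mul _)).congr_deriv (by norm_num)
  have r0 : ∀ s, |g₀ s - g₀ 0 - g₁ 0 * s - g₂ 0 * (s ^ 2 / 2) - g₃ 0 * (s ^ 3 / 6)| ≤
      K * |s| ^ (0 + 1 + 1 + 1 + 1) := by
    refine abs_le_pow_succ_of_hasDerivAt (by ring) (fun s => ?_) r1 hK
    exact (((((h0 s).sub_const _).sub ((hasDerivAt_id s).const_mul _)).sub
      (((hasDerivAt_pow 2 s).div_const 2).const_mul _)).sub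
      (((hasDerivAt_pow 3 s).div_const 6).const_mul _)).congr_deriv (by norm_num; left; ring)
  -- In 8(g₀(1) - g₀(-1)) - (g₀(2) - g₀(-2)) the even orders and the third order cancel, leaving 12
  -- g₁(0). The values contribute at most 9 and the remainders at most 48K.
  have a1 := abs_le.1 (r0 1)
  have a2 := abs_le.1 (r0 (-1))
  have a3 := abs_le.1 (r0 2)
  have a4 := abs_le.1 (r0 (-2))
  norm_num at a1 a2 a3 a4
  rw [abs_le]
  constructor <;> linarith [a1.1, a1.2, a2.1, a2.2, a3.1, a3.2, a4.1, a4.2, (hg 1).1, (hg 1).2,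
    (hg (-1)).1, (hg (-1)).2, (hg 2).1, (hg 2).2, (hg (-2)).1, (hg (-2)).2]

theorem hasDerivAt_iteratedFDeriv_line {E : Type*} [NormedAddCommGroup E] [NormedSpace ℝ E]
    {f : E → ℝ} {k : ℕ} (hf : Differentiable ℝ (iteratedFDeriv ℝ k f)) (u w : E) (s : ℝ) :
    HasDerivAt (fun s : ℝ => iteratedFDeriv ℝ k f (u + s • w) fun _ => w)
      (iteratedFDeriv ℝ (k + 1) f (u + s • w) fun _ => w) s := by
  have h1 : HasDerivAt (fun s : ℝ => u + s • w) w s := by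
    simpa using ((hasDerivAt_id s).smul_const w).const_add u
  have h2 := (hf (u + s • w)).hasFDerivAt.comp_hasDerivAt s h1
  have h3 := ((ContinuousMultilinearMap.apply ℝ (fun _ : Fin k => E) ℝ fun _ => w).hasFDerivAt
    ).comp_hasDerivAt s h2
  refine h3.congr_deriv ?_
  rw [iteratedFDeriv_succ_apply_left]
  rfl

/-- The one-dimensional inequality applies on every line and from every base point, so the first
derivative is bounded everywhere. -/
theorem HasBoundedFourthDeriv.exists_lipschitz {d : ℕ} {f : EuclideanSpace ℝ (Fin d) → ℝ}
    (hf : HasBoundedFourthDeriv f) (h01 : ∀ u, f u ∈ Set.Icc (0 : ℝ) 1) :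
    ∃ L : ℝ, 0 ≤ L ∧ ∀ (u w : EuclideanSpace ℝ (Fin d)) (s : ℝ), ‖w‖ = 1 →
      |f (u + s • w) - f u| ≤ L * |s| := by
  obtain ⟨hC, hD, K, hK⟩ := hf
  have hK0 : 0 ≤ K := (norm_nonneg _).trans (hK 0)
  refine ⟨1 + 4 * K, by positivity, fun u w s hw => ?_⟩
  have hd : ∀ k : ℕ, k < 3 → Differentiable ℝ (iteratedFDeriv ℝ k f) := fun k hk =>
    hC.differentiable_iteratedFDeriv (by exact_mod_cast hk)
  have hline : ∀ u, |iteratedFDeriv ℝ 1 f u fun _ => w| ≤ 1 + 4 * K := by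
    intro u
    have := abs_deriv_le_of_fourth (K := K) hK0
      (hasDerivAt_iteratedFDeriv_line (hd 0 (by norm_num)) u w)
      (hasDerivAt_iteratedFDeriv_line (hd 1 (by norm_num)) u w)
      (hasDerivAt_iteratedFDeriv_line (hd 2 (by norm_num)) u w)
      (hasDerivAt_iteratedFDeriv_line hD u w) (fun s => ?_) (fun s => by simpa using h01 _)
    · simpa using this
    · have h5 := (iteratedFDeriv ℝ 4 f (u + s • w)).le_opNorm fun _ => w
      rw [Finset.prod_const, hw, one_pow, mul_one, Real.norm_eq_abs] at h5
      exact h5.trans (hK _)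
  have := abs_le_pow_succ_of_hasDerivAt (k := 0) (K := 1 + 4 * K)
    (f := fun s => f (u + s • w) - f u) (by simp)
    (fun s => by
      have := (hasDerivAt_iteratedFDeriv_line (hd 0 (by norm_num)) u w s).sub_const (f u)
      simpa only [iteratedFDeriv_zero_apply] using this)
    (fun s => by rw [pow_zero, mul_one]; exact hline _) (by positivity) s
  simpa using this

variable {d : ℕ} {ρ₀ : EuclideanSpace ℝ (Fin d) → unitInterval} {n : ℕ}

/-- The macroscopic position `x/n` of the site `x`. -/
def scaledPos (n : ℕ) (x : Site d) : EuclideanSpace ℝ (Fin d) := WithLp.toLp 2 fun j => (x j : ℝ) / (n : ℝ)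

theorem exists_abs_sub_le_of_mem_nbr (hf : HasBoundedFourthDeriv fun u => (ρ₀ u : ℝ)) :
    ∃ L : ℝ, 0 ≤ L ∧ ∀ n : ℕ, 1 ≤ n → ∀ a : Site d, ∀ b ∈ nbr a,
      |(ρ₀ (scaledPos n a) : ℝ) - ρ₀ (scaledPos n b)| ≤ L / n := by
  obtain ⟨L, hL, h⟩ := hf.exists_lipschitz fun u => (ρ₀ u).2
  refine ⟨L, hL, fun n hn a b hb => ?_⟩
  obtain ⟨j, hj⟩ := mem_dirs.1 (mem_nbr.1 hb)
  have hn0 : (0 : ℝ) < n := by positivity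
  have key : ∀ σ : ℝ, |σ| = 1 → (∀ i, ((b i : ℤ) : ℝ) = a i + σ * (unitVec j : Site d) i) →
      scaledPos n b = scaledPos n a + (σ / n) • EuclideanSpace.single j (1 : ℝ) := by
    intro σ _ hb
    ext i
    simp only [scaledPos, PiLp.add_apply, PiLp.smul_apply, PiLp.single_apply, smul_eq_mul, hb i,
      unitVec, Pi.single_apply]
    split_ifs <;> push_cast <;> ring
  have fin : ∀ σ : ℝ, |σ| = 1 → (∀ i, ((b i : ℤ) : ℝ) = a i + σ * (unitVec j : Site d) i) →
      |(ρ₀ (scaledPos n a) : ℝ) - ρ₀ (scaledPos n b)| ≤ L / n := by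
    intro σ hσ hb
    rw [key σ hσ hb, abs_sub_comm]
    refine (h (scaledPos n a) (EuclideanSpace.single j (1 : ℝ)) (σ / n) (by simp)).trans_eq ?_
    rw [abs_div, hσ, abs_of_pos hn0]; ring
  rcases hj with hj | hj
  · refine fin 1 (by simp) fun i => ?_
    have := congrFun hj i
    rw [Pi.sub_apply] at this
    rw [← this]; push_cast; ring
  · refine fin (-1) (by simp) fun i => ?_
    have := congrFun hj i
    rw [Pi.sub_apply, Pi.neg_apply] at this
    have h2 : (unitVec j : Site d) i = a i - b i := by linarith
    rw [h2]; push_cast; ring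

/-! ### The initial distribution -/

theorem integral_cprod_initialMeasure (c : Site d → ℝ) (A : Finset (Site d)) :
    ∫ ζ, cprod c A ζ ∂initialMeasure ρ₀ n = ∏ a ∈ A, ((ρ₀ (scaledPos n a) : ℝ) - c a) := by
  set ν : Site d → Measure Bool := fun x => bernoulliMeasure true false (ρ₀ (scaledPos n x)) with hν
  set X : Site d → Bool → ℝ := fun x b => (if b then 1 else 0) - c x with hX
  have hXm : ∀ x, Measurable (X x) := fun x => measurable_of_finite _
  have h1 := (iIndepFun_infinitePi (P := ν) hXm).precomp
    (g := fun a : A => (a : Site d)) Subtype.val_injective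
  have h2 := h1.integral_fun_prod_eq_prod_integral fun a =>
    ((hXm a).comp (measurable_pi_apply _)).aestronglyMeasurable
  have h3 : ∀ x, ∫ ζ, X x (ζ x) ∂Measure.infinitePi ν = (ρ₀ (scaledPos n x) : ℝ) - c x := by
    intro x
    have := integral_map (μ := Measure.infinitePi ν) (φ := fun ζ : Config d => ζ x)
      (measurable_pi_apply x).aemeasurable (f := X x) (hXm x).aestronglyMeasurable
    rw [← this, Measure.infinitePi_map_eval, hν, integral_bernoulliMeasure]
    simp only [hX, smul_eq_mul]
    norm_num
    ring
  rw [← Finset.prod_coe_sort A fun a => (ρ₀ (scaledPos n a) : ℝ) - c a]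
  simp only [← h3]
  rw [← h2]
  refine integral_congr_ae (Eventually.of_forall fun ζ => ?_)
  simp only [cprod, hX, occ]
  rw [← Finset.prod_coe_sort A]

variable {Ω : Type*} [mΩ : MeasurableSpace Ω] {P : Measure Ω} {η : ℝ≥0 → Ω → Config d}

theorem measurable_occ (x : Site d) : Measurable fun ζ : Config d => occ ζ x := by
  have := (isLocal_cprod (0 : Site d → ℝ) {x}).measurable
  unfold cprod at this
  simpa using this

theorem stronglyMeasurable_centered (h : IsExclusionProcess n (initialMeasure ρ₀ n) P η) (s : ℝ≥0)
    (y : Site d) : StronglyMeasurable[h.filtration s] (centered P η s y) := by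
  have h1 := (Filtration.stronglyAdapted_natural
    fun t => (h.measurable t).stronglyMeasurable) s
  exact (((measurable_occ y).comp h1.measurable).sub_const _).stronglyMeasurable

theorem integral_cprod_zero (h : IsExclusionProcess n (initialMeasure ρ₀ n) P η) (c : Site d → ℝ)
    (A : Finset (Site d)) :
    ∫ ω, cprod c A (η 0 ω) ∂P = ∏ a ∈ A, ((ρ₀ (scaledPos n a) : ℝ) - c a) := by
  rw [← integral_cprod_initialMeasure, ← h.initial, integral_map (h.measurable 0).aemeasurable
    (isLocal_cprod c A).measurable.aestronglyMeasurable]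

theorem microDensity_zero (h : IsExclusionProcess n (initialMeasure ρ₀ n) P η) (x : Site d) :
    microDensity n P η 0 0 x = ρ₀ (scaledPos n x) := by
  have := integral_cprod_zero h 0 {x}
  simpa [microDensity, microExpect, expect] using this

variable [IsProbabilityMeasure P]

/-! ### The correlation functions at equal times and at two times -/

theorem equalTime_microCorr (hn : 1 ≤ n) (h : IsExclusionProcess n (initialMeasure ρ₀ n) P η) {δ : ℝ}
    (h0 : ∀ a, ∀ b ∈ nbr a, |microDensity n P η 0 0 a - microDensity n P η 0 0 b| ≤ δ) :
    EqualTime δ (microDensity n P η 0) (microCorr n P η 0 fun _ => 1) where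
  toHierarchy := hierarchy_microCorr hn h h0 stronglyMeasurable_const (by simp)
  empty τ := by simp [microCorr, microExpect, expect, cprod]
  single τ x := by
    have := integrable_occ h ((0 : ℝ≥0) + max τ 0 / (n : ℝ) ^ 2 : ℝ).toNNReal x
    simp only [microCorr, microExpect, expect, cprod, Finset.prod_singleton, one_mul, microDensity_eq]
    rw [integral_sub this (integrable_const _)]
    simp
  init A hA := by
    obtain ⟨a, ha⟩ := hA
    have := integral_cprod_zero h (microDensity n P η 0 0) A
    rw [Finset.prod_eq_zero ha (by rw [microDensity_zero h, sub_self])] at this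
    simpa [microCorr, microExpect, expect] using this

theorem microTime_zero (s : ℝ≥0) : (s + max 0 0 / (n : ℝ) ^ 2 : ℝ).toNNReal = s := by simp

theorem microTime_of_nonneg (hn : 1 ≤ n) (s : ℝ≥0) :
    (((0 : ℝ≥0) : ℝ) + max ((n : ℝ) ^ 2 * s) 0 / (n : ℝ) ^ 2).toNNReal = s := by
  have hn0 : (n : ℝ) ≠ 0 := by positivity
  rw [max_eq_left (by positivity), mul_div_cancel_left₀ _ (by positivity), NNReal.coe_zero, zero_add,
    Real.toNNReal_coe]

theorem abs_centered_le (h : IsExclusionProcess n (initialMeasure ρ₀ n) P η) (s : ℝ≥0) (y : Site d)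
    (ω : Ω) : |centered P η s y ω| ≤ 1 := by
  have h1 := integral_occ_mem h s y
  rw [centered, abs_le]
  constructor <;> linarith [h1.1, h1.2, occ_nonneg (η s ω) y, occ_le_one (η s ω) y]

theorem twoTime_microCorr (hn : 1 ≤ n) (h : IsExclusionProcess n (initialMeasure ρ₀ n) P η) {δ : ℝ}
    (h0 : ∀ a, ∀ b ∈ nbr a, |microDensity n P η 0 0 a - microDensity n P η 0 0 b| ≤ δ) (s : ℝ≥0)
    (y : Site d) :
    TwoTime δ (microDensity n P η 0) (microCorr n P η 0 fun _ => 1) ((n : ℝ) ^ 2 * s) y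
      (microDensity n P η s) (microCorr n P η s (centered P η s y)) := by
  have e1 : ∀ x, microDensity n P η s 0 x = ∫ ω, occ (η s ω) x ∂P := fun x => by
    rw [microDensity_eq, microTime_zero]
  have e2 : ∀ x, microDensity n P η 0 ((n : ℝ) ^ 2 * s) x = ∫ ω, occ (η s ω) x ∂P := fun x => by
    rw [microDensity_eq, microTime_of_nonneg hn]
  set ρ : Site d → ℝ := fun x => ∫ ω, occ (η s ω) x ∂P with hρ
  have e3 : ∀ A, microCorr n P η s (centered P η s y) 0 A =
      ∫ ω, (occ (η s ω) y - ρ y) * cprod ρ A (η s ω) ∂P := fun A => by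
    rw [microCorr, microExpect, expect, microTime_zero, show microDensity n P η s 0 = ρ from funext e1]
    rfl
  have e4 : ∀ A, microCorr n P η 0 (fun _ => 1) ((n : ℝ) ^ 2 * s) A =
      ∫ ω, cprod ρ A (η s ω) ∂P := fun A => by
    rw [microCorr, microExpect, expect, microTime_of_nonneg hn,
      show microDensity n P η 0 ((n : ℝ) ^ 2 * s) = ρ from funext e2]
    simp only [one_mul]
  have hint : ∀ A, Integrable (fun ω => cprod ρ A (η s ω)) P := fun A => by
    simpa using integrable_mul_comp (G := fun _ => 1) measurable_const (by simp) h
      (isLocal_cprod ρ A) s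
  exact
  { toHierarchy := hierarchy_microCorr hn h h0 (stronglyMeasurable_centered h s y)
      (abs_centered_le h s y)
    equal := equalTime_microCorr hn h h0
    time_nonneg := by positivity
    empty := fun τ => by
      simp only [microCorr, microExpect, expect, cprod, Finset.prod_empty, mul_one, centered]
      rw [integral_sub (integrable_occ h s y) (integrable_const _)]
      simp
    init_notMem := fun A hA => by
      rw [e3, e4]
      simp only [cprod, Finset.prod_insert hA]
    init_mem := by
      -- Since η² = η for an occupation number, (η - r)² = (1 - 2r)(η - r) + r(1 - r) with r the
      -- density at y.
      refine ⟨ρ y, integral_occ_mem h s y, fun A hA => ?_⟩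
      obtain ⟨r, hr⟩ : ∃ r, ρ y = r := ⟨_, rfl⟩
      rw [e3, e4, e4, hr, ← integral_const_mul, ← integral_const_mul,
        ← integral_add ((hint A).const_mul _) ((hint _).const_mul _)]
      refine integral_congr_ae (Eventually.of_forall fun ω => ?_)
      simp only
      rw [cprod_eq_mul ρ hA, hr]
      linear_combination cprod ρ (A.erase y) (η s ω) * occ_mul_self (η s ω) y }

end

section

variable {d : ℕ}

/-! ### Bounds for the correlation functions -/

theorem heatDecay_two_eq_decay (n : ℕ) {s t : ℝ≥0} (hst : s ≤ t) :
    heatDecay 2 ((n : ℝ) ^ 2 * (t - s)) = decay n s t := by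
  have : (s : ℝ) ≤ t := hst
  have h : 0 ≤ (n : ℝ) ^ 2 * ((t : ℝ) - s) := mul_nonneg (by positivity) (by linarith)
  rw [heatDecay, decay, div_pow, one_pow, Real.sq_sqrt (by linarith)]

theorem heatDecay_eq_rpow (d n : ℕ) {s t : ℝ≥0} (hst : s ≤ t) :
    heatDecay d ((n : ℝ) ^ 2 * (t - s)) = decay n s t ^ ((d : ℝ) / 2) := by
  have : (s : ℝ) ≤ t := hst
  have h : 0 ≤ (n : ℝ) ^ 2 * ((t : ℝ) - s) := mul_nonneg (by positivity) (by linarith)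
  have h' : 0 ≤ 1 / (1 + (n : ℝ) ^ 2 * ((t : ℝ) - s)) := by positivity
  rw [heatDecay, decay, ← Real.sqrt_one, ← Real.sqrt_div zero_le_one, Real.sqrt_one,
    Real.sqrt_eq_rpow, ← Real.rpow_natCast, ← Real.rpow_mul h']
  congr 1
  ring

theorem decay_nonneg (n : ℕ) {s t : ℝ≥0} (hst : s ≤ t) : 0 ≤ decay n s t := by
  rw [← heatDecay_two_eq_decay n hst]; exact heatDecay_nonneg _ _

theorem microCorr_eq {n : ℕ} (hn : 1 ≤ n) {Ω : Type*} [MeasurableSpace Ω] {P : Measure Ω}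
    {η : ℝ≥0 → Ω → Config d} {s t : ℝ≥0} (hst : s ≤ t) (y : Site d) (A : Finset (Site d)) :
    microCorr n P η s (centered P η s y) ((n : ℝ) ^ 2 * (t - s)) A =
      ∫ ω, centered P η s y ω * ∏ x ∈ A, centered P η t x ω ∂P := by
  have hst' : (s : ℝ) ≤ t := hst
  have hn0 : (n : ℝ) ≠ 0 := by positivity
  have e : ((s : ℝ) + max ((n : ℝ) ^ 2 * (t - s)) 0 / (n : ℝ) ^ 2).toNNReal = t := by
    rw [max_eq_left (mul_nonneg (by positivity) (by linarith)), mul_div_cancel_left₀ _ (by positivity),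
      add_sub_cancel, Real.toNNReal_coe]
  simp only [microCorr, microExpect, expect, e, cprod, microDensity_eq]
  rfl

/-- The abstract bounds with δ = L/n. The parameter Λ bounds `ell` up to the final time, so the
logarithm of d = 2 and the constant of d ≥ 3 are treated together. -/
theorem exists_corr_bounds (hd : 2 ≤ d) {ρ₀ : EuclideanSpace ℝ (Fin d) → unitInterval}
    (hρ₀ : HasBoundedFourthDeriv fun u => (ρ₀ u : ℝ)) :
    ∃ C : ℝ, 0 ≤ C ∧ ∀ n : ℕ, 1 ≤ n → ∀ (Ω : Type*) [MeasurableSpace Ω] (P : Measure Ω)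
      [IsProbabilityMeasure P] (η : ℝ≥0 → Ω → Config d),
      IsExclusionProcess n (initialMeasure ρ₀ n) P η →
    ∀ s t : ℝ≥0, s ≤ t → ∀ Λ : ℝ, ell d ((n : ℝ) ^ 2 * t) ≤ Λ → ∀ y : Site d,
      (∀ x₁ : Site d, |corr P η ![s, t] ![y, x₁]| ≤
        C * (Λ / n ^ 2 + heatDecay d ((n : ℝ) ^ 2 * (t - s)))) ∧
      (∀ x₁ x₂ : Site d, x₁ ≠ x₂ → |corr P η ![s, t, t] ![y, x₁, x₂]| ≤
        C * (Λ / n ^ 3 + (1 + Λ / n) / n * heatDecay d ((n : ℝ) ^ 2 * (t - s)))) ∧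
      (∀ x₁ x₂ x₃ : Site d, x₁ ≠ x₂ → x₁ ≠ x₃ → x₂ ≠ x₃ →
        |corr P η ![s, t, t, t] ![y, x₁, x₂, x₃]| ≤
        C * (Λ ^ 2 / n ^ 4 + (1 + Λ / n) * Λ / n ^ 2 * heatDecay d ((n : ℝ) ^ 2 * (t - s)))) := by
  obtain ⟨L, hL, hgrad⟩ := exists_abs_sub_le_of_mem_nbr hρ₀
  obtain ⟨C₂, hC₂, h₂⟩ := TwoTime.exists_two_le hd
  obtain ⟨C₃, hC₃, h₃⟩ := TwoTime.exists_three_le hd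
  have k1 := exConst_nonneg d 1
  have k2 := exConst_nonneg d 2
  refine ⟨(exConst d 2 * L ^ 2 + exConst d 1) + C₂ * (L ^ 3 + L + L ^ 2) +
    C₃ * (L ^ 4 + L ^ 2 + L ^ 3), by positivity, ?_⟩
  intro n hn Ω _ P _ η h s t hst Λ hΛ y
  have hn0 : (0 : ℝ) < n := by positivity
  have hn1 : (1 : ℝ) ≤ n := by exact_mod_cast hn
  have hst' : (s : ℝ) ≤ t := hst
  have htt := twoTime_microCorr hn h (δ := L / n) (fun a b hb => by
    rw [microDensity_zero h, microDensity_zero h]; exact hgrad n hn a b hb) s y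
  set τ := (n : ℝ) ^ 2 * ((t : ℝ) - s) with hτ
  have hτ0 : 0 ≤ τ := mul_nonneg (by positivity) (by linarith)
  have hl0 : ell d ((n : ℝ) ^ 2 * s) ≤ Λ := (ell_mono d (by positivity) (by gcongr)).trans hΛ
  have hl1 : ell d τ ≤ Λ := (ell_mono d hτ0 (by
    rw [hτ]; gcongr; linarith [s.coe_nonneg])).trans hΛ
  have hΛ0 : 0 ≤ Λ := (ell_nonneg d hτ0).trans hl1
  have hD := heatDecay_nonneg d τ
  have m1 : 0 ≤ exConst d 2 * L ^ 2 + exConst d 1 := by positivity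
  have m2 : 0 ≤ C₂ * (L ^ 3 + L + L ^ 2) := by positivity
  have m3 : 0 ≤ C₃ * (L ^ 4 + L ^ 2 + L ^ 3) := by positivity
  refine ⟨fun x₁ => ?_, fun x₁ x₂ h12 => ?_, fun x₁ x₂ x₃ h12 h13 h23 => ?_⟩
  · have e : corr P η ![s, t] ![y, x₁] = microCorr n P η s (centered P η s y) τ {x₁} := by
      rw [microCorr_eq hn hst]
      simp [corr, Fin.prod_univ_succ]
    rw [e]
    have hb := htt.one_le hd hτ0 (A := {x₁}) (Finset.card_singleton _)
    have p1 : 0 ≤ Λ / (n : ℝ) ^ 2 := by positivity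
    calc _ ≤ exConst d 2 * ((L / n) ^ 2 * Λ) + exConst d 1 * heatDecay d τ :=
          hb.trans (by gcongr)
      _ = exConst d 2 * L ^ 2 * (Λ / n ^ 2) + exConst d 1 * heatDecay d τ := by ring
      _ ≤ (exConst d 2 * L ^ 2 + exConst d 1) * (Λ / n ^ 2 + heatDecay d τ) := by
          have q1 := mul_nonneg k1 p1
          have q2 : 0 ≤ exConst d 2 * L ^ 2 * heatDecay d τ := by positivity
          linarith
      _ ≤ _ := mul_le_mul_of_nonneg_right (by linarith) (by positivity)
  · have e : corr P η ![s, t, t] ![y, x₁, x₂] =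
        microCorr n P η s (centered P η s y) τ {x₁, x₂} := by
      rw [microCorr_eq hn hst]
      simp [corr, Fin.prod_univ_succ, Finset.prod_pair h12]
    rw [e]
    have hb := h₂ htt hτ0 hl0 hl1 (A := {x₁, x₂}) (Finset.card_pair h12)
    have p1 : 0 ≤ Λ / (n : ℝ) ^ 3 := by positivity
    have p2 : 0 ≤ 1 / (n : ℝ) * heatDecay d τ := by positivity
    have p3 : 0 ≤ Λ / (n : ℝ) ^ 2 * heatDecay d τ := by positivity
    calc _ ≤ C₂ * (L ^ 3 * (Λ / n ^ 3) + (L * (1 / n * heatDecay d τ) +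
          L ^ 2 * (Λ / n ^ 2 * heatDecay d τ))) := hb.trans_eq (by ring)
      _ ≤ C₂ * ((L ^ 3 + L + L ^ 2) * (Λ / n ^ 3 + (1 / n * heatDecay d τ +
          Λ / n ^ 2 * heatDecay d τ))) := by
          gcongr
          have q1 : 0 ≤ (L + L ^ 2) * (Λ / n ^ 3) := by positivity
          have q2 : 0 ≤ (L ^ 3 + L ^ 2) * (1 / n * heatDecay d τ) := by positivity
          have q3 : 0 ≤ (L ^ 3 + L) * (Λ / n ^ 2 * heatDecay d τ) := by positivity
          linarith
      _ = C₂ * (L ^ 3 + L + L ^ 2) * (Λ / n ^ 3 + (1 + Λ / n) / n * heatDecay d τ) := by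
          field_simp
      _ ≤ _ := mul_le_mul_of_nonneg_right (by linarith) (by positivity)
  · have hc : ({x₁, x₂, x₃} : Finset (Site d)).card = 3 :=
      Finset.card_eq_three.2 ⟨x₁, x₂, x₃, h12, h13, h23, rfl⟩
    have e : corr P η ![s, t, t, t] ![y, x₁, x₂, x₃] =
        microCorr n P η s (centered P η s y) τ {x₁, x₂, x₃} := by
      rw [microCorr_eq hn hst]
      have : ∀ f : Site d → ℝ, ∏ x ∈ ({x₁, x₂, x₃} : Finset (Site d)), f x = f x₁ * (f x₂ * f x₃) := by
        intro f
        rw [Finset.prod_insert (by simp [h12, h13]), Finset.prod_pair h23]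
      simp [corr, Fin.prod_univ_succ, this]
    rw [e]
    have hb := h₃ htt hτ0 hl0 hl1 hc
    -- The δ³ term from initial sets containing y is of lower order and merges with the δ² term,
    -- because n ≥ 1.
    have p4 : L ^ 3 * (1 / (n : ℝ) ^ 3) ≤ L ^ 3 * (1 / (n : ℝ) ^ 2) := by
      gcongr
      norm_num
    have hD' : 0 ≤ Λ * heatDecay d τ := by positivity
    calc _ ≤ C₃ * (L ^ 4 * (Λ ^ 2 / n ^ 4) + (L ^ 2 * (1 / n ^ 2) + L ^ 3 * (1 / n ^ 3) +
          L ^ 3 * (Λ / n ^ 3)) * (Λ * heatDecay d τ)) := hb.trans_eq (by ring)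
      _ ≤ C₃ * (L ^ 4 * (Λ ^ 2 / n ^ 4) + (L ^ 2 * (1 / n ^ 2) + L ^ 3 * (1 / n ^ 2) +
          L ^ 3 * (Λ / n ^ 3)) * (Λ * heatDecay d τ)) := by gcongr
      _ ≤ C₃ * ((L ^ 4 + L ^ 2 + L ^ 3) * (Λ ^ 2 / n ^ 4 + (1 / n ^ 2 + Λ / n ^ 3) *
          (Λ * heatDecay d τ))) := by
          gcongr
          have q1 : 0 ≤ (L ^ 2 + L ^ 3) * (Λ ^ 2 / n ^ 4) := by positivity
          have q2 : 0 ≤ L ^ 4 * (1 / n ^ 2) * (Λ * heatDecay d τ) := by positivity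
          have q3 : 0 ≤ (L ^ 4 + L ^ 2) * (Λ / n ^ 3) * (Λ * heatDecay d τ) := by positivity
          linarith
      _ = C₃ * (L ^ 4 + L ^ 2 + L ^ 3) * (Λ ^ 2 / n ^ 4 + (1 + Λ / n) * Λ / n ^ 2 *
          heatDecay d τ) := by
          field_simp
      _ ≤ _ := mul_le_mul_of_nonneg_right (by linarith) (by positivity)

theorem abs_corr_two_le_one {n : ℕ} {ρ₀ : EuclideanSpace ℝ (Fin d) → unitInterval} {Ω : Type*}
    [MeasurableSpace Ω] {P : Measure Ω} [IsProbabilityMeasure P] {η : ℝ≥0 → Ω → Config d}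
    (h : IsExclusionProcess n (initialMeasure ρ₀ n) P η) (s t : ℝ≥0) (y x : Site d) :
    |corr P η ![s, t] ![y, x]| ≤ 1 := by
  have := norm_integral_le_of_norm_le_const (μ := P) (C := 1)
    (f := fun ω => centered P η s y ω * centered P η t x ω) (Eventually.of_forall fun ω => by
      rw [Real.norm_eq_abs, abs_mul]
      exact mul_le_one₀ (abs_centered_le h s y ω) (abs_nonneg _) (abs_centered_le h t x ω))
  simpa [corr, Fin.prod_univ_succ] using this

/-- The additive term log(1+T) is absorbed into a multiple of log n, which is where n ≥ 2 is needed.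
-/
theorem log_one_add_sq_mul_le {n : ℕ} (hn : 2 ≤ n) {T : ℝ} (hT : 0 ≤ T) :
    Real.log (1 + (n : ℝ) ^ 2 * T) ≤ (2 + Real.log (1 + T) / Real.log 2) * Real.log n := by
  have hn0 : (0 : ℝ) < n := by positivity
  have hn1 : (2 : ℝ) ≤ n := by exact_mod_cast hn
  have h2 : 0 < Real.log 2 := Real.log_pos (by norm_num)
  have h3 : Real.log 2 ≤ Real.log n := Real.log_le_log (by norm_num) hn1
  have h4 : 0 ≤ Real.log (1 + T) := Real.log_nonneg (by linarith)
  calc Real.log (1 + (n : ℝ) ^ 2 * T) ≤ Real.log ((n : ℝ) ^ 2 * (1 + T)) := by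
        refine Real.log_le_log (by positivity) ?_
        nlinarith
    _ = 2 * Real.log n + Real.log (1 + T) / Real.log 2 * Real.log 2 := by
        rw [Real.log_mul (by positivity) (by positivity), Real.log_pow, div_mul_cancel₀ _ h2.ne']
        norm_num
    _ ≤ 2 * Real.log n + Real.log (1 + T) / Real.log 2 * Real.log n := by gcongr
    _ = _ := by ring

theorem add_le_mul_add {a b c x y : ℝ} (ha : a ≤ c) (hb : b ≤ c) (hx : 0 ≤ x) (hy : 0 ≤ y) :
    a * x + b * y ≤ c * (x + y) := by
  rw [mul_add]
  exact add_le_add (mul_le_mul_of_nonneg_right ha hx) (mul_le_mul_of_nonneg_right hb hy)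

end

end SSEP

end

/-! ### The correlation bounds in dimension two and in higher dimensions -/

theorem lemma3p3 (d : ℕ) (ρ₀ : EuclideanSpace ℝ (Fin d) → unitInterval)
    (hρ₀ : SSEP.HasBoundedFourthDeriv fun u => (ρ₀ u : ℝ)) (T : ℝ≥0) (hT : 0 < T) :
    ∃ C : ℝ, 0 < C ∧
      ∀ n : ℕ, 1 ≤ n →
      ∀ (Ω : Type*) [MeasurableSpace Ω] (P : Measure Ω) [IsProbabilityMeasure P]
        (η : ℝ≥0 → Ω → SSEP.Config d),
        SSEP.IsExclusionProcess n (SSEP.initialMeasure ρ₀ n) P η →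
      ∀ s t : ℝ≥0, 0 < s → s < t → t ≤ T →
      ∀ y : SSEP.Site d,
        (d = 2 →
          (∀ x₁ : SSEP.Site d,
            |SSEP.corr P η ![s, t] ![y, x₁]| ≤
              C * (Real.log n / (n : ℝ) ^ 2 + SSEP.decay n s t)) ∧
          (3 ≤ n → ∀ x₁ x₂ : SSEP.Site d, x₁ ≠ x₂ →
            |SSEP.corr P η ![s, t, t] ![y, x₁, x₂]| ≤
              C * (Real.log n * Real.log (Real.log n) / (n : ℝ) ^ 3
                + 1 / (n : ℝ) * SSEP.decay n s t)) ∧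
          (2 ≤ n → ∀ x₁ x₂ x₃ : SSEP.Site d, x₁ ≠ x₂ → x₁ ≠ x₃ → x₂ ≠ x₃ →
            |SSEP.corr P η ![s, t, t, t] ![y, x₁, x₂, x₃]| ≤
              C * (Real.log n ^ 2 / (n : ℝ) ^ 4
                + Real.log n / (n : ℝ) ^ 2 * SSEP.decay n s t))) ∧
        (3 ≤ d →
          (∀ x₁ : SSEP.Site d,
            |SSEP.corr P η ![s, t] ![y, x₁]| ≤
              C * (1 / (n : ℝ) ^ 2 + SSEP.decay n s t ^ ((d : ℝ) / 2))) ∧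
          (∀ x₁ x₂ : SSEP.Site d, x₁ ≠ x₂ →
            |SSEP.corr P η ![s, t, t] ![y, x₁, x₂]| ≤
              C * (1 / (n : ℝ) ^ 3 + 1 / (n : ℝ) * SSEP.decay n s t ^ ((d : ℝ) / 2))) ∧
          (∀ x₁ x₂ x₃ : SSEP.Site d, x₁ ≠ x₂ → x₁ ≠ x₃ → x₂ ≠ x₃ →
            |SSEP.corr P η ![s, t, t, t] ![y, x₁, x₂, x₃]| ≤
              C * (1 / (n : ℝ) ^ 4
                + 1 / (n : ℝ) ^ 2 * SSEP.decay n s t ^ ((d : ℝ) / 2)))) := by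
  -- Below dimension two both implications are void.
  by_cases hd : 2 ≤ d
  swap
  · exact ⟨1, one_pos, fun n _ Ω _ P _ η _ s t _ _ _ y =>
      ⟨fun h => absurd h (by omega), fun h => absurd h (by omega)⟩⟩
  obtain ⟨A, hA, hbd⟩ := SSEP.exists_corr_bounds hd hρ₀
  have hT0 : (0 : ℝ) ≤ T := T.coe_nonneg
  set κ : ℝ := 2 + Real.log (1 + T) / Real.log 2 with hκ
  set l : ℝ := Real.log (Real.log 3) with hl
  have hκ0 : 2 ≤ κ := le_add_of_nonneg_right
    (div_nonneg (Real.log_nonneg (by linarith)) (Real.log_nonneg (by norm_num)))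
  have hlog3 : 1 < Real.log 3 := by
    rw [Real.lt_log_iff_exp_lt (by norm_num)]
    exact Real.exp_one_lt_d9.trans (by norm_num)
  have hl0 : 0 < l := Real.log_pos hlog3
  have c1 : 0 ≤ A * κ ^ 2 := by positivity
  have c2 : 0 ≤ A * κ := by positivity
  have c3 : 0 ≤ A * κ / l := by positivity
  -- The summands with κ serve d = 2, the one divided by l = log log 3 the iterated logarithm, 1 + T
  -- the case n = 1, and 12A the coefficients up to 6A that occur for d ≥ 3.
  refine ⟨A * κ ^ 2 + A * κ + A * κ / l + A + (1 + T) + 12 * A, by positivity, ?_⟩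
  intro n hn Ω _ P _ η h s t hs hst htT y
  have hn0 : (0 : ℝ) < n := by positivity
  have hn1 : (1 : ℝ) ≤ n := by exact_mod_cast hn
  have htT' : (t : ℝ) ≤ T := htT
  have hD := SSEP.decay_nonneg n hst.le
  refine ⟨?_, fun hd3 => ?_⟩
  · rintro rfl
    have hlogn : 0 ≤ Real.log n := Real.log_nonneg hn1
    have hΛn : κ * Real.log n / n ≤ κ := by
      rw [div_le_iff₀ hn0]
      gcongr
      exact (Real.log_le_sub_one_of_pos hn0).trans (by linarith)
    have hb := fun hn2 : 2 ≤ n => hbd n hn Ω P η h s t hst.le (κ * Real.log n) (by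
      rw [SSEP.ell_two (by positivity)]
      refine (Real.log_le_log (by positivity) ?_).trans (SSEP.log_one_add_sq_mul_le hn2 hT0)
      gcongr) y
    simp only [SSEP.heatDecay_two_eq_decay n hst.le] at hb
    refine ⟨fun x₁ => ?_, fun hn3 x₁ x₂ h12 => ?_, fun hn2 x₁ x₂ x₃ h12 h13 h23 => ?_⟩
    · rcases hn.eq_or_lt with rfl | hn2
      · refine (SSEP.abs_corr_two_le_one h s t y x₁).trans ?_
        have hd1 : 1 ≤ (1 + (T : ℝ)) * SSEP.decay 1 s t := by
          have : (s : ℝ) < t := hst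
          rw [SSEP.decay, mul_one_div, le_div_iff₀ (by norm_num; linarith)]
          norm_num
          linarith [s.coe_nonneg]
        norm_num
        refine hd1.trans (mul_le_mul_of_nonneg_right (by linarith) hD)
      · refine ((hb hn2).1 x₁).trans ?_
        refine (le_of_eq ?_).trans (SSEP.add_le_mul_add (a := A * κ) (b := A) (by linarith)
          (by linarith) (by positivity) hD)
        ring
    · have hlog : 0 < Real.log 3 := by linarith
      have h3n : Real.log 3 ≤ Real.log n := Real.log_le_log (by norm_num) (by exact_mod_cast hn3)
      have hll : l ≤ Real.log (Real.log n) := Real.log_le_log hlog h3n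
      -- The bound proved has no iterated logarithm; for n ≥ 3 that factor is at least l > 0 and can
      -- be inserted at the cost of 1/l.
      have e1 : A * κ * (Real.log n / n ^ 3) ≤
          A * κ / l * (Real.log n * Real.log (Real.log n) / n ^ 3) := by
        rw [div_mul_eq_mul_div, le_div_iff₀ hl0, mul_assoc (A * κ), div_mul_eq_mul_div]
        gcongr
      refine ((hb (by omega)).2.1 x₁ x₂ h12).trans ?_
      have hll0 : 0 ≤ Real.log (Real.log n) := hl0.le.trans hll
      calc _ ≤ A * (κ * Real.log n / n ^ 3 + (1 + κ) / n * SSEP.decay n s t) := by gcongr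
        _ = A * κ * (Real.log n / n ^ 3) + (A + A * κ) * (1 / n * SSEP.decay n s t) := by ring
        _ ≤ A * κ / l * (Real.log n * Real.log (Real.log n) / n ^ 3) +
            (A + A * κ) * (1 / n * SSEP.decay n s t) := by linarith
        _ ≤ _ := SSEP.add_le_mul_add (by linarith) (by linarith) (by positivity) (by positivity)
    · refine ((hb hn2).2.2 x₁ x₂ x₃ h12 h13 h23).trans ?_
      calc _ ≤ A * ((κ * Real.log n) ^ 2 / n ^ 4 +
            (1 + κ) * (κ * Real.log n) / n ^ 2 * SSEP.decay n s t) := by gcongr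
        _ = A * κ ^ 2 * (Real.log n ^ 2 / n ^ 4) +
            (A * κ + A * κ ^ 2) * (Real.log n / n ^ 2 * SSEP.decay n s t) := by ring
        _ ≤ _ := SSEP.add_le_mul_add (by linarith) (by linarith) (by positivity) (by positivity)
  · have hb := hbd n hn Ω P η h s t hst.le 2
      ((SSEP.ell_le_of_le hd3 (by positivity)).trans (SSEP.ell_three_le (by positivity))) y
    simp only [SSEP.heatDecay_eq_rpow d n hst.le] at hb
    have hD' : 0 ≤ SSEP.decay n s t ^ ((d : ℝ) / 2) := Real.rpow_nonneg hD _
    have h2n : 2 / (n : ℝ) ≤ 2 := div_le_self (by norm_num) hn1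
    refine ⟨fun x₁ => ?_, fun x₁ x₂ h12 => ?_, fun x₁ x₂ x₃ h12 h13 h23 => ?_⟩
    · refine (hb.1 x₁).trans ?_
      refine (le_of_eq ?_).trans (SSEP.add_le_mul_add (a := 2 * A) (b := A) (by linarith)
        (by linarith) (by positivity) hD')
      ring
    · refine (hb.2.1 x₁ x₂ h12).trans ?_
      calc _ ≤ A * (2 / n ^ 3 + (1 + 2) / n * SSEP.decay n s t ^ ((d : ℝ) / 2)) := by gcongr
        _ = 2 * A * (1 / n ^ 3) + 3 * A * (1 / n * SSEP.decay n s t ^ ((d : ℝ) / 2)) := by ring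
        _ ≤ _ := SSEP.add_le_mul_add (by linarith) (by linarith) (by positivity) (by positivity)
    · refine (hb.2.2 x₁ x₂ x₃ h12 h13 h23).trans ?_
      calc _ ≤ A * (2 ^ 2 / n ^ 4 +
            (1 + 2) * 2 / n ^ 2 * SSEP.decay n s t ^ ((d : ℝ) / 2)) := by gcongr
        _ = 4 * A * (1 / n ^ 4) + 6 * A * (1 / n ^ 2 * SSEP.decay n s t ^ ((d : ℝ) / 2)) := by ring
        _ ≤ _ := SSEP.add_le_mul_add (by linarith) (by linarith) (by positivity) (by positivity)
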